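/- Let $G$ be a finite group and $R$ a commutative ring with unit. Write ${}^gH=gHg^{-1}$ and $H^g=g^{-1}Hg$. **Mackey functors.** Let $\Omega_R(G)$ be the category whose objects are the finite $G$-sets and whose morphism modules are $\hom(X,Y)=R\otimes_{\mathbb N}\hom_{\omega(G)}(X,Y)$. Here $\hom_{\omega(G)}(X,Y)$ is the additive monoid, under disjoint union, of isomorphism classes of spans $X\leftarrow V\to Y$ of finite $G$-sets; composition is by pullback. For an equivariant map $f\colon X\to Y$ put $r_f=(X=X\to Y)$ and $t_f=(Y\leftarrow X=X)$. A Mackey functor is an $R$-linear functor $\Omega_R(G)^{op}\to R\text{-mod}$. These functors form a category $\mathcal A$. The box product $M\square N$ in $\mathcal A$ is the left Kan extension of $(X,Y)\mapsto M(X)\otimes_R N(Y)$ along the cartesian product functor $\Omega_R(G)^{op}\times\Omega_R(G)^{op}\to\Omega_R(G)^{op}$. Write $m\boxtimes n\in (M\square N)(X\times Y)$ for the image of $m\otimes n$ under the universal map. The unit is $B^G=\hom_{\Omega_R(G)}(-,G/G)$. **Modules over the Mackey algebra.** Let $\mu_R(G)=\bigoplus_{H,K\le G}\hom_{\Omega_R(G)}(G/H,G/K)$,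 with $x\cdot y$ the composite ($x$ first, then $y$), or $0$ if $x$ and $y$ are not composable. Let $\mathcal B$ be the category of left $\mu_R(G)$-modules. For $K\le H$ and $g\in G$ put $$R^H_K=(G/K=G/K\to G/H),\qquad I^H_K=(G/H\leftarrow G/K=G/K),\qquad C_{g,H}=(G/{}^gH\xleftarrow{\,kH\mapsto kg^{-1}\,{}^gH\,}G/H=G/H).$$ For $M,N\in\mathcal B$ define $R$-modules recursively by $$A_H=(I^H_HM\otimes_R I^H_HN)\oplus\bigoplus_{K<H}I^H_KA_K,$$ where $I^H_KA_K$ is a copy of $A_K$, and put $A=\bigoplus_{H\le G}A_H$. Define $R$-linear operators on $A$, each zero on the grades not mentioned, as follows. * $I^L_H\colon A_H\to A_L$ is the identity if $H=L$, and the inclusion of the copy if $H<L$. * $C_{g,H}\colon A_H\to A_{{}^gH}$ is given by $C_{g,H}(m\otimes n)=C_{g,H}m\otimes C_{g,H}n$ and $C_{g,H}I^H_Kx=I^{{}^gH}_{{}^gK}C_{g,K}x$. * $R^H_J\colon A_H\to A_J$ is given by $R^H_J(m\otimes n)=R^H_Jm\otimes R^H_Jn$ and $R^H_JI^H_Kx=\sum_{g\in[J\backslash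 H/K]}I^J_{{}^gK\cap J}C_gR^K_{K\cap J^g}x$, for chosen double coset representatives. The Frobenius reciprocity elements are $$a\otimes I^H_Kb-I^H_K(R^H_Ka\otimes b),\qquad I^H_Kc\otimes d-I^H_K(c\otimes R^H_Kd)$$ for $K<H$, $a\in I^H_HM$, $b\in I^K_KN$, $c\in I^K_KM$, $d\in I^H_HN$. The box product $M\square N$ in $\mathcal B$ is the universal left $\mu_R(G)$-module with an $R$-linear map $A\to M\square N$ that kills the Frobenius reciprocity elements and carries the operators $I,C,R$ on $A$ to multiplication by the elements $I,C,R$ of $\mu_R(G)$. In other words, one divides $A$ by Frobenius reciprocity and by the relations of $\mu_R(G)$. Write $[m\otimes n]$ for the image of $m\otimes n\in I^H_HM\otimes_R I^H_HN$. The unit is $U=\bigoplus_{H\le G}\hom_{\Omega_R(G)}(G/H,G/G)$. Put $n_H=(G/H=G/H\to G/G)\in U$. **Theorem.** 1. The functor $\Phi\colon\mathcal A\to\mathcal B$, $M\mapsto\bigoplus_{H\le G}M(G/H)$, is an equivalence of categories. For all $M,N\in\mathcal B$ the canonical map $A\to M\square N$ is surjective. 2. The Kan extension $M\square N$ exists,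 and is again a Mackey functor, for all $M,N\in\mathcal A$. For any choice of these Kan extensions, $(\mathcal A,\square,B^G)$ is a symmetric monoidal category whose associativity, unit and symmetry isomorphisms satisfy $$(m\boxtimes n)\boxtimes p\mapsto r_\alpha\bigl(m\boxtimes(n\boxtimes p)\bigr),\quad \mathrm{id}_{G/G}\boxtimes m\mapsto r_{\mathrm{pr}_2}m,\quad m\boxtimes\mathrm{id}_{G/G}\mapsto r_{\mathrm{pr}_1}m,\quad m\boxtimes n\mapsto r_\tau(n\boxtimes m),$$ where $\alpha\colon (X\times Y)\times Z\to X\times(Y\times Z)$ and $\tau\colon X\times Y\to Y\times X$ are the canonical bijections, and $\mathrm{pr}_1,\mathrm{pr}_2$ are the projections $X\times G/G\to X$ and $G/G\times X\to X$. 3. $(\mathcal B,\square,U)$ is a symmetric monoidal category whose associativity, unit and symmetry isomorphisms satisfy $$[[m\otimes n]\otimes p]\mapsto[m\otimes[n\otimes p]],\quad[n_H\otimes m]\mapsto m,\quad[m\otimes n_H]\mapsto m,\quad[m\otimes n]\mapsto[n\otimes m].$$ 4. With these structures $\Phi$ is a (strong) symmetric monoidal functor, hence a symmetric monoidal equivalence.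 In particular there is an isomorphism $\Phi M\square\Phi N\cong\Phi(M\square N)$, natural in $M,N\in\mathcal A$. It sends $[m\otimes n]$, for $m\in M(G/H)$ and $n\in N(G/H)$, to $r_\Delta(m\boxtimes n)\in(M\square N)(G/H)$, where $\Delta\colon G/H\to G/H\times G/H$ is the diagonal. The compatible isomorphism of units $U=\bigoplus_H\hom_{\Omega_R(G)}(G/H,G/G)\to\Phi(B^G)$ is the identity in each grade. -/

import Mathlib

open CategoryTheory Opposite
open scoped TensorProduct Pointwise

universe u

namespace MackeyBox

/-! ### Finite `G`-sets and spans -/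

/-- A finite `G`-set. -/
structure FinGSet (G : Type u) [Group G] where
  carrier : Type u
  [action : MulAction G carrier]
  [finite : Finite carrier]

namespace FinGSet

variable {G : Type u} [Group G]

instance : CoeSort (FinGSet G) (Type u) := ⟨FinGSet.carrier⟩

attribute [instance] FinGSet.action FinGSet.finite

/-- The cartesian product with the diagonal action. -/
def prod (X Y : FinGSet G) : FinGSet G := ⟨X × Y⟩

/-- The disjoint union. -/
def sum (X Y : FinGSet G) : FinGSet G := ⟨X ⊕ Y⟩

/-- The empty `G`-set. -/
def empty (G : Type u) [Group G] : FinGSet G :=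
  letI : MulAction G PEmpty.{u + 1} :=
    { smul := fun _ x => x, one_smul := fun _ => rfl, mul_smul := fun _ _ _ => rfl }
  ⟨PEmpty.{u + 1}⟩

/-- The orbit `G/H`. -/
def orbit [Finite G] (H : Subgroup G) : FinGSet G := ⟨G ⧸ H⟩

/-- The explicit pullback `{(v, w) | f v = g w}`. -/
def pullback {V W Y : FinGSet G} (f : V →[G] Y) (g : W →[G] Y) : FinGSet G :=
  letI : MulAction G {p : V × W // f p.1 = g p.2} :=
    { smul := fun a p => ⟨a • p.1, by simp [p.2]⟩
      one_smul := fun p => Subtype.ext (one_smul G p.1)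
      mul_smul := fun a b p => Subtype.ext (mul_smul a b p.1) }
  ⟨{p : V × W // f p.1 = g p.2}⟩

/-- The equivariant map `kH ↦ kH'` for `H ≤ H'`. -/
def proj [Finite G] {K H : Subgroup G} (h : K ≤ H) : orbit K →[G] orbit H where
  toFun := Quotient.map' id (fun a b hab => by
    rw [QuotientGroup.leftRel_apply] at hab ⊢
    exact h hab)
  map_smul' := by
    rintro a ⟨b⟩
    rfl

/-- The equivariant map `c_{g,H} : G/H → G/ᵍH`, `kH ↦ (k g⁻¹) ᵍH`, where `ᵍH = g H g⁻¹`. -/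
def conj [Finite G] (g : G) (H : Subgroup G) : orbit H →[G] orbit (MulAut.conj g • H) where
  toFun := Quotient.map' (fun k => k * g⁻¹) (fun a b hab => by
    rw [QuotientGroup.leftRel_apply] at hab ⊢
    refine (Subgroup.mem_smul_pointwise_iff_exists _ _ _).2 ⟨a⁻¹ * b, hab, ?_⟩
    simp [MulAut.conj_apply, mul_assoc])
  map_smul' := by
    rintro a ⟨b⟩
    exact congrArg Quotient.mk'' (mul_assoc a b g⁻¹)

/-- The first projection. -/
def fst (X Y : FinGSet G) : prod X Y →[G] X := ⟨Prod.fst, fun _ _ => rfl⟩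

/-- The second projection. -/
def snd (X Y : FinGSet G) : prod X Y →[G] Y := ⟨Prod.snd, fun _ _ => rfl⟩

/-- The swap map. -/
def swap (X Y : FinGSet G) : prod X Y →[G] prod Y X := ⟨Prod.swap, fun _ _ => rfl⟩

/-- The diagonal map. -/
def diag (X : FinGSet G) : X →[G] prod X X := ⟨fun x => (x, x), fun _ _ => rfl⟩

/-- The bijection `(X × Y) × Z → X × (Y × Z)`. -/
def assoc (X Y Z : FinGSet G) : prod (prod X Y) Z →[G] prod X (prod Y Z) :=
  ⟨fun p => (p.1.1, p.1.2, p.2), fun _ _ => rfl⟩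

end FinGSet

variable {G : Type u} [Group G]

/-- A diagram `X ← V → Y` of finite `G`-sets. -/
structure Span (X Y : FinGSet G) where
  apex : FinGSet G
  left : apex →[G] X
  right : apex →[G] Y

namespace Span

/-- Two diagrams `X ← V → Y` and `X ← V' → Y` are equivalent if there is an equivariant bijection
`V ≃ V'` over `X` and `Y`. -/
def Equivalent {X Y : FinGSet G} (S T : Span X Y) : Prop :=
  ∃ e : S.apex ≃ T.apex, (∀ (g : G) (v : S.apex), e (g • v) = g • e v) ∧
    (∀ v, T.left (e v) = S.left v) ∧ ∀ v, T.right (e v) = S.right v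

instance setoid (X Y : FinGSet G) : Setoid (Span X Y) where
  r := Equivalent
  iseqv :=
    { refl := fun S => ⟨Equiv.refl _, fun _ _ => rfl, fun _ => rfl, fun _ => rfl⟩
      symm := by
        rintro S T ⟨e, he, hl, hr⟩
        refine ⟨e.symm, fun g v => ?_, fun v => ?_, fun v => ?_⟩
        · rw [Equiv.symm_apply_eq, he, Equiv.apply_symm_apply]
        · rw [← hl, Equiv.apply_symm_apply]
        · rw [← hr, Equiv.apply_symm_apply]
      trans := by
        rintro S T U ⟨e, he, hl, hr⟩ ⟨f, hf, hl', hr'⟩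
        refine ⟨e.trans f, fun g v => ?_, fun v => ?_, fun v => ?_⟩
        · simp [he, hf]
        · simp [hl, hl']
        · simp [hr, hr'] }

/-- The identity span. -/
def id (X : FinGSet G) : Span X X := ⟨X, MulActionHom.id G, MulActionHom.id G⟩

/-- Composition of spans through the pullback. -/
def comp {X Y Z : FinGSet G} (S : Span X Y) (T : Span Y Z) : Span X Z where
  apex := FinGSet.pullback S.right T.left
  left := ⟨fun p => S.left p.1.1, fun g p => map_smul S.left g p.1.1⟩
  right := ⟨fun p => T.right p.1.2, fun g p => map_smul T.right g p.1.2⟩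

/-- Disjoint union of spans. -/
def add {X Y : FinGSet G} (S T : Span X Y) : Span X Y where
  apex := FinGSet.sum S.apex T.apex
  left := ⟨Sum.elim S.left T.left, by
    rintro g (v | v)
    · exact map_smul S.left g v
    · exact map_smul T.left g v⟩
  right := ⟨Sum.elim S.right T.right, by
    rintro g (v | v)
    · exact map_smul S.right g v
    · exact map_smul T.right g v⟩

/-- The empty span. -/
def zero (X Y : FinGSet G) : Span X Y where
  apex := FinGSet.empty G
  left := ⟨PEmpty.elim, fun _ x => x.elim⟩
  right := ⟨PEmpty.elim, fun _ x => x.elim⟩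

/-- Cartesian product of spans. -/
def prod {X Y X' Y' : FinGSet G} (S : Span X Y) (T : Span X' Y') :
    Span (X.prod X') (Y.prod Y') where
  apex := S.apex.prod T.apex
  left := ⟨Prod.map S.left T.left, fun g p =>
    Prod.ext (map_smul S.left g p.1) (map_smul T.left g p.2)⟩
  right := ⟨Prod.map S.right T.right, fun g p =>
    Prod.ext (map_smul S.right g p.1) (map_smul T.right g p.2)⟩

end Span

/-- The set `hom_{ω(G)}(X, Y)` of equivalence classes of spans. -/
def SpanClass (X Y : FinGSet G) : Type (u + 1) := Quotient (Span.setoid X Y)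

namespace SpanClass

/-- The class of a span. -/
def mk {X Y : FinGSet G} (S : Span X Y) : SpanClass X Y := Quotient.mk _ S

theorem sound {X Y : FinGSet G} {S T : Span X Y} (e : S.apex ≃ T.apex)
    (he : ∀ (g : G) (v : S.apex), e (g • v) = g • e v)
    (hl : ∀ v, T.left (e v) = S.left v) (hr : ∀ v, T.right (e v) = S.right v) : mk S = mk T :=
  Quotient.sound ⟨e, he, hl, hr⟩

theorem sound' {X Y : FinGSet G} {S T : Span X Y} (f : S.apex → T.apex) (f' : T.apex → S.apex)
    (h : ∀ v, f' (f v) = v) (h' : ∀ v, f (f' v) = v)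
    (he : ∀ (g : G) (v : S.apex), f (g • v) = g • f v)
    (hl : ∀ v, T.left (f v) = S.left v) (hr : ∀ v, T.right (f v) = S.right v) : mk S = mk T :=
  sound ⟨f, f', h, h'⟩ he hl hr

@[elab_as_elim]
theorem ind {X Y : FinGSet G} {p : SpanClass X Y → Prop} (h : ∀ S, p (mk S)) (s) : p s :=
  Quotient.ind h s

instance small (X Y : FinGSet G) : Small.{u} (SpanClass X Y) := by
  let F : (Σ n : ℕ, Σ _ : MulAction G (ULift.{u} (Fin n)),
      (ULift.{u} (Fin n) →[G] X) × (ULift.{u} (Fin n) →[G] Y)) → SpanClass X Y :=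
    fun a => letI := a.2.1; mk ⟨⟨ULift.{u} (Fin a.1)⟩, a.2.2.1, a.2.2.2⟩
  refine small_of_surjective (f := F) ?_
  intro s
  induction s using ind with
  | h S =>
    let e : S.apex ≃ ULift.{u} (Fin (Nat.card S.apex)) :=
      (Finite.equivFin S.apex).trans Equiv.ulift.symm
    let act : MulAction G (ULift.{u} (Fin (Nat.card S.apex))) :=
      { smul := fun g x => e (g • e.symm x)
        one_smul := fun x => by
          change e ((1 : G) • e.symm x) = x
          simp
        mul_smul := fun g h x => by
          change e ((g * h) • e.symm x) = e (g • e.symm (e (h • e.symm x)))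
          simp [mul_smul] }
    have hs : ∀ (g : G) (x : ULift.{u} (Fin (Nat.card S.apex))),
        e.symm (g • x) = g • e.symm x := fun g x => by
      change e.symm (e (g • e.symm x)) = _
      simp
    refine ⟨⟨Nat.card S.apex, act, ⟨fun x => S.left (e.symm x), fun g x => ?_⟩,
      ⟨fun x => S.right (e.symm x), fun g x => ?_⟩⟩, ?_⟩
    · rw [hs]; simp
    · rw [hs]; simp
    · exact sound e.symm hs (fun _ => rfl) (fun _ => rfl)

instance {X Y : FinGSet G} : Zero (SpanClass X Y) := ⟨mk (Span.zero X Y)⟩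

instance {X Y : FinGSet G} : Add (SpanClass X Y) :=
  ⟨Quotient.map₂ Span.add (by
    rintro S S' ⟨e, he, hl, hr⟩ T T' ⟨f, hf, hl', hr'⟩
    refine ⟨Equiv.sumCongr e f, ?_, ?_, ?_⟩
    · rintro g (v | v)
      · exact congrArg Sum.inl (he g v)
      · exact congrArg Sum.inr (hf g v)
    · rintro (v | v)
      · exact hl v
      · exact hl' v
    · rintro (v | v)
      · exact hr v
      · exact hr' v)⟩

theorem mk_add {X Y : FinGSet G} (S T : Span X Y) : mk S + mk T = mk (S.add T) := rfl

theorem zero_def {X Y : FinGSet G} : (0 : SpanClass X Y) = mk (Span.zero X Y) := rfl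

instance {X Y : FinGSet G} : AddCommMonoid (SpanClass X Y) where
  add_assoc a b c := by
    induction a using ind with | h S => ?_
    induction b using ind with | h T => ?_
    induction c using ind with | h U => ?_
    refine sound (Equiv.sumAssoc _ _ _) ?_ ?_ ?_
    · rintro g ((v | v) | v) <;> rfl
    · rintro ((v | v) | v) <;> rfl
    · rintro ((v | v) | v) <;> rfl
  zero_add a := by
    induction a using ind with | h S => ?_
    refine sound (Equiv.emptySum PEmpty S.apex) ?_ ?_ ?_
    · rintro g (v | v)
      · exact v.elim
      · rfl
    · rintro (v | v)
      · exact v.elim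
      · rfl
    · rintro (v | v)
      · exact v.elim
      · rfl
  add_zero a := by
    induction a using ind with | h S => ?_
    refine sound (Equiv.sumEmpty S.apex PEmpty) ?_ ?_ ?_
    · rintro g (v | v)
      · rfl
      · exact v.elim
    · rintro (v | v)
      · rfl
      · exact v.elim
    · rintro (v | v)
      · rfl
      · exact v.elim
  add_comm a b := by
    induction a using ind with | h S => ?_
    induction b using ind with | h T => ?_
    refine sound (Equiv.sumComm _ _) ?_ ?_ ?_
    · rintro g (v | v) <;> rfl
    · rintro (v | v) <;> rfl
    · rintro (v | v) <;> rfl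
  nsmul := nsmulRec

/-- Composition of classes of spans. -/
def compFun {X Y Z : FinGSet G} : SpanClass X Y → SpanClass Y Z → SpanClass X Z :=
  Quotient.map₂ Span.comp (by
    rintro S S' ⟨e, he, hl, hr⟩ T T' ⟨f, hf, hl', hr'⟩
    refine ⟨Equiv.subtypeEquiv (Equiv.prodCongr e f) ?_, ?_, ?_, ?_⟩
    · rintro ⟨v, w⟩
      change S.right v = T.left w ↔ S'.right (e v) = T'.left (f w)
      rw [hr, hl']
    · rintro g ⟨⟨v, w⟩, h⟩
      exact Subtype.ext (Prod.ext (he g v) (hf g w))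
    · rintro ⟨⟨v, w⟩, h⟩
      exact hl v
    · rintro ⟨⟨v, w⟩, h⟩
      exact hr' w)

theorem mk_comp {X Y Z : FinGSet G} (S : Span X Y) (T : Span Y Z) :
    compFun (mk S) (mk T) = mk (S.comp T) := rfl

theorem add_compFun {X Y Z : FinGSet G} (a b : SpanClass X Y) (c : SpanClass Y Z) :
    compFun (a + b) c = compFun a c + compFun b c := by
  induction a using ind with | h S => ?_
  induction b using ind with | h T => ?_
  induction c using ind with | h U => ?_
  refine sound'
    (fun p => match p with
      | ⟨(.inl v, w), h⟩ => .inl ⟨(v, w), h⟩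
      | ⟨(.inr v, w), h⟩ => .inr ⟨(v, w), h⟩)
    (fun p => match p with
      | .inl ⟨(v, w), h⟩ => ⟨(.inl v, w), h⟩
      | .inr ⟨(v, w), h⟩ => ⟨(.inr v, w), h⟩) ?_ ?_ ?_ ?_ ?_
  · rintro ⟨⟨v | v, w⟩, h⟩ <;> rfl
  · rintro (⟨⟨v, w⟩, h⟩ | ⟨⟨v, w⟩, h⟩) <;> rfl
  · rintro g ⟨⟨v | v, w⟩, h⟩ <;> rfl
  · rintro ⟨⟨v | v, w⟩, h⟩ <;> rfl
  · rintro ⟨⟨v | v, w⟩, h⟩ <;> rfl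

theorem compFun_add {X Y Z : FinGSet G} (a : SpanClass X Y) (b c : SpanClass Y Z) :
    compFun a (b + c) = compFun a b + compFun a c := by
  induction a using ind with | h S => ?_
  induction b using ind with | h T => ?_
  induction c using ind with | h U => ?_
  refine sound'
    (fun p => match p with
      | ⟨(w, .inl v), h⟩ => .inl ⟨(w, v), h⟩
      | ⟨(w, .inr v), h⟩ => .inr ⟨(w, v), h⟩)
    (fun p => match p with
      | .inl ⟨(w, v), h⟩ => ⟨(w, .inl v), h⟩
      | .inr ⟨(w, v), h⟩ => ⟨(w, .inr v), h⟩) ?_ ?_ ?_ ?_ ?_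
  · rintro ⟨⟨w, v | v⟩, h⟩ <;> rfl
  · rintro (⟨⟨w, v⟩, h⟩ | ⟨⟨w, v⟩, h⟩) <;> rfl
  · rintro g ⟨⟨w, v | v⟩, h⟩ <;> rfl
  · rintro ⟨⟨w, v | v⟩, h⟩ <;> rfl
  · rintro ⟨⟨w, v | v⟩, h⟩ <;> rfl

theorem zero_compFun {X Y Z : FinGSet G} (c : SpanClass Y Z) :
    compFun (0 : SpanClass X Y) c = 0 := by
  induction c using ind with | h U => ?_
  exact sound' (fun p => p.1.1.elim) (fun p => p.elim) (fun p => p.1.1.elim) (fun p => p.elim)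
    (fun _ p => p.1.1.elim) (fun p => p.1.1.elim) (fun p => p.1.1.elim)

theorem compFun_zero {X Y Z : FinGSet G} (c : SpanClass X Y) :
    compFun c (0 : SpanClass Y Z) = 0 := by
  induction c using ind with | h U => ?_
  exact sound' (fun p => p.1.2.elim) (fun p => p.elim) (fun p => p.1.2.elim) (fun p => p.elim)
    (fun _ p => p.1.2.elim) (fun p => p.1.2.elim) (fun p => p.1.2.elim)

theorem id_compFun {X Y : FinGSet G} (c : SpanClass X Y) : compFun (mk (Span.id X)) c = c := by
  induction c using ind with | h U => ?_
  refine sound' (fun p => p.1.2) (fun w => ⟨(U.left w, w), rfl⟩) ?_ ?_ ?_ ?_ ?_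
  · rintro ⟨⟨x, w⟩, h⟩
    exact Subtype.ext (Prod.ext h.symm rfl)
  · intro w; rfl
  · intro g p; rfl
  · rintro ⟨⟨x, w⟩, h⟩
    exact h.symm
  · intro p; rfl

theorem compFun_id {X Y : FinGSet G} (c : SpanClass X Y) : compFun c (mk (Span.id Y)) = c := by
  induction c using ind with | h U => ?_
  refine sound' (fun p => p.1.1) (fun w => ⟨(w, U.right w), rfl⟩) ?_ ?_ ?_ ?_ ?_
  · rintro ⟨⟨x, w⟩, h⟩
    exact Subtype.ext (Prod.ext rfl h)
  · intro w; rfl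
  · intro g p; rfl
  · intro p; rfl
  · rintro ⟨⟨x, w⟩, h⟩
    exact h

theorem compFun_assoc {X Y Z W : FinGSet G} (a : SpanClass X Y) (b : SpanClass Y Z)
    (c : SpanClass Z W) : compFun (compFun a b) c = compFun a (compFun b c) := by
  induction a using ind with | h S => ?_
  induction b using ind with | h T => ?_
  induction c using ind with | h U => ?_
  exact sound'
    (fun p => ⟨(p.1.1.1.1, ⟨(p.1.1.1.2, p.1.2), p.2⟩), p.1.1.2⟩)
    (fun p => ⟨(⟨(p.1.1, p.1.2.1.1), p.2⟩, p.1.2.1.2), p.1.2.2⟩)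
    (fun _ => rfl) (fun _ => rfl) (fun _ _ => rfl) (fun _ => rfl) (fun _ => rfl)

/-- Composition of classes of spans, as a biadditive map. -/
def comp (X Y Z : FinGSet G) : SpanClass X Y →+ SpanClass Y Z →+ SpanClass X Z where
  toFun a :=
    { toFun := compFun a
      map_zero' := compFun_zero a
      map_add' := compFun_add a }
  map_zero' := AddMonoidHom.ext zero_compFun
  map_add' a b := AddMonoidHom.ext (add_compFun a b)

/-- The cartesian product of classes of spans. -/
def prodFun {X Y X' Y' : FinGSet G} :
    SpanClass X Y → SpanClass X' Y' → SpanClass (X.prod X') (Y.prod Y') :=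
  Quotient.map₂ Span.prod (by
    rintro S S' ⟨e, he, hl, hr⟩ T T' ⟨f, hf, hl', hr'⟩
    refine ⟨Equiv.prodCongr e f, ?_, ?_, ?_⟩
    · rintro g ⟨v, w⟩
      exact Prod.ext (he g v) (hf g w)
    · rintro ⟨v, w⟩
      exact Prod.ext (hl v) (hl' w)
    · rintro ⟨v, w⟩
      exact Prod.ext (hr v) (hr' w))

theorem mk_prod {X Y X' Y' : FinGSet G} (S : Span X Y) (T : Span X' Y') :
    prodFun (mk S) (mk T) = mk (S.prod T) := rfl

theorem add_prodFun {X Y X' Y' : FinGSet G} (a b : SpanClass X Y) (c : SpanClass X' Y') :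
    prodFun (a + b) c = prodFun a c + prodFun b c := by
  induction a using ind with | h S => ?_
  induction b using ind with | h T => ?_
  induction c using ind with | h U => ?_
  refine sound (Equiv.sumProdDistrib _ _ _) ?_ ?_ ?_
  · rintro g ⟨v | v, w⟩ <;> rfl
  · rintro ⟨v | v, w⟩ <;> rfl
  · rintro ⟨v | v, w⟩ <;> rfl

theorem prodFun_add {X Y X' Y' : FinGSet G} (a : SpanClass X Y) (b c : SpanClass X' Y') :
    prodFun a (b + c) = prodFun a b + prodFun a c := by
  induction a using ind with | h S => ?_
  induction b using ind with | h T => ?_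
  induction c using ind with | h U => ?_
  refine sound (Equiv.prodSumDistrib _ _ _) ?_ ?_ ?_
  · rintro g ⟨w, v | v⟩ <;> rfl
  · rintro ⟨w, v | v⟩ <;> rfl
  · rintro ⟨w, v | v⟩ <;> rfl

theorem zero_prodFun {X Y X' Y' : FinGSet G} (c : SpanClass X' Y') :
    prodFun (0 : SpanClass X Y) c = 0 := by
  induction c using ind with | h U => ?_
  exact sound' (fun p => p.1.elim) (fun p => p.elim) (fun p => p.1.elim) (fun p => p.elim)
    (fun _ p => p.1.elim) (fun p => p.1.elim) (fun p => p.1.elim)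

theorem prodFun_zero {X Y X' Y' : FinGSet G} (c : SpanClass X Y) :
    prodFun c (0 : SpanClass X' Y') = 0 := by
  induction c using ind with | h U => ?_
  exact sound' (fun p => p.2.elim) (fun p => p.elim) (fun p => p.2.elim) (fun p => p.elim)
    (fun _ p => p.2.elim) (fun p => p.2.elim) (fun p => p.2.elim)

theorem prodFun_id (X Y : FinGSet G) :
    prodFun (mk (Span.id X)) (mk (Span.id Y)) = mk (Span.id (X.prod Y)) := rfl

theorem prodFun_comp {X Y Z X' Y' Z' : FinGSet G} (a : SpanClass X Y) (b : SpanClass Y Z)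
    (a' : SpanClass X' Y') (b' : SpanClass Y' Z') :
    prodFun (compFun a b) (compFun a' b') = compFun (prodFun a a') (prodFun b b') := by
  induction a using ind with | h S => ?_
  induction b using ind with | h T => ?_
  induction a' using ind with | h S' => ?_
  induction b' using ind with | h T' => ?_
  exact sound'
    (fun p => ⟨((p.1.1.1, p.2.1.1), (p.1.1.2, p.2.1.2)), Prod.ext p.1.2 p.2.2⟩)
    (fun p => (⟨(p.1.1.1, p.1.2.1), congrArg Prod.fst p.2⟩,
      ⟨(p.1.1.2, p.1.2.2), congrArg Prod.snd p.2⟩))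
    (fun _ => rfl) (fun _ => rfl) (fun _ _ => rfl) (fun _ => rfl) (fun _ => rfl)

/-- The cartesian product of classes of spans, as a biadditive map. -/
def prod (X Y X' Y' : FinGSet G) :
    SpanClass X Y →+ SpanClass X' Y' →+ SpanClass (X.prod X') (Y.prod Y') where
  toFun a :=
    { toFun := prodFun a
      map_zero' := prodFun_zero a
      map_add' := prodFun_add a }
  map_zero' := AddMonoidHom.ext zero_prodFun
  map_add' a b := AddMonoidHom.ext (add_prodFun a b)

end SpanClass

/-! ### The category `Ω_R(G)` -/

/-- The monoid `hom_{ω(G)}(X, Y)`, moved to the universe of `G`. -/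
abbrev SmallSpanClass (X Y : FinGSet G) : Type u := Shrink.{u} (SpanClass X Y)

namespace SmallSpanClass

/-- The bilinear map over `ℕ` attached to a biadditive map of classes of spans. -/
noncomputable def lift₂ {X Y X' Y' X'' Y'' : FinGSet G}
    (f : SpanClass X Y →+ SpanClass X' Y' →+ SpanClass X'' Y'') :
    SmallSpanClass X Y →ₗ[ℕ] SmallSpanClass X' Y' →ₗ[ℕ] SmallSpanClass X'' Y'' :=
  LinearMap.mk₂ ℕ
    (fun a b => (equivShrink _) (f ((equivShrink _).symm a) ((equivShrink _).symm b)))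
    (fun a a' b => by rw [equivShrink_symm_add, map_add, AddMonoidHom.add_apply, equivShrink_add])
    (fun n a b => by
      have h : ∀ x : SpanClass X'' Y'', (equivShrink _) (n • x) = n • (equivShrink _) x :=
        fun x => map_nsmul (Shrink.addEquiv (α := SpanClass X'' Y'')).symm n x
      have h' : (equivShrink (SpanClass X Y)).symm (n • a) = n • (equivShrink _).symm a :=
        map_nsmul (Shrink.addEquiv (α := SpanClass X Y)) n a
      rw [← h, h', map_nsmul, AddMonoidHom.nsmul_apply])
    (fun a b b' => by rw [equivShrink_symm_add, map_add, equivShrink_add])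
    (fun n a b => by
      have h : ∀ x : SpanClass X'' Y'', (equivShrink _) (n • x) = n • (equivShrink _) x :=
        fun x => map_nsmul (Shrink.addEquiv (α := SpanClass X'' Y'')).symm n x
      have h' : (equivShrink (SpanClass X' Y')).symm (n • b) = n • (equivShrink _).symm b :=
        map_nsmul (Shrink.addEquiv (α := SpanClass X' Y')) n b
      rw [← h, h', map_nsmul])

theorem lift₂_apply {X Y X' Y' X'' Y'' : FinGSet G}
    (f : SpanClass X Y →+ SpanClass X' Y' →+ SpanClass X'' Y'') (a : SpanClass X Y)
    (b : SpanClass X' Y') :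
    lift₂ f (equivShrink _ a) (equivShrink _ b) = equivShrink _ (f a b) := by
  simp [lift₂]

end SmallSpanClass

variable (R : Type u) [CommRing R]

/-- `hom_{Ω_R(G)}(X, Y) = R ⊗_ℕ hom_{ω(G)}(X, Y)`. -/
def OmegaHom (X Y : FinGSet G) : Type u := R ⊗[ℕ] SmallSpanClass X Y

namespace OmegaHom

noncomputable instance (X Y : FinGSet G) : AddCommGroup (OmegaHom R X Y) :=
  letI : AddCommMonoid (OmegaHom R X Y) :=
    inferInstanceAs (AddCommMonoid (R ⊗[ℕ] SmallSpanClass X Y))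
  letI : Module R (OmegaHom R X Y) := inferInstanceAs (Module R (R ⊗[ℕ] SmallSpanClass X Y))
  Module.addCommMonoidToAddCommGroup R

noncomputable instance (X Y : FinGSet G) : Module R (OmegaHom R X Y) :=
  inferInstanceAs (Module R (R ⊗[ℕ] SmallSpanClass X Y))

/-- The morphism `r · [S]`. -/
noncomputable def mk {X Y : FinGSet G} (r : R) (s : SpanClass X Y) : OmegaHom R X Y :=
  r ⊗ₜ[ℕ] (equivShrink _ s)

variable {R}

@[elab_as_elim]
theorem ind {X Y : FinGSet G} {p : OmegaHom R X Y → Prop} (h0 : p 0)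
    (h : ∀ r s, p (mk R r s)) (hadd : ∀ a b, p a → p b → p (a + b)) (a) : p a := by
  refine TensorProduct.induction_on (motive := p) a h0 (fun r s => ?_) hadd
  have := h r ((equivShrink _).symm s)
  rwa [mk, Equiv.apply_symm_apply] at this

theorem smul_mk {X Y : FinGSet G} (r r' : R) (s : SpanClass X Y) :
    r • mk R r' s = mk R (r * r') s := rfl

/-- The base change to `R` of a bilinear map over `ℕ`. -/
noncomputable def baseChange₂ {A B C : Type u} [AddCommMonoid A] [AddCommMonoid B]
    [AddCommMonoid C] (f : A →ₗ[ℕ] B →ₗ[ℕ] C) :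
    R ⊗[ℕ] A →ₗ[R] R ⊗[ℕ] B →ₗ[R] R ⊗[ℕ] C :=
  LinearMap.liftBaseChange R
    ((LinearMap.liftBaseChangeEquiv R (M := B) (N := R ⊗[ℕ] C)).toLinearMap.restrictScalars ℕ ∘ₗ
      f.compr₂ (TensorProduct.mk ℕ R C 1))

theorem baseChange₂_tmul {A B C : Type u} [AddCommMonoid A] [AddCommMonoid B]
    [AddCommMonoid C] (f : A →ₗ[ℕ] B →ₗ[ℕ] C) (r r' : R) (a : A) (b : B) :
    baseChange₂ f (r ⊗ₜ a) (r' ⊗ₜ b) = (r * r') ⊗ₜ f a b := by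
  change r • r' • ((1 : R) ⊗ₜ[ℕ] f a b) = _
  simp [TensorProduct.smul_tmul']

/-- The `R`-bilinear extension of a biadditive map of classes of spans. -/
noncomputable def lift₂ {X Y X' Y' X'' Y'' : FinGSet G}
    (f : SpanClass X Y →+ SpanClass X' Y' →+ SpanClass X'' Y'') :
    OmegaHom R X Y →ₗ[R] OmegaHom R X' Y' →ₗ[R] OmegaHom R X'' Y'' :=
  baseChange₂ (SmallSpanClass.lift₂ f)

theorem lift₂_mk {X Y X' Y' X'' Y'' : FinGSet G}
    (f : SpanClass X Y →+ SpanClass X' Y' →+ SpanClass X'' Y'') (r r' : R) (s : SpanClass X Y)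
    (s' : SpanClass X' Y') : lift₂ f (mk R r s) (mk R r' s') = mk R (r * r') (f s s') := by
  refine (baseChange₂_tmul _ r r' _ _).trans ?_
  rw [SmallSpanClass.lift₂_apply]
  rfl

end OmegaHom

/-- The category `Ω_R(G)`: its objects are the finite `G`-sets. -/
@[nolint unusedArguments]
def Omega (R : Type u) [CommRing R] (G : Type u) [Group G] : Type (u + 1) := FinGSet G

namespace Omega

/-- A finite `G`-set as an object of `Ω_R(G)`. -/
def of (X : FinGSet G) : Omega R G := X

/-- The underlying finite `G`-set. -/
def gset {R : Type u} [CommRing R] (X : Omega R G) : FinGSet G := X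

noncomputable instance : Category.{u} (Omega R G) where
  Hom X Y := OmegaHom R X.gset Y.gset
  id X := OmegaHom.mk R 1 (SpanClass.mk (Span.id X.gset))
  comp f g := OmegaHom.lift₂ (SpanClass.comp _ _ _) f g
  id_comp f := by
    induction f using OmegaHom.ind with
    | h0 => rw [map_zero]
    | hadd a b h h' => rw [map_add, h, h']
    | h r s => rw [OmegaHom.lift₂_mk, one_mul]; exact congrArg _ (SpanClass.id_compFun s)
  comp_id f := by
    induction f using OmegaHom.ind with
    | h0 => rw [LinearMap.map_zero₂]
    | hadd a b h h' => rw [LinearMap.map_add₂, h, h']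
    | h r s => rw [OmegaHom.lift₂_mk, mul_one]; exact congrArg _ (SpanClass.compFun_id s)
  assoc f g k := by
    induction f using OmegaHom.ind with
    | h0 => simp only [map_zero, LinearMap.zero_apply]
    | hadd a b h h' => simp only [map_add, LinearMap.add_apply, h, h']
    | h r s =>
      induction g using OmegaHom.ind with
      | h0 => simp only [map_zero, LinearMap.zero_apply]
      | hadd a b h h' => simp only [map_add, LinearMap.add_apply, h, h']
      | h r' s' =>
        induction k using OmegaHom.ind with
        | h0 => simp only [map_zero]
        | hadd a b h h' => simp only [map_add, h, h']
        | h r'' s'' =>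
          rw [OmegaHom.lift₂_mk, OmegaHom.lift₂_mk, OmegaHom.lift₂_mk, OmegaHom.lift₂_mk,
            mul_assoc]
          exact congrArg _ (SpanClass.compFun_assoc s s' s'')

variable {R}

/-- A class of spans as a morphism. -/
noncomputable def homOfSpan {X Y : FinGSet G} (S : Span X Y) : of R X ⟶ of R Y :=
  OmegaHom.mk R 1 (SpanClass.mk S)

noncomputable instance (X Y : Omega R G) : AddCommGroup (X ⟶ Y) :=
  inferInstanceAs (AddCommGroup (OmegaHom R X.gset Y.gset))

noncomputable instance (X Y : Omega R G) : Module R (X ⟶ Y) :=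
  inferInstanceAs (Module R (OmegaHom R X.gset Y.gset))

/-- Composition as a bilinear map. -/
noncomputable def compL (X Y Z : Omega R G) : (X ⟶ Y) →ₗ[R] (Y ⟶ Z) →ₗ[R] (X ⟶ Z) :=
  OmegaHom.lift₂ (SpanClass.comp X.gset Y.gset Z.gset)

noncomputable instance : Preadditive (Omega R G) where
  homGroup _ _ := inferInstance
  add_comp _ _ _ f f' g := LinearMap.map_add₂ (compL _ _ _) f f' g
  comp_add _ _ _ f g g' := map_add (compL _ _ _ f) g g'

noncomputable instance : Linear R (Omega R G) where
  homModule _ _ := inferInstance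
  smul_comp _ _ _ r f g := LinearMap.map_smul₂ (compL _ _ _) r f g
  comp_smul _ _ _ f r g := map_smul (compL _ _ _ f) r g

/-- The product of two morphisms, `R`-bilinear and given on spans by the cartesian product. -/
noncomputable def prodMap {X Y X' Y' : Omega R G} (f : X ⟶ Y) (g : X' ⟶ Y') :
    of R (X.gset.prod X'.gset) ⟶ of R (Y.gset.prod Y'.gset) :=
  OmegaHom.lift₂ (SpanClass.prod _ _ _ _) f g

theorem prodMap_id (X X' : Omega R G) :
    prodMap (𝟙 X) (𝟙 X') = 𝟙 (of R (X.gset.prod X'.gset)) := by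
  refine (OmegaHom.lift₂_mk _ _ _ _ _).trans ?_
  rw [one_mul]
  rfl

theorem prodMap_comp {X Y Z X' Y' Z' : Omega R G} (f : X ⟶ Y) (g : Y ⟶ Z) (f' : X' ⟶ Y')
    (g' : Y' ⟶ Z') : prodMap (f ≫ g) (f' ≫ g') = prodMap f f' ≫ prodMap g g' := by
  change OmegaHom.lift₂ _ (OmegaHom.lift₂ _ f g) (OmegaHom.lift₂ _ f' g') =
    OmegaHom.lift₂ (SpanClass.comp (X.gset.prod X'.gset) (Y.gset.prod Y'.gset)
      (Z.gset.prod Z'.gset)) (OmegaHom.lift₂ _ f f') (OmegaHom.lift₂ _ g g')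
  induction f using OmegaHom.ind with
  | h0 => simp only [map_zero, LinearMap.zero_apply]
  | hadd a b h h' => simp only [map_add, LinearMap.add_apply, h, h']
  | h r s =>
    induction g using OmegaHom.ind with
    | h0 => simp only [map_zero, LinearMap.zero_apply]
    | hadd a b h h' => simp only [map_add, LinearMap.add_apply, h, h']
    | h r' s' =>
      induction f' using OmegaHom.ind with
      | h0 => simp only [map_zero, LinearMap.zero_apply]
      | hadd a b h h' => simp only [map_add, LinearMap.add_apply, h, h']
      | h r₂ s₂ =>
        induction g' using OmegaHom.ind with
        | h0 => simp only [map_zero]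
        | hadd a b h h' => simp only [map_add, h, h']
        | h r₃ s₃ =>
          simp only [OmegaHom.lift₂_mk]
          rw [mul_mul_mul_comm]
          exact congrArg _ (SpanClass.prodFun_comp s s' s₂ s₃)

/-- The cartesian product functor `Ω_R(G)ᵒᵖ × Ω_R(G)ᵒᵖ ⥤ Ω_R(G)ᵒᵖ`. -/
noncomputable def prodFunctor : (Omega R G)ᵒᵖ × (Omega R G)ᵒᵖ ⥤ (Omega R G)ᵒᵖ where
  obj P := op (of R (P.1.unop.gset.prod P.2.unop.gset))
  map f := (prodMap f.1.unop f.2.unop).op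
  map_id _ := congrArg Quiver.Hom.op (prodMap_id _ _)
  map_comp _ _ := congrArg Quiver.Hom.op (prodMap_comp _ _ _ _)

/-- The restriction `r_f = (X = X → Y)` of an equivariant map `f : X → Y`. -/
noncomputable def res {X Y : FinGSet G} (f : X →[G] Y) : of R X ⟶ of R Y :=
  homOfSpan ⟨X, MulActionHom.id G, f⟩

/-- The transfer `t_f = (Y ← X = X)` of an equivariant map `f : X → Y`. -/
noncomputable def tr {X Y : FinGSet G} (f : X →[G] Y) : of R Y ⟶ of R X :=
  homOfSpan ⟨X, f, MulActionHom.id G⟩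

variable [Finite G]

variable (R)

/-- The orbit `G/H` as an object of `Ω_R(G)`. -/
abbrev orbit (H : Subgroup G) : Omega R G := of R (FinGSet.orbit H)

variable {R}

/-- `R^H_K = r_π = (G/K = G/K → G/H)`. -/
noncomputable def elR {K H : Subgroup G} (h : K ≤ H) : orbit R K ⟶ orbit R H :=
  res (FinGSet.proj h)

/-- `I^H_K = t_π = (G/H ← G/K = G/K)`. -/
noncomputable def elI {K H : Subgroup G} (h : K ≤ H) : orbit R H ⟶ orbit R K :=
  tr (FinGSet.proj h)

/-- `C_{g,H} = t_c = (G/ᵍH ← G/H = G/H)`. -/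
noncomputable def elC (g : G) (H : Subgroup G) : orbit R (MulAut.conj g • H) ⟶ orbit R H :=
  tr (FinGSet.conj g H)

end Omega

theorem conj_mono (g : G) {K H : Subgroup G} (h : K ≤ H) :
    MulAut.conj g • K ≤ MulAut.conj g • H :=
  Subgroup.pointwise_smul_le_pointwise_smul_iff.2 h

theorem conj_strictMono (g : G) {K H : Subgroup G} (h : K < H) :
    MulAut.conj g • K < MulAut.conj g • H :=
  lt_of_le_of_ne (conj_mono g h.le) fun e => h.ne (smul_left_cancel _ e)

theorem conj_inf_le (g : G) (J K : Subgroup G) :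
    MulAut.conj g • (K ⊓ MulAut.conj g⁻¹ • J) ≤ J := by
  refine (conj_mono g inf_le_right).trans_eq ?_
  rw [smul_smul, ← map_mul, mul_inv_cancel, map_one, one_smul]

/-! ### Mackey functors -/

/-- The condition that a functor `Ω_R(G)ᵒᵖ ⥤ R-mod` be `R`-additive, i.e. `R`-linear on
morphisms. -/
def IsRAdditive : ObjectProperty ((Omega R G)ᵒᵖ ⥤ ModuleCat.{u} R) := fun F =>
  (∀ (X Y : Omega R G) (f g : X ⟶ Y), F.map (f + g).op = F.map f.op + F.map g.op) ∧
    ∀ (X Y : Omega R G) (r : R) (f : X ⟶ Y), F.map (r • f).op = r • F.map f.op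

/-- The category of Mackey functors: `R`-additive functors `Ω_R(G)ᵒᵖ ⥤ R-mod` and natural
transformations. -/
abbrev MackeyFunctor (R : Type u) [CommRing R] (G : Type u) [Group G] : Type (u + 1) :=
  (IsRAdditive R (G := G)).FullSubcategory

variable {R}

/-- The value `M(X)` of a Mackey functor. -/
abbrev MackeyFunctor.val (M : MackeyFunctor R G) (X : FinGSet G) : ModuleCat.{u} R :=
  M.obj.obj (op (Omega.of R X))

/-- The map `M(Y) → M(X)` given by a morphism `X ⟶ Y` of `Ω_R(G)`. -/
noncomputable abbrev MackeyFunctor.act (M : MackeyFunctor R G) {X Y : FinGSet G}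
    (f : Omega.of R X ⟶ Omega.of R Y) : M.val Y →ₗ[R] M.val X :=
  (M.obj.map f.op).hom

theorem MackeyFunctor.act_id (M : MackeyFunctor R G) (X : FinGSet G) (m : M.val X) :
    M.act (𝟙 (Omega.of R X)) m = m := by
  have := M.obj.map_id (op (Omega.of R X))
  exact congrArg (fun f => f.hom m) this

theorem MackeyFunctor.act_comp (M : MackeyFunctor R G) {X Y Z : FinGSet G}
    (f : Omega.of R X ⟶ Omega.of R Y) (g : Omega.of R Y ⟶ Omega.of R Z) (m : M.val Z) :
    M.act (f ≫ g) m = M.act f (M.act g m) := by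
  have := M.obj.map_comp g.op f.op
  exact congrArg (fun f => f.hom m) this

theorem MackeyFunctor.act_add (M : MackeyFunctor R G) {X Y : FinGSet G}
    (f g : Omega.of R X ⟶ Omega.of R Y) (m : M.val Y) :
    M.act (f + g) m = M.act f m + M.act g m :=
  congrArg (fun f => f.hom m) (M.property.1 _ _ f g)

theorem MackeyFunctor.act_smul (M : MackeyFunctor R G) {X Y : FinGSet G} (r : R)
    (f : Omega.of R X ⟶ Omega.of R Y) (m : M.val Y) :
    M.act (r • f) m = r • M.act f m :=
  congrArg (fun f => f.hom m) (M.property.2 _ _ r f)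

/-- The map `f ↦ f · m`, `R`-linear in `f`. -/
noncomputable def MackeyFunctor.actL (M : MackeyFunctor R G) {X Y : FinGSet G} (m : M.val Y) :
    (Omega.of R X ⟶ Omega.of R Y) →ₗ[R] M.val X where
  toFun f := M.act f m
  map_add' f g := M.act_add f g m
  map_smul' r f := M.act_smul r f m

theorem MackeyFunctor.act_zero (M : MackeyFunctor R G) {X Y : FinGSet G} (m : M.val Y) :
    M.act (0 : Omega.of R X ⟶ Omega.of R Y) m = 0 := map_zero (M.actL m)

/-- The Burnside functor `B^G = hom_{Ω_R(G)}(-, G/G)`. -/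
noncomputable def burnside (R : Type u) [CommRing R] (G : Type u) [Group G] [Finite G] :
    MackeyFunctor R G where
  obj := (linearYoneda R (Omega R G)).obj (Omega.orbit R ⊤)
  property := by
    refine ⟨fun X Y f g => ?_, fun X Y r f => ?_⟩
    · ext x
      exact Preadditive.add_comp _ _ _ f g x
    · ext x
      exact Linear.smul_comp _ _ _ r f x

/-! ### The Mackey algebra -/

/-- The Mackey algebra `μ_R(G) = ⊕_{H, K ≤ G} hom_{Ω_R(G)}(G/H, G/K)`; the index set is finite. -/
def MackeyAlgebra (R : Type u) [CommRing R] (G : Type u) [Group G] [Finite G] : Type u :=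
  ∀ H K : Subgroup G, (Omega.orbit R H ⟶ Omega.orbit R K)

variable [Finite G]

namespace MackeyAlgebra

noncomputable instance : AddCommGroup (MackeyAlgebra R G) :=
  inferInstanceAs (AddCommGroup (∀ H K : Subgroup G, (Omega.orbit R H ⟶ Omega.orbit R K)))

noncomputable instance fintypeSubgroup : Fintype (Subgroup G) := Fintype.ofFinite _

open Classical in
/-- A morphism `G/H ⟶ G/K`, as an element of the Mackey algebra. -/
noncomputable def single {H K : Subgroup G} (x : Omega.orbit R H ⟶ Omega.orbit R K) :
    MackeyAlgebra R G :=
  Pi.single H (Pi.single K x)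

/-- The component of an element of the Mackey algebra, as an additive map. -/
noncomputable def entry (H K : Subgroup G) :
    MackeyAlgebra R G →+ (Omega.orbit R H ⟶ Omega.orbit R K) where
  toFun a := a H K
  map_zero' := rfl
  map_add' _ _ := rfl

theorem sum_apply {ι : Type u} (s : Finset ι) (f : ι → MackeyAlgebra R G) (H K : Subgroup G) :
    (∑ i ∈ s, f i) H K = ∑ i ∈ s, f i H K :=
  map_sum (entry H K) f s

open Classical in
theorem single_same {H K : Subgroup G} (x : Omega.orbit R H ⟶ Omega.orbit R K) :
    single x H K = x := by simp [single]

open Classical in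
theorem single_ne {H K H' K' : Subgroup G} (x : Omega.orbit R H ⟶ Omega.orbit R K)
    (h : ¬ (H' = H ∧ K' = K)) : single x H' K' = 0 := by
  by_cases h' : H' = H
  · subst h'
    have : K' ≠ K := fun e => h ⟨rfl, e⟩
    simp [single, Pi.single_eq_of_ne this]
  · simp [single, Pi.single_eq_of_ne h']

theorem one_apply_same (H : Subgroup G) :
    (∑ L : Subgroup G, single (𝟙 (Omega.orbit R L))) H H = 𝟙 _ := by
  rw [sum_apply, Finset.sum_eq_single H, single_same]
  · intro b _ hb
    exact single_ne _ fun h => hb h.1.symm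
  · simp

theorem one_apply_ne {H K : Subgroup G} (h : H ≠ K) :
    (∑ L : Subgroup G, single (𝟙 (Omega.orbit R L))) H K = 0 := by
  rw [sum_apply]
  exact Finset.sum_eq_zero fun L _ => single_ne _ fun h' => h (h'.1.trans h'.2.symm)

/-- The product of `x : G/H ⟶ G/L` and `y : G/L' ⟶ G/K` is their composite
`G/H ⟶ G/L ⟶ G/K` if `L = L'` and zero otherwise. -/
noncomputable instance : Ring (MackeyAlgebra R G) where
  __ := (inferInstance : AddCommGroup (MackeyAlgebra R G))
  mul a b := fun H K => ∑ L : Subgroup G, a H L ≫ b L K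
  one := ∑ H : Subgroup G, single (𝟙 (Omega.orbit R H))
  left_distrib a b c := by
    funext H K
    change ∑ L, a H L ≫ (b L K + c L K) = (∑ L, a H L ≫ b L K) + ∑ L, a H L ≫ c L K
    simp only [Preadditive.comp_add, Finset.sum_add_distrib]
  right_distrib a b c := by
    funext H K
    change ∑ L, (a H L + b H L) ≫ c L K = (∑ L, a H L ≫ c L K) + ∑ L, b H L ≫ c L K
    simp only [Preadditive.add_comp, Finset.sum_add_distrib]
  zero_mul a := by
    funext H K
    change ∑ L, (0 : Omega.orbit R H ⟶ Omega.orbit R L) ≫ a L K = 0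
    simp
  mul_zero a := by
    funext H K
    change ∑ L, a H L ≫ (0 : Omega.orbit R L ⟶ Omega.orbit R K) = 0
    simp
  mul_assoc a b c := by
    funext H K
    change ∑ L, (∑ L', a H L' ≫ b L' L) ≫ c L K = ∑ L', a H L' ≫ ∑ L, b L' L ≫ c L K
    simp only [Preadditive.sum_comp, Preadditive.comp_sum, Category.assoc]
    exact Finset.sum_comm
  one_mul a := by
    funext H K
    change ∑ L, (∑ L' : Subgroup G, single (𝟙 (Omega.orbit R L'))) H L ≫ a L K = a H K
    rw [Finset.sum_eq_single H, one_apply_same, Category.id_comp]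
    · intro L _ hL
      rw [one_apply_ne hL.symm, Limits.zero_comp]
    · simp
  mul_one a := by
    funext H K
    change ∑ L, a H L ≫ (∑ L' : Subgroup G, single (𝟙 (Omega.orbit R L'))) L K = a H K
    rw [Finset.sum_eq_single K, one_apply_same, Category.comp_id]
    · intro L _ hL
      rw [one_apply_ne hL, Limits.comp_zero]
    · simp

theorem mul_def (a b : MackeyAlgebra R G) (H K : Subgroup G) :
    (a * b) H K = ∑ L : Subgroup G, a H L ≫ b L K := rfl

theorem one_def : (1 : MackeyAlgebra R G) = ∑ H : Subgroup G, single (𝟙 (Omega.orbit R H)) := rfl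

noncomputable instance : Module R (MackeyAlgebra R G) :=
  inferInstanceAs (Module R (∀ H K : Subgroup G, (Omega.orbit R H ⟶ Omega.orbit R K)))

theorem smul_apply (r : R) (a : MackeyAlgebra R G) (H K : Subgroup G) :
    (r • a) H K = r • a H K := rfl

noncomputable instance : Algebra R (MackeyAlgebra R G) :=
  Algebra.ofModule
    (fun r a b => by
      funext H K
      simp only [mul_def, smul_apply, Linear.smul_comp, Finset.smul_sum])
    (fun r a b => by
      funext H K
      simp only [mul_def, smul_apply, Linear.comp_smul, Finset.smul_sum])

theorem single_mul_single {H L K : Subgroup G} (x : Omega.orbit R H ⟶ Omega.orbit R L)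
    (y : Omega.orbit R L ⟶ Omega.orbit R K) : single x * single y = single (x ≫ y) := by
  funext H' K'
  rw [mul_def, Finset.sum_eq_single L]
  · by_cases h : H' = H ∧ K' = K
    · obtain ⟨rfl, rfl⟩ := h
      simp only [single_same]
    · rw [single_ne (x ≫ y) h]
      by_cases h' : H' = H
      · rw [single_ne y fun e => h ⟨h', e.2⟩, Limits.comp_zero]
      · rw [single_ne x fun e => h' e.1, Limits.zero_comp]
  · intro L' _ hL
    rw [single_ne x fun e => hL e.2, Limits.zero_comp]
  · simp

end MackeyAlgebra

/-! ### The equivalence `Φ` and the unit module -/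

namespace MackeyAlgebra

theorem one_same (H : Subgroup G) : (1 : MackeyAlgebra R G) H H = 𝟙 (Omega.orbit R H) :=
  one_apply_same H

theorem one_ne {H K : Subgroup G} (h : H ≠ K) : (1 : MackeyAlgebra R G) H K = 0 :=
  one_apply_ne h

/-- A left `μ_R(G)`-module is an `R`-module through `R → μ_R(G)`. -/
noncomputable instance moduleBase (N : ModuleCat.{u} (MackeyAlgebra R G)) : Module R N :=
  Module.compHom N (algebraMap R (MackeyAlgebra R G))

instance scalarTower (N : ModuleCat.{u} (MackeyAlgebra R G)) :
    IsScalarTower R (MackeyAlgebra R G) N where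
  smul_assoc r a n := by
    rw [Algebra.smul_def, mul_smul]
    rfl

end MackeyAlgebra

/-- The underlying set `⊕_{H ≤ G} M(G/H)` of `Φ M`; the index set is finite. -/
def PhiCarrier (M : MackeyFunctor R G) : Type u := ∀ H : Subgroup G, M.val (FinGSet.orbit H)

noncomputable instance (M : MackeyFunctor R G) : AddCommGroup (PhiCarrier M) :=
  inferInstanceAs (AddCommGroup (∀ H : Subgroup G, M.val (FinGSet.orbit H)))

noncomputable instance (M : MackeyFunctor R G) : Module (MackeyAlgebra R G) (PhiCarrier M) where
  smul a m := fun H => ∑ K : Subgroup G, M.act (a H K) (m K)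
  one_smul m := by
    funext H
    change ∑ K, M.act ((1 : MackeyAlgebra R G) H K) (m K) = m H
    rw [Finset.sum_eq_single H, MackeyAlgebra.one_same, M.act_id]
    · intro K _ hK
      rw [MackeyAlgebra.one_ne hK.symm, M.act_zero]
    · simp
  mul_smul a b m := by
    funext H
    change ∑ K, M.act (∑ L, a H L ≫ b L K) (m K) = ∑ L, M.act (a H L) (∑ K, M.act (b L K) (m K))
    have h : ∀ K, M.act (∑ L, a H L ≫ b L K) (m K) = ∑ L, M.act (a H L) (M.act (b L K) (m K)) := by
      intro K
      refine (map_sum (M.actL (m K)) _ _).trans ?_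
      exact Finset.sum_congr rfl fun L _ => M.act_comp _ _ _
    simp only [h, map_sum]
    exact Finset.sum_comm
  smul_zero a := by
    funext H
    change ∑ K, M.act (a H K) 0 = 0
    simp
  smul_add a m n := by
    funext H
    change ∑ K, M.act (a H K) (m K + n K) = ∑ K, M.act (a H K) (m K) + ∑ K, M.act (a H K) (n K)
    simp [Finset.sum_add_distrib]
  add_smul a b m := by
    funext H
    change ∑ K, M.act (a H K + b H K) (m K) =
      ∑ K, M.act (a H K) (m K) + ∑ K, M.act (b H K) (m K)
    simp [M.act_add, Finset.sum_add_distrib]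
  zero_smul m := by
    funext H
    change ∑ K, M.act (0 : Omega.orbit R H ⟶ Omega.orbit R K) (m K) = 0
    simp [M.act_zero]

/-- The functor `Φ`, sending a Mackey functor `M` to the left `μ_R(G)`-module `⊕_{H ≤ G} M(G/H)`. -/
noncomputable def Phi (R : Type u) [CommRing R] (G : Type u) [Group G] [Finite G] :
    MackeyFunctor R G ⥤ ModuleCat.{u} (MackeyAlgebra R G) where
  obj M := ModuleCat.of (MackeyAlgebra R G) (PhiCarrier M)
  map {M N} f := ModuleCat.ofHom (X := PhiCarrier M) (Y := PhiCarrier N)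
    { toFun := fun m H => (f.hom.app (op (Omega.orbit R H))).hom (m H)
      map_add' := fun m n => funext fun H => map_add (f.hom.app (op (Omega.orbit R H))).hom _ _
      map_smul' := fun a m => funext fun H => by
        change (f.hom.app (op (Omega.orbit R H))).hom (∑ K, M.act (a H K) (m K)) =
          ∑ K, N.act (a H K) ((f.hom.app (op (Omega.orbit R K))).hom (m K))
        rw [map_sum]
        refine Finset.sum_congr rfl fun K _ => ?_
        exact congrArg (fun k => k.hom (m K)) (f.hom.naturality (a H K).op) }
  map_id _ := rfl
  map_comp _ _ := rfl

open Classical in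
/-- An element of `M(G/H)` as an element of `Φ M`. -/
noncomputable def phiSingle (M : MackeyFunctor R G) (H : Subgroup G)
    (m : M.val (FinGSet.orbit H)) : (Phi R G).obj M :=
  (Pi.single H m : ∀ K : Subgroup G, M.val (FinGSet.orbit K))

/-- The underlying set of the unit module `⊕_{H ≤ G} hom_{Ω_R(G)}(G/H, G/G)`. -/
def UnitCarrier (R : Type u) [CommRing R] (G : Type u) [Group G] [Finite G] :
    Type u := ∀ H : Subgroup G, (Omega.orbit R H ⟶ Omega.orbit R (⊤ : Subgroup G))

noncomputable instance : AddCommGroup (UnitCarrier R G) :=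
  inferInstanceAs
    (AddCommGroup (∀ H : Subgroup G, (Omega.orbit R H ⟶ Omega.orbit R (⊤ : Subgroup G))))

noncomputable instance : Module (MackeyAlgebra R G) (UnitCarrier R G) where
  smul a x := fun H => ∑ K : Subgroup G, a H K ≫ x K
  one_smul x := by
    funext H
    change ∑ K, (1 : MackeyAlgebra R G) H K ≫ x K = x H
    rw [Finset.sum_eq_single H, MackeyAlgebra.one_same, Category.id_comp]
    · intro K _ hK
      rw [MackeyAlgebra.one_ne hK.symm, Limits.zero_comp]
    · simp
  mul_smul a b x := by
    funext H
    change ∑ K, (∑ L, a H L ≫ b L K) ≫ x K = ∑ L, a H L ≫ ∑ K, b L K ≫ x K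
    simp only [Preadditive.sum_comp, Preadditive.comp_sum, Category.assoc]
    exact Finset.sum_comm
  smul_zero a := by
    funext H
    change ∑ K, a H K ≫ (0 : Omega.orbit R K ⟶ Omega.orbit R (⊤ : Subgroup G)) = 0
    simp
  smul_add a x y := by
    funext H
    change ∑ K, a H K ≫ (x K + y K) = ∑ K, a H K ≫ x K + ∑ K, a H K ≫ y K
    simp [Finset.sum_add_distrib]
  add_smul a b x := by
    funext H
    change ∑ K, (a H K + b H K) ≫ x K = ∑ K, a H K ≫ x K + ∑ K, b H K ≫ x K
    simp [Finset.sum_add_distrib]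
  zero_smul x := by
    funext H
    change ∑ K, (0 : Omega.orbit R H ⟶ Omega.orbit R K) ≫ x K = 0
    simp

/-- The left `μ_R(G)`-module `⊕_{H ≤ G} hom_{Ω_R(G)}(G/H, G/G)`. -/
noncomputable def unitModule (R : Type u) [CommRing R] (G : Type u) [Group G] [Finite G] :
    ModuleCat.{u} (MackeyAlgebra R G) :=
  ModuleCat.of (MackeyAlgebra R G) (UnitCarrier R G)

open Classical in
/-- The element `n_H = (G/H = G/H → G/G)` of the unit module. -/
noncomputable def unitElt (R : Type u) [CommRing R] (H : Subgroup G) : unitModule R G :=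
  (Pi.single H (Omega.elR (le_top : H ≤ ⊤)) :
    ∀ K : Subgroup G, (Omega.orbit R K ⟶ Omega.orbit R (⊤ : Subgroup G)))

/-! ### Grades -/

/-- The grade `I^H_H N` of a left `μ_R(G)`-module. -/
noncomputable def grade (N : ModuleCat.{u} (MackeyAlgebra R G)) (H : Subgroup G) :
    Submodule R N :=
  LinearMap.range (Algebra.lsmul R R N (MackeyAlgebra.single (𝟙 (Omega.orbit R H)) :
    MackeyAlgebra R G))

theorem single_smul_mem_grade (N : ModuleCat.{u} (MackeyAlgebra R G)) {H K : Subgroup G}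
    (x : Omega.orbit R H ⟶ Omega.orbit R K) (n : N) :
    MackeyAlgebra.single x • n ∈ grade N H := by
  refine ⟨MackeyAlgebra.single x • n, ?_⟩
  change MackeyAlgebra.single (𝟙 (Omega.orbit R H)) • MackeyAlgebra.single x • n = _
  rw [← mul_smul, MackeyAlgebra.single_mul_single, Category.id_comp]

/-- Multiplication by a morphism `x : G/H ⟶ G/K`, as a map between the grades. -/
noncomputable def gradeMap (N : ModuleCat.{u} (MackeyAlgebra R G)) {H K : Subgroup G}
    (x : Omega.orbit R H ⟶ Omega.orbit R K) : grade N K →ₗ[R] grade N H :=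
  ((Algebra.lsmul R R N (MackeyAlgebra.single x)).domRestrict (grade N K)).codRestrict (grade N H)
    (fun n => single_smul_mem_grade N x n)

/-- The map on grades induced by a morphism of modules. -/
noncomputable def gradeHom {M N : ModuleCat.{u} (MackeyAlgebra R G)} (f : M ⟶ N)
    (H : Subgroup G) : grade M H →ₗ[R] grade N H where
  toFun m := ⟨f.hom m, by
    obtain ⟨_, m, rfl⟩ := m
    exact ⟨f.hom m, (f.hom.map_smul _ m).symm⟩⟩
  map_add' a b := Subtype.ext (map_add f.hom _ _)
  map_smul' r a := Subtype.ext (f.hom.map_smul (algebraMap R (MackeyAlgebra R G) r) a.1)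

theorem gradeHom_gradeMap {M N : ModuleCat.{u} (MackeyAlgebra R G)} (f : M ⟶ N)
    {H K : Subgroup G} (x : Omega.orbit R H ⟶ Omega.orbit R K) :
    gradeHom f H ∘ₗ gradeMap M x = gradeMap N x ∘ₗ gradeHom f K :=
  LinearMap.ext fun m => Subtype.ext (f.hom.map_smul (MackeyAlgebra.single x) m.1)

theorem phiSingle_mem_grade (M : MackeyFunctor R G) (H : Subgroup G)
    (m : M.val (FinGSet.orbit H)) : phiSingle M H m ∈ grade ((Phi R G).obj M) H := by
  classical
  refine ⟨phiSingle M H m, ?_⟩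
  funext H'
  change ∑ K, M.act (MackeyAlgebra.single (𝟙 (Omega.orbit R H)) H' K)
    ((Pi.single H m : ∀ K : Subgroup G, M.val (FinGSet.orbit K)) K) =
    (Pi.single H m : ∀ K : Subgroup G, M.val (FinGSet.orbit K)) H'
  rw [Finset.sum_eq_single H]
  · by_cases h : H' = H
    · subst h
      rw [MackeyAlgebra.single_same, M.act_id]
    · rw [MackeyAlgebra.single_ne _ fun e => h e.1, M.act_zero, Pi.single_eq_of_ne h]
  · intro K _ hK
    rw [Pi.single_eq_of_ne hK, map_zero]
  · simp

/-- An element of `M(G/H)` as an element of the grade `H` of `Φ M`. -/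
noncomputable def phiGrade (M : MackeyFunctor R G) (H : Subgroup G)
    (m : M.val (FinGSet.orbit H)) : grade ((Phi R G).obj M) H :=
  ⟨phiSingle M H m, phiSingle_mem_grade M H m⟩

theorem unitElt_mem_grade (H : Subgroup G) : unitElt R H ∈ grade (unitModule R G) H := by
  classical
  refine ⟨unitElt R H, ?_⟩
  funext H'
  change ∑ K, MackeyAlgebra.single (𝟙 (Omega.orbit R H)) H' K ≫
    (Pi.single H (Omega.elR (le_top : H ≤ ⊤)) :
      ∀ K : Subgroup G, (Omega.orbit R K ⟶ Omega.orbit R (⊤ : Subgroup G))) K =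
    (Pi.single H (Omega.elR (le_top : H ≤ ⊤)) :
      ∀ K : Subgroup G, (Omega.orbit R K ⟶ Omega.orbit R (⊤ : Subgroup G))) H'
  rw [Finset.sum_eq_single H]
  · by_cases h : H' = H
    · subst h
      rw [MackeyAlgebra.single_same, Category.id_comp]
    · rw [MackeyAlgebra.single_ne _ fun e => h e.1, Limits.zero_comp, Pi.single_eq_of_ne h]
  · intro K _ hK
    rw [Pi.single_eq_of_ne hK, Limits.comp_zero]
  · simp

/-- The element `n_H` in the grade `H` of the unit module. -/
noncomputable def unitGrade (R : Type u) [CommRing R] (H : Subgroup G) : grade (unitModule R G) H :=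
  ⟨unitElt R H, unitElt_mem_grade H⟩

/-! ### The graded `R`-module `A = ⊕_H A_H` and the operators on it -/

/-- Chains `L = K_n < ⋯ < K_1 < H` of subgroups from `H` down to `L`. -/
inductive Chain : Subgroup G → Subgroup G → Type u
  | nil (H : Subgroup G) : Chain H H
  | cons {H K L : Subgroup G} (h : K < H) (c : Chain K L) : Chain H L

/-- The chains of subgroups that start at `H`. -/
abbrev ChainFrom (H : Subgroup G) : Type u := Σ L : Subgroup G, Chain H L

/-- The `R`-module `(I^H_H M) ⊗_R (I^H_H N)`. -/
abbrev gradeTensor (M N : ModuleCat.{u} (MackeyAlgebra R G)) (H : Subgroup G) : Type u :=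
  grade M H ⊗[R] grade N H

/-- The `R`-module `A_H`. It is defined by `A_H = (I^H_H M ⊗ I^H_H N) ⊕ ⊕_{K < H} A_K`; unfolding
this recursion, it has one summand `I^L_L M ⊗ I^L_L N` for each chain from `H` down to `L`. -/
abbrev boxGrade (M N : ModuleCat.{u} (MackeyAlgebra R G)) (H : Subgroup G) : Type u :=
  DirectSum (ChainFrom H) fun p => gradeTensor M N p.1

/-- A set `[J\H/K]` of representatives of the double cosets, for `J, K ≤ H`. -/
noncomputable def doubleCosetReps (H J K : Subgroup G) : Finset G :=
  (Set.toFinite (Set.range fun q : DoubleCoset.Quotient (J.subgroupOf H : Set H)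
    (K.subgroupOf H : Set H) => ((Quotient.out q : H) : G))).toFinset

section Operators

variable (M N : ModuleCat.{u} (MackeyAlgebra R G))

open Classical in
/-- The inclusion of the summand `(I^H_H M) ⊗ (I^H_H N)` of `A_H`. -/
noncomputable def boxTop (H : Subgroup G) : gradeTensor M N H →ₗ[R] boxGrade M N H :=
  DirectSum.lof R (ChainFrom H) (fun p => gradeTensor M N p.1) ⟨H, Chain.nil H⟩

open Classical in
/-- The inclusion of the copy `I^H_K A_K` of `A_K` in `A_H`, for `K < H`. -/
noncomputable def boxCopy {H K : Subgroup G} (h : K < H) :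
    boxGrade M N K →ₗ[R] boxGrade M N H :=
  DirectSum.toModule R (ChainFrom K) (boxGrade M N H) fun p =>
    DirectSum.lof R (ChainFrom H) (fun p => gradeTensor M N p.1) ⟨p.1, Chain.cons h p.2⟩

open Classical in
/-- The action of `I^H_K` on the grade `K`. -/
noncomputable def opI {H K : Subgroup G} (h : K ≤ H) : boxGrade M N K →ₗ[R] boxGrade M N H :=
  if e : K = H then e ▸ LinearMap.id else boxCopy M N (lt_of_le_of_ne h e)

/-- The action of `C_{g,H}` on one summand of the grade `H`. -/
noncomputable def opCChain (g : G) : {H L : Subgroup G} → Chain H L →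
    (gradeTensor M N L →ₗ[R] boxGrade M N (MulAut.conj g • H))
  | _, _, .nil H => boxTop M N (MulAut.conj g • H) ∘ₗ
      TensorProduct.map (gradeMap M (Omega.elC g H)) (gradeMap N (Omega.elC g H))
  | _, _, .cons h c => boxCopy M N (conj_strictMono g h) ∘ₗ opCChain g c

open Classical in
/-- The action of `C_{g,H}` on the grade `H`. -/
noncomputable def opC (g : G) (H : Subgroup G) :
    boxGrade M N H →ₗ[R] boxGrade M N (MulAut.conj g • H) :=
  DirectSum.toModule R (ChainFrom H) (boxGrade M N (MulAut.conj g • H)) fun p =>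
    opCChain M N g p.2

/-- The action of `R^H_J` on one summand of the grade `H`; on a copy `I^H_K A_K` it is
`R^H_J I^H_K x = ∑_{g ∈ [J\H/K]} I^J_{ᵍK ∩ J} C_g R^K_{K ∩ Jᵍ} x`, where `ᵍ(K ∩ Jᵍ) = ᵍK ∩ J`. -/
noncomputable def opRChain : {H L : Subgroup G} → Chain H L → (J : Subgroup G) → J ≤ H →
    (gradeTensor M N L →ₗ[R] boxGrade M N J)
  | _, _, .nil _, J, hJ => boxTop M N J ∘ₗ
      TensorProduct.map (gradeMap M (Omega.elR hJ)) (gradeMap N (Omega.elR hJ))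
  | _, _, .cons (H := H) (K := K) _ c, J, _ => ∑ g ∈ doubleCosetReps H J K,
      opI M N (conj_inf_le g J K) ∘ₗ opC M N g (K ⊓ MulAut.conj g⁻¹ • J) ∘ₗ
        opRChain c (K ⊓ MulAut.conj g⁻¹ • J) inf_le_left

open Classical in
/-- The action of `R^H_J` on the grade `H`. -/
noncomputable def opR {J H : Subgroup G} (h : J ≤ H) : boxGrade M N H →ₗ[R] boxGrade M N J :=
  DirectSum.toModule R (ChainFrom H) (boxGrade M N J) fun p => opRChain M N p.2 J h

/-- The `R`-module `A = ⊕_{H ≤ G} A_H`. -/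
abbrev boxTotal : Type u := DirectSum (Subgroup G) fun H => boxGrade M N H

open Classical in
/-- The inclusion of the grade `H` of `A`. -/
noncomputable def boxIncl (H : Subgroup G) : boxGrade M N H →ₗ[R] boxTotal M N :=
  DirectSum.lof R (Subgroup G) (fun H => boxGrade M N H) H

/-- A map from the grade `H` to the grade `K`, extended by zero on the other grades. -/
noncomputable def extendZero {H K : Subgroup G} (f : boxGrade M N H →ₗ[R] boxGrade M N K) :
    boxTotal M N →ₗ[R] boxTotal M N :=
  boxIncl M N K ∘ₗ f ∘ₗ DirectSum.component R (Subgroup G) (fun H => boxGrade M N H) H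

/-! ### The box product of modules -/

/-- The relations, in `μ_R(G) ⊗_R A`, that make the generators `I`, `C`, `R` of `μ_R(G)` act on the
image of `A` by the operators above, and the Frobenius reciprocity relations. -/
inductive BoxRel : MackeyAlgebra R G ⊗[R] boxTotal M N → Prop
  | actI {H K : Subgroup G} (h : K ≤ H) (a : boxTotal M N) :
      BoxRel (MackeyAlgebra.single (Omega.elI h) ⊗ₜ[R] a -
        1 ⊗ₜ[R] extendZero M N (opI M N h) a)
  | actC (g : G) (H : Subgroup G) (a : boxTotal M N) :
      BoxRel (MackeyAlgebra.single (Omega.elC g H) ⊗ₜ[R] a -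
        1 ⊗ₜ[R] extendZero M N (opC M N g H) a)
  | actR {J H : Subgroup G} (h : J ≤ H) (a : boxTotal M N) :
      BoxRel (MackeyAlgebra.single (Omega.elR h) ⊗ₜ[R] a -
        1 ⊗ₜ[R] extendZero M N (opR M N h) a)
  | frobeniusRight {K H : Subgroup G} (h : K < H) (a : grade M H) (b : grade N K) :
      BoxRel (1 ⊗ₜ[R] boxIncl M N H (boxTop M N H (a ⊗ₜ[R] gradeMap N (Omega.elI h.le) b) -
        boxCopy M N h (boxTop M N K (gradeMap M (Omega.elR h.le) a ⊗ₜ[R] b))))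
  | frobeniusLeft {K H : Subgroup G} (h : K < H) (c : grade M K) (d : grade N H) :
      BoxRel (1 ⊗ₜ[R] boxIncl M N H (boxTop M N H (gradeMap M (Omega.elI h.le) c ⊗ₜ[R] d) -
        boxCopy M N h (boxTop M N K (c ⊗ₜ[R] gradeMap N (Omega.elR h.le) d))))

/-- The submodule of `μ_R(G) ⊗_R A` generated by the relations. -/
noncomputable def boxSubmodule :
    Submodule (MackeyAlgebra R G) (MackeyAlgebra R G ⊗[R] boxTotal M N) :=
  Submodule.span (MackeyAlgebra R G) {x | BoxRel M N x}

/-- The box product `M □ N` of left `μ_R(G)`-modules: the left `μ_R(G)`-module generated by the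
`R`-module `A`, on which the generators `I`, `C`, `R` of `μ_R(G)` act by the given operators, modulo
Frobenius reciprocity. -/
noncomputable def box : ModuleCat.{u} (MackeyAlgebra R G) :=
  ModuleCat.of (MackeyAlgebra R G)
    ((MackeyAlgebra R G ⊗[R] boxTotal M N) ⧸ boxSubmodule M N)

/-- The canonical `R`-linear map `A → M □ N`. -/
noncomputable def toBox (a : boxTotal M N) : box M N :=
  (boxSubmodule M N).mkQ (1 ⊗ₜ[R] a)

end Operators

theorem smul_toBox_of_rel (M N : ModuleCat.{u} (MackeyAlgebra R G)) (x : MackeyAlgebra R G)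
    (a b : boxTotal M N) (h : BoxRel M N (x ⊗ₜ[R] a - 1 ⊗ₜ[R] b)) :
    x • toBox M N a = toBox M N b := by
  refine Eq.trans (b := (boxSubmodule M N).mkQ (x ⊗ₜ[R] a)) ?_ ?_
  · change x • (boxSubmodule M N).mkQ (1 ⊗ₜ[R] a) = _
    rw [← map_smul, TensorProduct.smul_tmul', smul_eq_mul, mul_one]
  · exact (Submodule.Quotient.eq _).2 (Submodule.subset_span h)

theorem elI_self (H : Subgroup G) : Omega.elI (R := R) (le_refl H) = 𝟙 (Omega.orbit R H) := by
  have : FinGSet.proj (le_refl H) = MulActionHom.id G := by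
    ext x
    obtain ⟨x⟩ := x
    rfl
  simp only [Omega.elI, Omega.tr, this]
  rfl

/-- The class in `M □ N` of the elementary tensor `m ⊗ n` in the grade `H` of `A`; it lies in the
grade `H` of `M □ N`. -/
noncomputable def boxMk {M N : ModuleCat.{u} (MackeyAlgebra R G)} {H : Subgroup G}
    (m : grade M H) (n : grade N H) : grade (box M N) H :=
  ⟨toBox M N (boxIncl M N H (boxTop M N H (m ⊗ₜ[R] n))), by
    refine ⟨toBox M N (boxIncl M N H (boxTop M N H (m ⊗ₜ[R] n))), ?_⟩
    change MackeyAlgebra.single (𝟙 (Omega.orbit R H)) • toBox M N _ = toBox M N _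
    refine smul_toBox_of_rel M N _ _ _ ?_
    have := BoxRel.actI (M := M) (N := N) (le_refl H)
      (boxIncl M N H (boxTop M N H (m ⊗ₜ[R] n)))
    rw [elI_self] at this
    have e : extendZero M N (opI M N (le_refl H)) (boxIncl M N H (boxTop M N H (m ⊗ₜ[R] n))) =
        boxIncl M N H (boxTop M N H (m ⊗ₜ[R] n)) := by
      simp [extendZero, opI, boxIncl, DirectSum.component.lof_self]
    rwa [e] at this⟩

/-! ### Functoriality of the box product of modules -/

section Functoriality

variable {M N M' N' : ModuleCat.{u} (MackeyAlgebra R G)} (f : M ⟶ M') (g : N ⟶ N')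

/-- The map induced on `A_H`. -/
noncomputable def boxGradeMap (H : Subgroup G) : boxGrade M N H →ₗ[R] boxGrade M' N' H :=
  DirectSum.lmap fun p => TensorProduct.map (gradeHom f p.1) (gradeHom g p.1)

/-- The map induced on `A`. -/
noncomputable def boxTotalMap : boxTotal M N →ₗ[R] boxTotal M' N' :=
  DirectSum.lmap fun H => boxGradeMap f g H

theorem boxGradeMap_top (H : Subgroup G) (x : gradeTensor M N H) :
    boxGradeMap f g H (boxTop M N H x) =
      boxTop M' N' H (TensorProduct.map (gradeHom f H) (gradeHom g H) x) := by
  classical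
  exact DirectSum.lmap_lof _ _ _

theorem boxGradeMap_copy {H K : Subgroup G} (h : K < H) (x : boxGrade M N K) :
    boxGradeMap f g H (boxCopy M N h x) = boxCopy M' N' h (boxGradeMap f g K x) := by
  classical
  induction x using DirectSum.induction_on with
  | zero => simp only [map_zero]
  | add x y hx hy => simp only [map_add, hx, hy]
  | of c x =>
    change boxGradeMap f g H (boxCopy M N h (DirectSum.lof R _ _ c x)) =
      boxCopy M' N' h (boxGradeMap f g K (DirectSum.lof R _ _ c x))
    simp only [boxCopy, boxGradeMap, DirectSum.toModule_lof, DirectSum.lmap_lof]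

theorem boxGradeMap_opI {H K : Subgroup G} (h : K ≤ H) (x : boxGrade M N K) :
    boxGradeMap f g H (opI M N h x) = opI M' N' h (boxGradeMap f g K x) := by
  by_cases e : K = H
  · subst e
    simp [opI]
  · simp only [opI, e, dif_neg, not_false_eq_true]
    exact boxGradeMap_copy f g _ x

theorem map_gradeHom_gradeMap {H K : Subgroup G} (y : Omega.orbit R H ⟶ Omega.orbit R K)
    (x : gradeTensor M N K) :
    TensorProduct.map (gradeHom f H) (gradeHom g H)
        (TensorProduct.map (gradeMap M y) (gradeMap N y) x) =
      TensorProduct.map (gradeMap M' y) (gradeMap N' y)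
        (TensorProduct.map (gradeHom f K) (gradeHom g K) x) := by
  rw [← LinearMap.comp_apply, ← LinearMap.comp_apply, ← TensorProduct.map_comp,
    ← TensorProduct.map_comp, gradeHom_gradeMap, gradeHom_gradeMap]

theorem boxGradeMap_opCChain (k : G) {H L : Subgroup G} (c : Chain H L)
    (x : gradeTensor M N L) :
    boxGradeMap f g _ (opCChain M N k c x) =
      opCChain M' N' k c (TensorProduct.map (gradeHom f L) (gradeHom g L) x) := by
  induction c with
  | nil H =>
    simp only [opCChain, LinearMap.comp_apply, boxGradeMap_top, map_gradeHom_gradeMap]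
  | cons h c ih =>
    simp only [opCChain, LinearMap.comp_apply, boxGradeMap_copy, ih]

theorem boxGradeMap_toModule {H J : Subgroup G}
    (F : (p : ChainFrom H) → (gradeTensor M N p.1 →ₗ[R] boxGrade M N J))
    (F' : (p : ChainFrom H) → (gradeTensor M' N' p.1 →ₗ[R] boxGrade M' N' J))
    (hF : ∀ p x, boxGradeMap f g J (F p x) =
      F' p (TensorProduct.map (gradeHom f p.1) (gradeHom g p.1) x))
    [DecidableEq (ChainFrom H)] (x : boxGrade M N H) :
    boxGradeMap f g J (DirectSum.toModule R (ChainFrom H) _ F x) =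
      DirectSum.toModule R (ChainFrom H) _ F' (boxGradeMap f g H x) := by
  induction x using DirectSum.induction_on with
  | zero => simp only [map_zero]
  | add x y hx hy => simp only [map_add, hx, hy]
  | of c x =>
    change boxGradeMap f g J (DirectSum.toModule R _ _ F (DirectSum.lof R _ _ c x)) =
      DirectSum.toModule R _ _ F' (boxGradeMap f g H (DirectSum.lof R _ _ c x))
    rw [DirectSum.toModule_lof, hF, boxGradeMap, DirectSum.lmap_lof, DirectSum.toModule_lof]

theorem boxGradeMap_opC (k : G) (H : Subgroup G) (x : boxGrade M N H) :
    boxGradeMap f g _ (opC M N k H x) = opC M' N' k H (boxGradeMap f g H x) :=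
  by
  classical exact boxGradeMap_toModule f g _ _ (fun p => boxGradeMap_opCChain f g k p.2) x

theorem boxGradeMap_opRChain {H L : Subgroup G} (c : Chain H L) (J : Subgroup G)
    (hJ : J ≤ H) (x : gradeTensor M N L) :
    boxGradeMap f g J (opRChain M N c J hJ x) =
      opRChain M' N' c J hJ (TensorProduct.map (gradeHom f L) (gradeHom g L) x) := by
  induction c generalizing J with
  | nil H =>
    simp only [opRChain, LinearMap.comp_apply, boxGradeMap_top, map_gradeHom_gradeMap]
  | cons h c ih =>
    simp only [opRChain, LinearMap.sum_apply, map_sum, LinearMap.comp_apply]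
    refine Finset.sum_congr rfl fun k _ => ?_
    rw [boxGradeMap_opI, boxGradeMap_opC, ih]

theorem boxGradeMap_opR {J H : Subgroup G} (h : J ≤ H) (x : boxGrade M N H) :
    boxGradeMap f g J (opR M N h x) = opR M' N' h (boxGradeMap f g H x) :=
  by
  classical exact boxGradeMap_toModule f g _ _ (fun p => boxGradeMap_opRChain f g p.2 J h) x

theorem boxTotalMap_incl (H : Subgroup G) (x : boxGrade M N H) :
    boxTotalMap f g (boxIncl M N H x) = boxIncl M' N' H (boxGradeMap f g H x) := by
  classical
  exact DirectSum.lmap_lof _ _ _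

theorem boxTotalMap_extendZero {H K : Subgroup G} (F : boxGrade M N H →ₗ[R] boxGrade M N K)
    (F' : boxGrade M' N' H →ₗ[R] boxGrade M' N' K)
    (hF : ∀ x, boxGradeMap f g K (F x) = F' (boxGradeMap f g H x)) (x : boxTotal M N) :
    boxTotalMap f g (extendZero M N F x) = extendZero M' N' F' (boxTotalMap f g x) := by
  simp only [extendZero, LinearMap.comp_apply, boxTotalMap_incl, hF]
  rfl

theorem BoxRel.map {x : MackeyAlgebra R G ⊗[R] boxTotal M N} (h : BoxRel M N x) :
    BoxRel M' N' (TensorProduct.AlgebraTensorModule.map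
      (LinearMap.id : MackeyAlgebra R G →ₗ[MackeyAlgebra R G] MackeyAlgebra R G)
      (boxTotalMap f g) x) := by
  cases h with
  | actI h a =>
    rw [map_sub, TensorProduct.AlgebraTensorModule.map_tmul,
      TensorProduct.AlgebraTensorModule.map_tmul,
      boxTotalMap_extendZero f g _ _ (boxGradeMap_opI f g h)]
    exact .actI h _
  | actC k H a =>
    rw [map_sub, TensorProduct.AlgebraTensorModule.map_tmul,
      TensorProduct.AlgebraTensorModule.map_tmul,
      boxTotalMap_extendZero f g _ _ (boxGradeMap_opC f g k H)]
    exact .actC k H _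
  | actR h a =>
    rw [map_sub, TensorProduct.AlgebraTensorModule.map_tmul,
      TensorProduct.AlgebraTensorModule.map_tmul,
      boxTotalMap_extendZero f g _ _ (boxGradeMap_opR f g h)]
    exact .actR h _
  | @frobeniusRight K H h a b =>
    rw [TensorProduct.AlgebraTensorModule.map_tmul, boxTotalMap_incl, map_sub, boxGradeMap_top,
      boxGradeMap_copy, boxGradeMap_top, TensorProduct.map_tmul, TensorProduct.map_tmul]
    have h1 := LinearMap.congr_fun (gradeHom_gradeMap g (Omega.elI h.le)) b
    have h2 := LinearMap.congr_fun (gradeHom_gradeMap f (Omega.elR h.le)) a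
    rw [LinearMap.comp_apply, LinearMap.comp_apply] at h1 h2
    rw [h1, h2]
    exact .frobeniusRight h _ _
  | @frobeniusLeft K H h c d =>
    rw [TensorProduct.AlgebraTensorModule.map_tmul, boxTotalMap_incl, map_sub, boxGradeMap_top,
      boxGradeMap_copy, boxGradeMap_top, TensorProduct.map_tmul, TensorProduct.map_tmul]
    have h1 := LinearMap.congr_fun (gradeHom_gradeMap f (Omega.elI h.le)) c
    have h2 := LinearMap.congr_fun (gradeHom_gradeMap g (Omega.elR h.le)) d
    rw [LinearMap.comp_apply, LinearMap.comp_apply] at h1 h2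
    rw [h1, h2]
    exact .frobeniusLeft h _ _

/-- The map `f □ g` induced on box products of modules, `m ⊗ n ↦ f m ⊗ g n`. -/
noncomputable def boxMap : box M N ⟶ box M' N' :=
  ModuleCat.ofHom (Submodule.mapQ (boxSubmodule M N) (boxSubmodule M' N')
    (TensorProduct.AlgebraTensorModule.map
      (LinearMap.id : MackeyAlgebra R G →ₗ[MackeyAlgebra R G] MackeyAlgebra R G)
      (boxTotalMap f g))
    (Submodule.span_le.2 fun _ hx => Submodule.subset_span (BoxRel.map f g hx)))

end Functoriality

/-! ### The box product of Mackey functors -/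

section Lewis

open MonoidalCategory
open scoped MonoidalCategory.ExternalProduct

/-- A choice of box products of Mackey functors: for all `M` and `N`, a Mackey functor `M □ N`
that is a left Kan extension of `(X, Y) ↦ M(X) ⊗ N(Y)` along the cartesian product functor. -/
structure LewisBox (R : Type u) [CommRing R] (G : Type u) [Group G] where
  obj : MackeyFunctor R G → MackeyFunctor R G → MackeyFunctor R G
  unit : ∀ M N : MackeyFunctor R G, M.obj ⊠ N.obj ⟶ Omega.prodFunctor ⋙ (obj M N).obj
  isKan : ∀ M N : MackeyFunctor R G, (obj M N).obj.IsLeftKanExtension (unit M N)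

namespace LewisBox

variable (L : LewisBox R G)

/-- The image of `m ⊗ n` under the universal map `M(X) ⊗ N(Y) → (M □ N)(X × Y)`. -/
noncomputable def tmul {M N : MackeyFunctor R G} {X Y : FinGSet G} (m : M.val X) (n : N.val Y) :
    (L.obj M N).val (X.prod Y) :=
  ((L.unit M N).app (op (Omega.of R X), op (Omega.of R Y))).hom (m ⊗ₜ[R] n)

/-- The map `f □ g` given by the universal property of the Kan extension. -/
noncomputable def map {M N M' N' : MackeyFunctor R G} (f : M ⟶ M') (g : N ⟶ N') :
    L.obj M N ⟶ L.obj M' N' :=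
  haveI := L.isKan M N
  ObjectProperty.homMk ((L.obj M N).obj.descOfIsLeftKanExtension (L.unit M N) (L.obj M' N').obj
    ((externalProductBifunctor _ _ _).map (Prod.mkHom f.hom g.hom) ≫ L.unit M' N'))

theorem map_tmul {M N M' N' : MackeyFunctor R G} (f : M ⟶ M') (g : N ⟶ N') {X Y : FinGSet G}
    (m : M.val X) (n : N.val Y) :
    ((L.map f g).hom.app (op (Omega.of R (X.prod Y)))).hom (L.tmul m n) =
      L.tmul ((f.hom.app (op (Omega.of R X))).hom m) ((g.hom.app (op (Omega.of R Y))).hom n) := by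
  have := L.isKan M N
  have := (L.obj M N).obj.descOfIsLeftKanExtension_fac_app (L.unit M N) (L.obj M' N').obj
    ((externalProductBifunctor _ _ _).map (Prod.mkHom f.hom g.hom) ≫ L.unit M' N')
    (op (Omega.of R X), op (Omega.of R Y))
  refine (congrArg (fun k => k.hom (m ⊗ₜ[R] n)) this).trans ?_
  change ((L.unit M' N').app _).hom _ = ((L.unit M' N').app _).hom _
  refine congrArg _ ?_
  rfl

/-- The associators, unitors and braidings of the box product of Mackey functors, determined by
their values on the elements `m ⊗ n`. -/
structure Coherence where
  assoc : ∀ M N P : MackeyFunctor R G, L.obj (L.obj M N) P ≅ L.obj M (L.obj N P)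
  leftUnit : ∀ M : MackeyFunctor R G, L.obj (burnside R G) M ≅ M
  rightUnit : ∀ M : MackeyFunctor R G, L.obj M (burnside R G) ≅ M
  braid : ∀ M N : MackeyFunctor R G, L.obj M N ≅ L.obj N M
  assoc_tmul : ∀ {M N P : MackeyFunctor R G} {X Y Z : FinGSet G} (m : M.val X) (n : N.val Y)
    (p : P.val Z),
    ((assoc M N P).hom.hom.app (op (Omega.of R ((X.prod Y).prod Z)))).hom (L.tmul (L.tmul m n) p) =
      (L.obj M (L.obj N P)).act (Omega.res (FinGSet.assoc X Y Z)) (L.tmul m (L.tmul n p))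
  leftUnit_tmul : ∀ {M : MackeyFunctor R G} {X : FinGSet G} (m : M.val X),
    ((leftUnit M).hom.hom.app (op (Omega.of R ((FinGSet.orbit ⊤).prod X)))).hom
      (L.tmul (M := burnside R G) (𝟙 (Omega.orbit R (⊤ : Subgroup G))) m) =
        M.act (Omega.res (FinGSet.snd _ X)) m
  rightUnit_tmul : ∀ {M : MackeyFunctor R G} {X : FinGSet G} (m : M.val X),
    ((rightUnit M).hom.hom.app (op (Omega.of R (X.prod (FinGSet.orbit ⊤))))).hom
      (L.tmul (N := burnside R G) m (𝟙 (Omega.orbit R (⊤ : Subgroup G)))) =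
        M.act (Omega.res (FinGSet.fst X _)) m
  braid_tmul : ∀ {M N : MackeyFunctor R G} {X Y : FinGSet G} (m : M.val X) (n : N.val Y),
    ((braid M N).hom.hom.app (op (Omega.of R (X.prod Y)))).hom (L.tmul m n) =
      (L.obj N M).act (Omega.res (FinGSet.swap X Y)) (L.tmul n m)

variable {L}

/-- The monoidal structure on Mackey functors, with unit `B^G`. -/
@[reducible]
noncomputable def Coherence.toStruct (a : L.Coherence) :
    MonoidalCategoryStruct (MackeyFunctor R G) where
  tensorObj := L.obj
  whiskerLeft M _ _ g := L.map (𝟙 M) g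
  whiskerRight f N := L.map f (𝟙 N)
  tensorHom f g := L.map f g
  tensorUnit := burnside R G
  associator := a.assoc
  leftUnitor := a.leftUnit
  rightUnitor := a.rightUnit

end LewisBox

/-- The associators, unitors and braidings of the box product of left `μ_R(G)`-modules, determined
by their values on the elements `m ⊗ n`. -/
structure BoxCoherence (R : Type u) [CommRing R] (G : Type u) [Group G] [Finite G] where
  assoc : ∀ M N P : ModuleCat.{u} (MackeyAlgebra R G), box (box M N) P ≅ box M (box N P)
  leftUnit : ∀ M : ModuleCat.{u} (MackeyAlgebra R G), box (unitModule R G) M ≅ M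
  rightUnit : ∀ M : ModuleCat.{u} (MackeyAlgebra R G), box M (unitModule R G) ≅ M
  braid : ∀ M N : ModuleCat.{u} (MackeyAlgebra R G), box M N ≅ box N M
  assoc_tmul : ∀ {M N P : ModuleCat.{u} (MackeyAlgebra R G)} {H : Subgroup G} (m : grade M H)
    (n : grade N H) (p : grade P H),
    (assoc M N P).hom.hom (boxMk (boxMk m n) p).1 = (boxMk m (boxMk n p)).1
  leftUnit_tmul : ∀ {M : ModuleCat.{u} (MackeyAlgebra R G)} {H : Subgroup G} (m : grade M H),
    (leftUnit M).hom.hom (boxMk (unitGrade R H) m).1 = m.1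
  rightUnit_tmul : ∀ {M : ModuleCat.{u} (MackeyAlgebra R G)} {H : Subgroup G} (m : grade M H),
    (rightUnit M).hom.hom (boxMk m (unitGrade R H)).1 = m.1
  braid_tmul : ∀ {M N : ModuleCat.{u} (MackeyAlgebra R G)} {H : Subgroup G} (m : grade M H)
    (n : grade N H), (braid M N).hom.hom (boxMk m n).1 = (boxMk n m).1

/-- The monoidal structure on left `μ_R(G)`-modules, with unit
`⊕_{H ≤ G} hom_{Ω_R(G)}(G/H, G/G)`. -/
@[reducible]
noncomputable def BoxCoherence.toStruct (b : BoxCoherence R G) :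
    MonoidalCategoryStruct (ModuleCat.{u} (MackeyAlgebra R G)) where
  tensorObj := box
  whiskerLeft M _ _ g := boxMap (𝟙 M) g
  whiskerRight f N := boxMap f (𝟙 N)
  tensorHom f g := boxMap f g
  tensorUnit := unitModule R G
  associator := b.assoc
  leftUnitor := b.leftUnit
  rightUnitor := b.rightUnit

end Lewis

/-- The data `S` satisfy the axioms of a monoidal category. -/
def IsMonoidal {C : Type*} [Category C] (S : MonoidalCategoryStruct C) : Prop :=
  ∃ h : MonoidalCategory C, h.toMonoidalCategoryStruct = S

/-- The monoidal category with underlying data `S`. -/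
@[reducible]
def IsMonoidal.toMonoidalCategory {C : Type*} [Category C] {S : MonoidalCategoryStruct C}
    (hS : IsMonoidal S) : MonoidalCategory C where
  __ := S
  tensorHom_def := by obtain ⟨h, rfl⟩ := hS; exact h.tensorHom_def
  id_tensorHom_id := by obtain ⟨h, rfl⟩ := hS; exact h.id_tensorHom_id
  tensorHom_comp_tensorHom := by obtain ⟨h, rfl⟩ := hS; exact h.tensorHom_comp_tensorHom
  whiskerLeft_id := by obtain ⟨h, rfl⟩ := hS; exact h.whiskerLeft_id
  id_whiskerRight := by obtain ⟨h, rfl⟩ := hS; exact h.id_whiskerRight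
  associator_naturality := by obtain ⟨h, rfl⟩ := hS; exact h.associator_naturality
  leftUnitor_naturality := by obtain ⟨h, rfl⟩ := hS; exact h.leftUnitor_naturality
  rightUnitor_naturality := by obtain ⟨h, rfl⟩ := hS; exact h.rightUnitor_naturality
  pentagon := by obtain ⟨h, rfl⟩ := hS; exact h.pentagon
  triangle := by obtain ⟨h, rfl⟩ := hS; exact h.triangle

end MackeyBox

open MonoidalCategory MackeyBox

/-! Everything rests on one fact: a finite `G`-set is the disjoint union of its orbits, and in
`Ω_R(G)` this union is a biproduct (`sum_tr_emb_res_emb`). An `R`-linear functor is therefore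
determined by its values on the orbits `G/H` and by the action of the morphisms between orbits, and
these data form exactly a left module over `μ_R(G)`. This makes `Φ` fully faithful. It is
essentially surjective because `Φ(hom(-, G/H))` is the projective module `μ e_H`, with `e_H` the
idempotent of the grade `H`; so `X ↦ Hom(Φ(hom(-, X)), N)` takes the value `e_H N` at `G/H` and is
sent back to `N` (`bijective_phiPsi`).

The two box products are compared through the bilinear maps that they represent. Morphisms out of `M
□ N` in the category of Mackey functors are natural families `M(X) × N(Y) → Q(X × Y)`
(`LewisPairing`). Pulling back along the diagonal of `G/H` gives bilinear maps `M(G/H) × N(G/H) →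
Q(G/H)` that commute with restrictions and satisfy Frobenius reciprocity (`OrbitPairing`);
reciprocity is the Mackey formula for the pullback of the diagonal along `1 × f`. Conversely, an
orbit pairing extends orbit by orbit to all finite `G`-sets, and pairing the pullbacks of `m` and
`n` along the two projections of `X × Y` gives a natural family (`OrbitPairing.toLewis`).

On the module side, a pairing of the grades that respects `C`, `R` and Frobenius reciprocity induces
a morphism out of `M □ N` (`GradePairing.lift`): the recursive operators on `A` copy identities that
already hold in `μ_R(G)`, above all the double coset formula `elR_elI`. Because `I`, `C`, `R`
generate the morphisms between orbits, grade pairings for `Φ M` and `Φ N` are orbit pairings for `M`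
and `N`. Hence a preimage under `Φ` of `Φ M □ Φ N` represents natural pairings of Mackey functors. A
Kan extension must also be universal for functors that are not `R`-linear; `natApp_mem_linearPart`
shows that every natural transformation from `M ⊗ N` lands in the largest `R`-linear subfunctor of
its target.

For Mackey functors the elements `m ⊠ n` generate, the coherence maps act on them by restriction
along bijections of sets, and the coherence axioms become equalities between such bijections. For
modules the associator and the left unitor are transported along `Φ`. Frobenius reciprocity shows
that morphisms out of iterated products are determined by symbols with all factors in one grade
(`box_hom_ext_left`), and on these the axioms are immediate. `Φ` is symmetric monoidal because
diagonals are compatible with reassociation, exchange of factors and projection. -/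

namespace MackeyBox

/-! ### Equivariant maps between orbits -/

namespace FinGSet

variable {G : Type u} [Group G]

/-- The product of two equivariant maps. -/
def map {X Y X' Y' : FinGSet G} (f : X →[G] Y) (g : X' →[G] Y') : X.prod X' →[G] Y.prod Y' :=
  ⟨Prod.map f g, fun a p => Prod.ext (map_smul f a p.1) (map_smul g a p.2)⟩

/-- The map to a product with the given components. -/
def pair {X Y Z : FinGSet G} (f : Z →[G] X) (g : Z →[G] Y) : Z →[G] X.prod Y :=
  ⟨fun z => (f z, g z), fun a z => Prod.ext (map_smul f a z) (map_smul g a z)⟩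

theorem bijective_swap (X Y : FinGSet G) : Function.Bijective (swap X Y) :=
  (Equiv.prodComm X Y).bijective

theorem bijective_assoc (X Y Z : FinGSet G) : Function.Bijective (assoc X Y Z) :=
  (Equiv.prodAssoc X Y Z).bijective

section Orbit

variable [Finite G]

/-- The coset `gH` as an element of `G/H`. -/
def coset (H : Subgroup G) (g : G) : orbit H := (QuotientGroup.mk g : G ⧸ H)

theorem coset_eq {H : Subgroup G} {a b : G} : coset H a = coset H b ↔ a⁻¹ * b ∈ H :=
  QuotientGroup.eq

theorem exists_coset {H : Subgroup G} (x : orbit H) : ∃ g, x = coset H g := by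
  obtain ⟨g⟩ := x
  exact ⟨g, rfl⟩

theorem smul_coset (H : Subgroup G) (a g : G) : a • coset H g = coset H (a * g) := rfl

theorem coset_eq_smul (H : Subgroup G) (g : G) : coset H g = g • coset H 1 := by
  rw [smul_coset, mul_one]

theorem proj_coset {K H : Subgroup G} (h : K ≤ H) (g : G) :
    proj h (coset K g) = coset H g := rfl

theorem orbit_hom_ext {H : Subgroup G} {X : FinGSet G} {f f' : orbit H →[G] X}
    (h : f (coset H 1) = f' (coset H 1)) : f = f' := by
  ext x
  obtain ⟨g, rfl⟩ := exists_coset x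
  rw [coset_eq_smul, map_smul, map_smul, h]

/-- The equivariant map `G/H → X` with `gH ↦ g x`, for `H` contained in the stabilizer of `x`. -/
def orbitMap {H : Subgroup G} {X : FinGSet G} (x : X) (h : H ≤ MulAction.stabilizer G x) :
    orbit H →[G] X where
  toFun := Quotient.lift (fun g : G => g • x) (fun a b hab => by
    have := h (QuotientGroup.leftRel_apply.1 hab)
    rw [MulAction.mem_stabilizer_iff, mul_smul, inv_smul_eq_iff] at this
    exact this.symm)
  map_smul' := by
    rintro a ⟨b⟩
    exact mul_smul a b x

theorem orbitMap_coset {H : Subgroup G} {X : FinGSet G} (x : X)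
    (h : H ≤ MulAction.stabilizer G x) (g : G) : orbitMap x h (coset H g) = g • x := rfl

theorem le_stabilizer {H : Subgroup G} {X : FinGSet G} (f : orbit H →[G] X) :
    H ≤ MulAction.stabilizer G (f (coset H 1)) := fun g hg => by
  rw [MulAction.mem_stabilizer_iff, ← map_smul, smul_coset, mul_one]
  exact congrArg f (coset_eq.2 (by simpa using hg))

theorem orbitMap_injective {X : FinGSet G} (x : X) :
    Function.Injective (orbitMap x (le_refl (MulAction.stabilizer G x))) := by
  intro a b hab
  obtain ⟨a, rfl⟩ := exists_coset a
  obtain ⟨b, rfl⟩ := exists_coset b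
  rw [orbitMap_coset, orbitMap_coset] at hab
  rw [coset_eq, MulAction.mem_stabilizer_iff, mul_smul, inv_smul_eq_iff, hab]

/-- The inverse `G/ᵍH → G/H` of `c_{g,H}`, with `k ᵍH ↦ k g H`. -/
def conjInv (g : G) (H : Subgroup G) : orbit (MulAut.conj g • H) →[G] orbit H :=
  orbitMap (coset H g) fun k hk => by
    obtain ⟨h, hh, rfl⟩ := (Subgroup.mem_smul_pointwise_iff_exists _ _ _).1 hk
    rw [MulAction.mem_stabilizer_iff, smul_coset, coset_eq]
    simpa [MulAut.conj_apply, mul_assoc] using hh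

theorem conj_coset (g : G) (H : Subgroup G) (k : G) :
    conj g H (coset H k) = coset _ (k * g⁻¹) := rfl

theorem conjInv_coset (g : G) (H : Subgroup G) (k : G) :
    conjInv g H (coset _ k) = coset H (k * g) := rfl

theorem conjInv_conj (g : G) (H : Subgroup G) (x : orbit H) : conjInv g H (conj g H x) = x := by
  obtain ⟨k, rfl⟩ := exists_coset x
  rw [conj_coset, conjInv_coset, inv_mul_cancel_right]

theorem conj_conjInv (g : G) (H : Subgroup G) (x) : conj g H (conjInv g H x) = x := by
  obtain ⟨k, rfl⟩ := exists_coset x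
  rw [conjInv_coset, conj_coset, mul_inv_cancel_right]

/-- Every map `G/K → G/H` is a projection `G/K → G/ᵍH` followed by `k ᵍH ↦ k g H`. -/
theorem exists_eq_conjInv_comp_proj {K H : Subgroup G} (f : orbit K →[G] orbit H) :
    ∃ (g : G) (h : K ≤ MulAut.conj g • H), f = (conjInv g H).comp (proj h) := by
  -- The base coset goes to some `gH`. Since `K` fixes the base coset, it lies in the stabilizer
  -- `gHg⁻¹` of `gH`.
  obtain ⟨g, hg⟩ := exists_coset (f (coset K 1))
  have h : K ≤ MulAut.conj g • H := fun k hk => by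
    have := le_stabilizer f hk
    rw [hg, MulAction.mem_stabilizer_iff, smul_coset, coset_eq] at this
    have := H.inv_mem this
    refine (Subgroup.mem_smul_pointwise_iff_exists _ _ _).2 ⟨g⁻¹ * k * g, ?_, ?_⟩
    · simpa [mul_assoc] using this
    · simp [MulAut.conj_apply, mul_assoc]
  refine ⟨g, h, orbit_hom_ext ?_⟩
  rw [hg, MulActionHom.comp_apply, proj_coset, conjInv_coset, one_mul]

end Orbit

end FinGSet

/-! ### Calculus of spans, transfers and restrictions -/

namespace Omega

variable {R : Type u} [CommRing R] {G : Type u} [Group G]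

open FinGSet

theorem homOfSpan_congr {X Y : FinGSet G} {S T : Span X Y} (f : S.apex →[G] T.apex)
    (hf : Function.Bijective f) (hl : ∀ v, T.left (f v) = S.left v)
    (hr : ∀ v, T.right (f v) = S.right v) : homOfSpan (R := R) S = homOfSpan T :=
  congrArg (OmegaHom.mk R 1)
    (SpanClass.sound (Equiv.ofBijective f hf) (fun g v => map_smul f g v) hl hr)

theorem homOfSpan_comp {X Y Z : FinGSet G} (S : Span X Y) (T : Span Y Z) :
    homOfSpan (R := R) S ≫ homOfSpan T = homOfSpan (S.comp T) := by
  refine (OmegaHom.lift₂_mk _ _ _ _ _).trans ?_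
  rw [one_mul]
  rfl

theorem homOfSpan_prod {X Y X' Y' : FinGSet G} (S : Span X Y) (T : Span X' Y') :
    prodMap (homOfSpan (R := R) S) (homOfSpan T) = homOfSpan (S.prod T) := by
  refine (OmegaHom.lift₂_mk _ _ _ _ _).trans ?_
  rw [one_mul]
  rfl

theorem homOfSpan_add {X Y : FinGSet G} (S T : Span X Y) :
    homOfSpan (R := R) (S.add T) = homOfSpan S + homOfSpan T := by
  change (1 : R) ⊗ₜ[ℕ] equivShrink _ (SpanClass.mk S + SpanClass.mk T) =
    ((1 : R) ⊗ₜ[ℕ] equivShrink _ (SpanClass.mk S) + (1 : R) ⊗ₜ[ℕ] equivShrink _ (SpanClass.mk T) :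
      R ⊗[ℕ] SmallSpanClass X Y)
  rw [equivShrink_add, TensorProduct.tmul_add]

theorem homOfSpan_eq_zero {X Y : FinGSet G} (S : Span X Y) (h : IsEmpty S.apex) :
    homOfSpan (R := R) S = 0 := by
  have e : homOfSpan (R := R) S = homOfSpan (Span.zero X Y) :=
    homOfSpan_congr ⟨fun v => h.elim v, fun _ v => h.elim v⟩
      ⟨fun v => h.elim v, fun v => v.elim⟩ (fun v => h.elim v) (fun v => h.elim v)
  rw [e]
  change (1 : R) ⊗ₜ[ℕ] equivShrink _ (0 : SpanClass X Y) = (0 : R ⊗[ℕ] SmallSpanClass X Y)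
  rw [show equivShrink (SpanClass X Y) 0 = 0 from rfl, TensorProduct.tmul_zero]

/-- A span whose apex is the disjoint union of the images of the apices of the `T i` is the sum
of the `T i`. -/
theorem homOfSpan_eq_sum {X Y : FinGSet G} {ι : Type*} (s : Finset ι) (T : ι → Span X Y)
    (S : Span X Y) (e : ∀ i ∈ s, (T i).apex →[G] S.apex)
    (hl : ∀ i hi v, S.left (e i hi v) = (T i).left v)
    (hr : ∀ i hi v, S.right (e i hi v) = (T i).right v)
    (hinj : ∀ i hi j hj v w, e i hi v = e j hj w → i = j)
    (hinj' : ∀ i hi, Function.Injective (e i hi))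
    (hsurj : ∀ v, ∃ i hi w, e i hi w = v) :
    homOfSpan (R := R) S = ∑ i ∈ s, homOfSpan (T i) := by
  classical
  induction s using Finset.induction_on generalizing S with
  | empty =>
    rw [Finset.sum_empty]
    exact homOfSpan_eq_zero S ⟨fun v => by simpa using hsurj v⟩
  | insert i s hi ih =>
    rw [Finset.sum_insert hi]
    have hs : ∀ j, j ∈ s → j ∈ insert i s := fun j hj => Finset.mem_insert_of_mem hj
    have hi' := Finset.mem_insert_self i s
    -- Removing the piece `i` from the apex leaves the union of the images of the other pieces. This
    -- is `G`-stable, so it is again the apex of a span, to which the induction hypothesis applies.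
    let act : MulAction G {v : S.apex // ∃ j, ∃ hj : j ∈ s, ∃ w, e j (hs j hj) w = v} :=
      { smul := fun g v => ⟨g • v.1, by
          obtain ⟨j, hj, w, hw⟩ := v.2
          exact ⟨j, hj, g • w, by rw [map_smul, hw]⟩⟩
        one_smul := fun v => Subtype.ext (one_smul G v.1)
        mul_smul := fun a b v => Subtype.ext (mul_smul a b v.1) }
    let S' : Span X Y := ⟨⟨{v : S.apex // ∃ j, ∃ hj : j ∈ s, ∃ w, e j (hs j hj) w = v}⟩,
      ⟨fun v => S.left v.1, fun g v => map_smul S.left g v.1⟩,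
      ⟨fun v => S.right v.1, fun g v => map_smul S.right g v.1⟩⟩
    have ne : ∀ (v) (w : S'.apex), e i hi' v ≠ w.1 := by
      rintro v ⟨_, j, hj, w, rfl⟩ h
      have := hinj i hi' j (hs j hj) v w h
      exact hi (this ▸ hj)
    have h1 : homOfSpan (R := R) S = homOfSpan (T i) + homOfSpan S' := by
      rw [← homOfSpan_add]
      symm
      refine homOfSpan_congr (S := (T i).add S')
        ⟨Sum.elim (e i hi') Subtype.val, by
          rintro g (v | v)
          · exact map_smul (e i hi') g v
          · rfl⟩ ⟨?_, ?_⟩ ?_ ?_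
      · rintro (v | v) (w | w) h
        · exact congrArg Sum.inl (hinj' i hi' h)
        · exact (ne v w h).elim
        · exact (ne w v h.symm).elim
        · exact congrArg Sum.inr (Subtype.ext h)
      · intro v
        obtain ⟨j, hj, w, hw⟩ := hsurj v
        rcases Finset.mem_insert.1 hj with rfl | hj
        · exact ⟨.inl w, hw⟩
        · exact ⟨.inr ⟨v, j, hj, w, hw⟩, rfl⟩
      · rintro (v | v)
        · exact hl i hi' v
        · rfl
      · rintro (v | v)
        · exact hr i hi' v
        · rfl
    rw [h1, ih S' (fun j hj => ⟨fun w => ⟨e j (hs j hj) w, j, hj, w, rfl⟩,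
      fun g w => Subtype.ext (map_smul (e j (hs j hj)) g w)⟩)
      (fun j hj v => hl j (hs j hj) v) (fun j hj v => hr j (hs j hj) v)
      (fun j hj k hk v w h => hinj j (hs j hj) k (hs k hk) v w (congrArg Subtype.val h))
      (fun j hj v w h => hinj' j (hs j hj) (congrArg Subtype.val h))
      (fun ⟨v, j, hj, w, h⟩ => ⟨j, hj, w, Subtype.ext h⟩)]

theorem res_id (X : FinGSet G) : res (R := R) (MulActionHom.id G : X →[G] X) = 𝟙 (of R X) := rfl

theorem tr_id (X : FinGSet G) : tr (R := R) (MulActionHom.id G : X →[G] X) = 𝟙 (of R X) := rfl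

/-- The Mackey formula: `res` and `tr` of a pullback square commute. -/
theorem res_tr {X Y Z W : FinGSet G} (f : X →[G] Z) (g : Y →[G] Z) (p : W →[G] X) (q : W →[G] Y)
    (h : ∀ w, f (p w) = g (q w)) (hinj : ∀ w w', p w = p w' → q w = q w' → w = w')
    (hsurj : ∀ x y, f x = g y → ∃ w, p w = x ∧ q w = y) :
    res (R := R) f ≫ tr g = tr p ≫ res q := by
  rw [res, tr, tr, res, homOfSpan_comp, homOfSpan_comp]
  symm
  -- The composite `tr p ≫ res q` has as apex the pairs `(w, w)`, a copy of `W`. The hypotheses say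
  -- precisely that `W` maps bijectively onto the pullback of `f` and `g`.
  refine homOfSpan_congr ⟨fun w => ⟨(p w.1.1, q w.1.2), by
      rw [← show w.1.1 = w.1.2 from w.2]; exact h _⟩,
    fun g w => Subtype.ext (Prod.ext (map_smul p g w.1.1) (map_smul q g w.1.2))⟩ ⟨?_, ?_⟩ ?_ ?_
  · rintro ⟨⟨w, w₂⟩, hw⟩ ⟨⟨w', w₂'⟩, hw'⟩ e
    obtain rfl : w = w₂ := hw
    obtain rfl : w' = w₂' := hw'
    have := congrArg Subtype.val e
    obtain rfl := hinj w w' (congrArg Prod.fst this) (congrArg Prod.snd this)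
    rfl
  · rintro ⟨⟨x, y⟩, hxy⟩
    obtain ⟨w, rfl, rfl⟩ := hsurj x y hxy
    exact ⟨⟨(w, w), rfl⟩, rfl⟩
  · intro w; rfl
  · intro w; rfl

/-- The composite is a pullback over two identities, so its apex is the diagonal of `V`. Thus every
span is a transfer followed by a restriction, which is how all morphisms get reduced to these two
kinds. -/
theorem tr_res_eq_homOfSpan {X Y V : FinGSet G} (f : V →[G] X) (g : V →[G] Y) :
    tr (R := R) f ≫ res g = homOfSpan ⟨V, f, g⟩ := by
  rw [res, tr, homOfSpan_comp]
  symm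
  refine homOfSpan_congr ⟨fun v => ⟨(v, v), rfl⟩, fun _ _ => rfl⟩ ⟨?_, ?_⟩ (fun _ => rfl)
    (fun _ => rfl)
  · exact fun v w h => congrArg (fun p => p.1.1) h
  · rintro ⟨⟨v, w⟩, h⟩
    obtain rfl : v = w := h
    exact ⟨v, rfl⟩

theorem res_comp {X Y Z : FinGSet G} (f : X →[G] Y) (g : Y →[G] Z) :
    res (R := R) f ≫ res g = res (g.comp f) := by
  rw [res, res, homOfSpan_comp]
  symm
  refine homOfSpan_congr ⟨fun v => ⟨(v, f v), rfl⟩,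
    fun a v => Subtype.ext (Prod.ext rfl (map_smul f a v))⟩ ⟨?_, ?_⟩ (fun _ => rfl) (fun _ => rfl)
  · exact fun v w h => congrArg (fun p => p.1.1) h
  · rintro ⟨⟨v, w⟩, h⟩
    obtain rfl : f v = w := h
    exact ⟨v, rfl⟩

theorem tr_comp {X Y Z : FinGSet G} (f : X →[G] Y) (g : Y →[G] Z) :
    tr (R := R) g ≫ tr f = tr (g.comp f) := by
  rw [tr, tr, homOfSpan_comp]
  symm
  refine homOfSpan_congr ⟨fun v => ⟨(f v, v), rfl⟩,
    fun a v => Subtype.ext (Prod.ext (map_smul f a v) rfl)⟩ ⟨?_, ?_⟩ (fun _ => rfl) (fun _ => rfl)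
  · exact fun v w h => congrArg (fun p => p.1.2) h
  · rintro ⟨⟨v, w⟩, h⟩
    obtain rfl : v = f w := h
    exact ⟨w, rfl⟩

/-- For an injective `f` the pullback of `f` with itself is the diagonal copy of `X`. Together with
the disjoint case this gives the orthogonality relations of a biproduct. -/
theorem res_tr_of_injective {X Y : FinGSet G} (f : X →[G] Y) (hf : Function.Injective f) :
    res (R := R) f ≫ tr f = 𝟙 _ := by
  rw [res_tr f f (MulActionHom.id G) (MulActionHom.id G) (fun _ => rfl) (fun _ _ h _ => h)
    (fun x y h => ⟨x, rfl, hf h⟩), tr_id, res_id, Category.comp_id]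

theorem res_tr_of_disjoint {X Y Z : FinGSet G} (f : X →[G] Z) (g : Y →[G] Z)
    (h : ∀ x y, f x ≠ g y) : res (R := R) f ≫ tr g = 0 := by
  rw [res, tr, homOfSpan_comp]
  exact homOfSpan_eq_zero _ ⟨fun p => h _ _ p.2⟩

/-- A square formed by `f`, its inverse and two identities is a pullback, so the Mackey formula
applies. It lets the conjugations `C_{g,H}`, defined as transfers, be handled as restrictions. -/
theorem tr_eq_res {X Y : FinGSet G} (f : X →[G] Y) (g : Y →[G] X) (h : ∀ x, g (f x) = x)
    (h' : ∀ y, f (g y) = y) : tr (R := R) f = res g := by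
  have := res_tr (R := R) (MulActionHom.id G) f (MulActionHom.id G) g (fun y => (h' y).symm)
    (fun _ _ h _ => h) (fun x y hxy => ⟨x, rfl, by
      obtain rfl : x = f y := hxy
      exact h y⟩)
  simpa only [res_id, tr_id, Category.id_comp] using this

/-- Replaces the apex of a span by an isomorphic copy; this is used to turn the left leg of a span
into a projection of orbits. -/
theorem tr_eq_comp {X Y Z : FinGSet G} (f : X →[G] Y) (c : Z →[G] X) (d : X →[G] Z)
    (h : ∀ z, d (c z) = z) (h' : ∀ x, c (d x) = x) :
    tr (R := R) f = tr (f.comp c) ≫ res c := by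
  have : c.comp d = MulActionHom.id G := MulActionHom.ext h'
  rw [← tr_comp c f, Category.assoc, tr_eq_res c d h h', res_comp, this, res_id, Category.comp_id]

/-- The product of two morphisms between explicitly given finite `G`-sets. -/
noncomputable def prodHom {X Y X' Y' : FinGSet G} (f : of R X ⟶ of R Y) (g : of R X' ⟶ of R Y') :
    of R (X.prod X') ⟶ of R (Y.prod Y') := prodMap f g

theorem prodHom_res {X Y X' Y' : FinGSet G} (f : X →[G] Y) (g : X' →[G] Y') :
    prodHom (res (R := R) f) (res g) = res (map f g) := homOfSpan_prod _ _

theorem prodHom_tr {X Y X' Y' : FinGSet G} (f : X →[G] Y) (g : X' →[G] Y') :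
    prodHom (tr (R := R) f) (tr g) = tr (map f g) := homOfSpan_prod _ _

theorem prodHom_id (X Y : FinGSet G) :
    prodHom (𝟙 (of R X)) (𝟙 (of R Y)) = 𝟙 (of R (X.prod Y)) := prodMap_id _ _

theorem prodHom_comp {X Y Z X' Y' Z' : FinGSet G} (f : of R X ⟶ of R Y) (g : of R Y ⟶ of R Z)
    (f' : of R X' ⟶ of R Y') (g' : of R Y' ⟶ of R Z') :
    prodHom (f ≫ g) (f' ≫ g') = prodHom f f' ≫ prodHom g g' := prodMap_comp f g f' g'

/-- The product of morphisms as a bilinear map. -/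
noncomputable def prodL (X Y X' Y' : FinGSet G) : (of R X ⟶ of R Y) →ₗ[R] (of R X' ⟶ of R Y') →ₗ[R]
    (of R (X.prod X') ⟶ of R (Y.prod Y')) := OmegaHom.lift₂ (SpanClass.prod X Y X' Y')

theorem prodHom_add_left {X Y X' Y' : FinGSet G} (f f' : of R X ⟶ of R Y)
    (g : of R X' ⟶ of R Y') : prodHom (f + f') g = prodHom f g + prodHom f' g :=
  LinearMap.map_add₂ (prodL X Y X' Y') f f' g

theorem prodHom_add_right {X Y X' Y' : FinGSet G} (f : of R X ⟶ of R Y)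
    (g g' : of R X' ⟶ of R Y') : prodHom f (g + g') = prodHom f g + prodHom f g' :=
  map_add (prodL X Y X' Y' f) g g'

theorem prodHom_smul_left {X Y X' Y' : FinGSet G} (r : R) (f : of R X ⟶ of R Y)
    (g : of R X' ⟶ of R Y') : prodHom (r • f) g = r • prodHom f g :=
  LinearMap.map_smul₂ (prodL X Y X' Y') r f g

theorem prodHom_smul_right {X Y X' Y' : FinGSet G} (r : R) (f : of R X ⟶ of R Y)
    (g : of R X' ⟶ of R Y') : prodHom f (r • g) = r • prodHom f g :=
  map_smul (prodL X Y X' Y' f) r g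

-- Elements of `R ⊗_ℕ hom_{ω(G)}(X, Y)` are sums of multiples of spans, and a span is `tr f ≫ res
-- g`. No case for zero is needed, since `0` is `0` times the empty span.
@[elab_as_elim]
theorem hom_ind {X Y : FinGSet G} {p : (of R X ⟶ of R Y) → Prop}
    (add : ∀ a b, p a → p b → p (a + b)) (smul : ∀ (r : R) a, p a → p (r • a))
    (span : ∀ (V : FinGSet G) (f : V →[G] X) (g : V →[G] Y), p (tr f ≫ res g)) (a) : p a := by
  have h : ∀ r s, p (OmegaHom.mk R r s) := fun r s => by
    induction s using SpanClass.ind with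
    | h S =>
      have : OmegaHom.mk R r (SpanClass.mk S) = r • (homOfSpan S : of R X ⟶ of R Y) := by
        change _ = OmegaHom.mk R (r * 1) _
        rw [mul_one]
      rw [this]
      refine smul r _ ?_
      have := span S.apex S.left S.right
      exact (tr_res_eq_homOfSpan (R := R) S.left S.right) ▸ this
  refine OmegaHom.ind ?_ h add a
  have := smul 0 _ (h 0 (SpanClass.mk (Span.zero X Y)))
  rwa [zero_smul] at this

/-! ### Orbit decomposition and the double coset formula -/

section Orbit

variable [Finite G]

/-- The orbits of a finite `G`-set. -/
abbrev orbits (X : FinGSet G) : Type u := MulAction.orbitRel.Quotient G X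

noncomputable instance (X : FinGSet G) : Fintype (orbits X) := Fintype.ofFinite _

/-- The stabilizer of a representative of an orbit. -/
noncomputable abbrev stab {X : FinGSet G} (i : orbits X) : Subgroup G :=
  MulAction.stabilizer G (Quotient.out i)

/-- The embedding of an orbit. -/
noncomputable def emb {X : FinGSet G} (i : orbits X) : FinGSet.orbit (stab i) →[G] X :=
  orbitMap (Quotient.out i) le_rfl

theorem emb_injective {X : FinGSet G} (i : orbits X) : Function.Injective (emb i) :=
  orbitMap_injective _

theorem mk_emb {X : FinGSet G} (i : orbits X) (v) :
    (Quotient.mk (MulAction.orbitRel G X) (emb i v) : orbits X) = i := by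
  obtain ⟨g, rfl⟩ := exists_coset v
  conv_rhs => rw [← Quotient.out_eq i]
  exact Quotient.sound ⟨g, rfl⟩

theorem exists_emb {X : FinGSet G} (x : X) : ∃ (i : orbits X) (g : G), emb i (coset _ g) = x := by
  obtain ⟨g, hg⟩ := (MulAction.orbitRel G X).symm (@Quotient.mk_out _ (MulAction.orbitRel G X) x)
  exact ⟨Quotient.mk _ x, g, hg⟩

/-- The summand for the orbit `i` is the span with both legs equal to its inclusion, and the
identity span of `X` is the disjoint union of these. With the two orthogonality relations that
follow, `X` is the biproduct of its orbits in `Ω_R(G)`. -/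
theorem sum_tr_emb_res_emb (X : FinGSet G) :
    ∑ i : orbits X, tr (R := R) (emb i) ≫ res (emb i) = 𝟙 (of R X) := by
  simp only [tr_res_eq_homOfSpan]
  refine (homOfSpan_eq_sum Finset.univ _ (Span.id X) (fun i _ => emb i) (fun _ _ _ => rfl)
    (fun _ _ _ => rfl) ?_ (fun i _ => emb_injective i) ?_).symm
  · intro i _ j _ v w h
    exact (mk_emb i v).symm.trans ((congrArg _ h).trans (mk_emb j w))
  · intro x
    obtain ⟨i, g, h⟩ := exists_emb x
    exact ⟨i, Finset.mem_univ i, _, h⟩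

theorem res_emb_tr_emb_self {X : FinGSet G} (i : orbits X) :
    res (R := R) (emb i) ≫ tr (emb i) = 𝟙 _ := res_tr_of_injective _ (emb_injective i)

theorem res_emb_tr_emb_ne {X : FinGSet G} {i j : orbits X} (h : i ≠ j) :
    res (R := R) (emb i) ≫ tr (emb j) = 0 :=
  res_tr_of_disjoint _ _ fun v w e => h ((mk_emb i v).symm.trans ((congrArg _ e).trans (mk_emb j w)))

theorem exists_eq_emb_comp {K : Subgroup G} {X : FinGSet G} (b : FinGSet.orbit K →[G] X) :
    ∃ (i : orbits X) (c : FinGSet.orbit K →[G] FinGSet.orbit (stab i)), b = (emb i).comp c := by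
  obtain ⟨i, g, h⟩ := exists_emb (b (coset K 1))
  -- `K` fixes the image of the base coset in `X`, and the inclusion of an orbit is injective, so
  -- `K` already fixes the corresponding point of the orbit.
  have hK : K ≤ MulAction.stabilizer G (coset (stab i) g) := fun k hk => by
    have := le_stabilizer b hk
    rw [← h, MulAction.mem_stabilizer_iff, ← map_smul] at this
    exact emb_injective i this
  refine ⟨i, orbitMap (coset _ g) hK, orbit_hom_ext ?_⟩
  have : orbitMap _ hK (coset K 1) = coset _ g := by rw [orbitMap_coset, one_smul]
  exact h.symm.trans (congrArg (emb i) this.symm)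

/-- With this, compatibility with `C` becomes a case of compatibility with restrictions. -/
theorem elC_eq (g : G) (H : Subgroup G) : elC (R := R) g H = res (conjInv g H) :=
  tr_eq_res _ _ (conjInv_conj g H) (conj_conjInv g H)

theorem res_eq_elR_elC {K H : Subgroup G} (f : FinGSet.orbit K →[G] FinGSet.orbit H) :
    ∃ (g : G) (h : K ≤ MulAut.conj g • H), res (R := R) f = elR h ≫ elC g H := by
  obtain ⟨g, h, rfl⟩ := exists_eq_conjInv_comp_proj f
  exact ⟨g, h, by rw [elC_eq, elR, res_comp]⟩

/-- Morphisms out of `G/H` are generated by the `I^H_L` followed by restrictions. -/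
@[elab_as_elim]
theorem orbit_hom_ind {H : Subgroup G} {Y : FinGSet G} {p : (orbit R H ⟶ of R Y) → Prop}
    (zero : p 0) (add : ∀ a b, p a → p b → p (a + b)) (smul : ∀ (r : R) a, p a → p (r • a))
    (span : ∀ (L : Subgroup G) (h : L ≤ H) (g : FinGSet.orbit L →[G] Y), p (elI h ≫ res g)) (a) :
    p a := by
  induction a using hom_ind with
  | add a b ha hb => exact add a b ha hb
  | smul r a ha => exact smul r a ha
  | span V f g =>
    -- The identity of the apex is inserted between the two legs and split into orbits, so that only
    -- spans with a single orbit as apex remain.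
    rw [← Category.id_comp (res g), ← sum_tr_emb_res_emb V]
    simp only [Preadditive.sum_comp, Preadditive.comp_sum, Category.assoc, res_comp]
    simp only [← Category.assoc, tr_comp]
    refine Finset.sum_induction _ p add zero fun i _ => ?_
    -- The left leg is a projection up to conjugation by `k`. Replacing the apex by the orbit of the
    -- subgroup conjugated by `k⁻¹` makes it a genuine projection, and the isomorphism is absorbed
    -- into the right leg.
    obtain ⟨k, h, hk⟩ := exists_eq_conjInv_comp_proj (f.comp (emb i))
    have hK : MulAut.conj k⁻¹ • stab i ≤ H := by
      refine (conj_mono k⁻¹ h).trans_eq ?_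
      rw [smul_smul, ← map_mul, inv_mul_cancel, map_one, one_smul]
    have e1 : (f.comp (emb i)).comp (conjInv k⁻¹ (stab i)) = proj hK := by
      rw [hk]
      refine orbit_hom_ext ?_
      simp only [MulActionHom.comp_apply, conjInv_coset, proj_coset]
      rw [one_mul, inv_mul_cancel]
    have e2 : tr (R := R) (f.comp (emb i)) = elI hK ≫ res (conjInv k⁻¹ (stab i)) := by
      rw [tr_eq_comp _ (conjInv k⁻¹ (stab i)) _ (conj_conjInv _ _) (conjInv_conj _ _), e1]
      rfl
    rw [e2, Category.assoc, res_comp]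
    exact span _ _ _

theorem elI_elI {L K H : Subgroup G} (h : L ≤ K) (h' : K ≤ H) :
    elI (R := R) h' ≫ elI h = elI (h.trans h') := by
  rw [elI, elI, tr_comp, elI]
  exact congrArg tr (orbit_hom_ext rfl)

theorem elC_elI (g : G) {K H : Subgroup G} (h : K ≤ H) :
    elC (R := R) g H ≫ elI h = elI (conj_mono g h) ≫ elC g K := by
  rw [elI, elI, elC, elC, tr_comp, tr_comp]
  exact congrArg tr (orbit_hom_ext rfl)

/-- The Mackey formula. -/
theorem elR_elI {J K H : Subgroup G} (hJ : J ≤ H) (hK : K ≤ H) :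
    elR (R := R) hJ ≫ elI hK = ∑ g ∈ doubleCosetReps H J K,
      elI (conj_inf_le g J K) ≫ elC g (K ⊓ MulAut.conj g⁻¹ • J) ≫ elR inf_le_left := by
  have e : ∀ g : G, elI (R := R) (conj_inf_le g J K) ≫ elC g (K ⊓ MulAut.conj g⁻¹ • J) ≫
      elR inf_le_left = homOfSpan ⟨_, proj (conj_inf_le g J K),
        (proj inf_le_left).comp (conjInv g (K ⊓ MulAut.conj g⁻¹ • J))⟩ := fun g => by
    rw [elC_eq, elR, res_comp, elI, tr_res_eq_homOfSpan]
  simp only [e]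
  rw [elR, elI, res, tr, homOfSpan_comp]
  have hg : ∀ g ∈ doubleCosetReps H J K, ∃ q : DoubleCoset.Quotient (J.subgroupOf H : Set H)
    (K.subgroupOf H : Set H), ((Quotient.out q : H) : G) = g := fun g hg => by
    simpa [doubleCosetReps] using hg
  -- The apex of the composite is `G/J ×_{G/H} G/K`. The piece indexed by `g` is the orbit of `(J,
  -- gK)`, whose stabilizer is `J ∩ gKg⁻¹`; it is parametrized by `a ↦ (aJ, agK)`.
  refine homOfSpan_eq_sum _ _ _ (fun g hg' => ⟨fun x => ⟨(proj (conj_inf_le g J K) x,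
    (proj inf_le_left).comp (conjInv g (K ⊓ MulAut.conj g⁻¹ • J)) x), ?_⟩, ?_⟩) ?_ ?_ ?_ ?_ ?_
  · obtain ⟨q, rfl⟩ := hg g hg'
    obtain ⟨a, rfl⟩ := exists_coset x
    refine coset_eq.2 ?_
    change a⁻¹ * (a * _) ∈ H
    rw [inv_mul_cancel_left]
    exact (Quotient.out q).2
  · intro a x
    exact Subtype.ext (Prod.ext (map_smul _ a x) (map_smul _ a x))
  · intro _ _ _; rfl
  · intro _ _ _; rfl
  · intro g hg₁ g' hg₁' v w h
    obtain ⟨q, rfl⟩ := hg g hg₁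
    obtain ⟨q', rfl⟩ := hg g' hg₁'
    obtain ⟨a, rfl⟩ := exists_coset v
    obtain ⟨b, rfl⟩ := exists_coset w
    have h1 : a⁻¹ * b ∈ J := coset_eq.1 (congrArg (fun p => p.1.1) h)
    have h2 : (a * (Quotient.out q : H))⁻¹ * (b * (Quotient.out q' : H)) ∈ K :=
      coset_eq.1 (congrArg (fun p => p.1.2) h)
    -- The equalities `aJ = bJ` and `agK = bg'K` put `g` and `g'` into the same double coset of `J`
    -- and `K` in `H`.
    have : q = q' := by
      rw [← DoubleCoset.out_eq' _ _ q, ← DoubleCoset.out_eq' _ _ q', DoubleCoset.eq]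
      refine ⟨⟨b⁻¹ * a, hJ ?_⟩, ?_, ⟨_, hK h2⟩, h2, Subtype.ext ?_⟩
      · simpa using J.inv_mem h1
      · change b⁻¹ * a ∈ J
        simpa using J.inv_mem h1
      · simp [mul_assoc]
    rw [this]
  · intro g hg₁ v w h
    obtain ⟨a, rfl⟩ := exists_coset v
    obtain ⟨b, rfl⟩ := exists_coset w
    have h1 : a⁻¹ * b ∈ J := coset_eq.1 (congrArg (fun p => p.1.1) h)
    have h2 : (a * g)⁻¹ * (b * g) ∈ K := coset_eq.1 (congrArg (fun p => p.1.2) h)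
    refine coset_eq.2 ((Subgroup.mem_smul_pointwise_iff_exists _ _ _).2
      ⟨g⁻¹ * (a⁻¹ * b) * g, ⟨?_, ?_⟩, ?_⟩)
    · simpa [mul_assoc] using h2
    · exact (Subgroup.mem_smul_pointwise_iff_exists _ _ _).2 ⟨_, h1, by simp [mul_assoc]⟩
    · simp [MulAut.conj_apply, mul_assoc]
  · rintro ⟨⟨x, y⟩, h⟩
    obtain ⟨a, rfl⟩ := exists_coset x
    obtain ⟨b, rfl⟩ := exists_coset y
    have h : a⁻¹ * b ∈ H := coset_eq.1 h
    -- The point `(aJ, bK)` belongs to the double coset of `a⁻¹b`. If `a⁻¹b = jgk` with `g` the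
    -- chosen representative, it is the image of the coset of `aj`.
    let q := DoubleCoset.mk (J.subgroupOf H) (K.subgroupOf H) (⟨a⁻¹ * b, h⟩ : H)
    obtain ⟨j, hj, k, hk, e⟩ := (DoubleCoset.eq _ _ _ _).1 (DoubleCoset.out_eq' _ _ q)
    have e : a⁻¹ * b = j * (Quotient.out q : H) * k := congrArg Subtype.val e
    refine ⟨(Quotient.out q : H), (Set.Finite.mem_toFinset _).2 ⟨q, rfl⟩, coset _ (a * j),
      Subtype.ext (Prod.ext (coset_eq.2 ?_) (coset_eq.2 ?_))⟩
    · simpa using J.inv_mem hj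
    · change (a * j * (Quotient.out q : H))⁻¹ * b ∈ K
      have : b = a * (j * (Quotient.out q : H) * k) := by rw [← e, mul_inv_cancel_left]
      rw [this]
      simpa [mul_assoc] using Subgroup.mem_subgroupOf.1 hk

end Orbit

end Omega
end MackeyBox

namespace MackeyBox

open FinGSet Omega

variable {R : Type u} [CommRing R] {G : Type u} [Group G]

/-! ### Mackey functors are determined by their values on orbits -/

namespace MackeyFunctor

theorem act_sum (M : MackeyFunctor R G) {X Y : FinGSet G} {ι : Type*} (s : Finset ι)
    (f : ι → (of R X ⟶ of R Y)) (m : M.val Y) :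
    M.act (∑ i ∈ s, f i) m = ∑ i ∈ s, M.act (f i) m := map_sum (M.actL m) f s

theorem hom_act {M N : MackeyFunctor R G} (φ : M ⟶ N) {X Y : FinGSet G} (f : of R X ⟶ of R Y)
    (m : M.val Y) : (φ.hom.app (op (of R X))).hom (M.act f m) =
      N.act f ((φ.hom.app (op (of R Y))).hom m) :=
  congrArg (fun k => k.hom m) (φ.hom.naturality f.op)

theorem hom_ext {M N : MackeyFunctor R G} {φ ψ : M ⟶ N}
    (h : ∀ (X : FinGSet G) (m : M.val X),
      (φ.hom.app (op (of R X))).hom m = (ψ.hom.app (op (of R X))).hom m) : φ = ψ := by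
  refine ObjectProperty.hom_ext _ (NatTrans.ext (funext fun X => ?_))
  exact ModuleCat.hom_ext (LinearMap.ext fun m => h X.unop.gset m)

/-- A morphism of Mackey functors from a family of linear maps. -/
noncomputable def homMk {M N : MackeyFunctor R G} (φ : ∀ X : FinGSet G, M.val X →ₗ[R] N.val X)
    (h : ∀ {X Y : FinGSet G} (f : of R X ⟶ of R Y) (m : M.val Y),
      φ X (M.act f m) = N.act f (φ Y m)) : M ⟶ N :=
  ObjectProperty.homMk
    { app := fun X => ModuleCat.ofHom (φ X.unop.gset)
      naturality := fun X Y f => ModuleCat.hom_ext (LinearMap.ext fun m => h f.unop m) }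

theorem homMk_app {M N : MackeyFunctor R G} (φ : ∀ X : FinGSet G, M.val X →ₗ[R] N.val X)
    (h : ∀ {X Y : FinGSet G} (f : of R X ⟶ of R Y) (m : M.val Y),
      φ X (M.act f m) = N.act f (φ Y m)) (X : FinGSet G) (m : M.val X) :
    ((homMk φ h).hom.app (op (of R X))).hom m = φ X m := rfl

variable [Finite G]

theorem eq_sum_emb (M : MackeyFunctor R G) {X : FinGSet G} (m : M.val X) :
    m = ∑ i : orbits X, M.act (tr (emb i)) (M.act (res (emb i)) m) := by
  conv_lhs => rw [← M.act_id X m, ← sum_tr_emb_res_emb, act_sum]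
  exact Finset.sum_congr rfl fun i _ => M.act_comp _ _ _

/-- Elements of `M(X)` are determined by their restrictions to orbits. -/
theorem ext_orbit (M : MackeyFunctor R G) {X : FinGSet G} {m m' : M.val X}
    (h : ∀ (H : Subgroup G) (a : FinGSet.orbit H →[G] X), M.act (res a) m = M.act (res a) m') :
    m = m' := by
  rw [M.eq_sum_emb m, M.eq_sum_emb m']
  simp only [h]

theorem hom_ext_orbit {M N : MackeyFunctor R G} {φ ψ : M ⟶ N}
    (h : ∀ (H : Subgroup G) (m : M.val (FinGSet.orbit H)),
      (φ.hom.app (op (orbit R H))).hom m = (ψ.hom.app (op (orbit R H))).hom m) : φ = ψ := by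
  refine hom_ext fun X m => N.ext_orbit fun H a => ?_
  rw [← hom_act, ← hom_act]
  exact h H _

/-- A morphism of Mackey functors from its components on orbits. -/
theorem exists_hom_of_orbit {M N : MackeyFunctor R G}
    (φ : ∀ H : Subgroup G, M.val (FinGSet.orbit H) →ₗ[R] N.val (FinGSet.orbit H))
    (hφ : ∀ {H K : Subgroup G} (f : orbit R H ⟶ orbit R K) (m : M.val (FinGSet.orbit K)),
      φ H (M.act f m) = N.act f (φ K m)) :
    ∃ ψ : M ⟶ N, ∀ (H : Subgroup G) (m : M.val (FinGSet.orbit H)),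
      (ψ.hom.app (op (orbit R H))).hom m = φ H m := by
  -- The biproduct decomposition of `X` leaves no choice: `ψ` must be the diagonal matrix with the
  -- entries `φ (stab i)`.
  let ψ : ∀ X : FinGSet G, M.val X →ₗ[R] N.val X := fun X =>
    ∑ i : orbits X, N.act (tr (emb i)) ∘ₗ φ (stab i) ∘ₗ M.act (res (emb i))
  have ψ_apply : ∀ X m, ψ X m = ∑ i : orbits X, N.act (tr (emb i)) (φ (stab i)
      (M.act (res (emb i)) m)) := fun X m => LinearMap.sum_apply _ _ _
  refine ⟨homMk ψ ?_, fun H m => ?_⟩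
  · intro X Y f m
    -- Once `m` is expanded along the orbits of `Y`, each block of `f` is a morphism between two
    -- orbits, where `φ` is natural by hypothesis.
    have e : ∀ i : orbits X, φ (stab i) (M.act (res (emb i)) (M.act f m)) =
        N.act (res (emb i)) (N.act f (ψ Y m)) := fun i => by
      conv_lhs => rw [M.eq_sum_emb m]
      rw [ψ_apply]
      simp only [map_sum]
      refine Finset.sum_congr rfl fun j _ => ?_
      simp only [← act_comp]
      rw [← hφ, ← act_comp]
      simp only [Category.assoc]
    rw [ψ_apply]
    simp only [e]
    exact (N.eq_sum_emb _).symm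
  · rw [homMk_app, ψ_apply]
    simp only [← hφ, ← act_comp]
    simp only [hφ]
    rw [← act_sum, sum_tr_emb_res_emb, act_id]

end MackeyFunctor

/-- The representable Mackey functor `hom(-, X)`. -/
noncomputable def yoneda (R : Type u) [CommRing R] {G : Type u} [Group G] (X : FinGSet G) :
    MackeyFunctor R G where
  obj := (linearYoneda R (Omega R G)).obj (of R X)
  property := by
    refine ⟨fun X Y f g => ?_, fun X Y r f => ?_⟩
    · ext x
      exact Preadditive.add_comp _ _ _ f g x
    · ext x
      exact Linear.smul_comp _ _ _ r f x

/-- Composition with a morphism, as a morphism of representable functors. -/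
noncomputable def yonedaMap {X Y : FinGSet G} (f : of R X ⟶ of R Y) : yoneda R X ⟶ yoneda R Y :=
  ObjectProperty.homMk ((linearYoneda R (Omega R G)).map f)

variable [Finite G]

/-! ### `Φ` is fully faithful -/

section Phi

/-- The component of an element of `Φ M` in the grade `H`. -/
noncomputable def phiApply (M : MackeyFunctor R G) (H : Subgroup G) :
    (Phi R G).obj M →ₗ[R] M.val (FinGSet.orbit H) where
  toFun m := (show PhiCarrier M from m) H
  map_add' _ _ := rfl
  map_smul' r m := by
    change ∑ K, M.act ((algebraMap R (MackeyAlgebra R G) r) H K) _ = r • _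
    have : algebraMap R (MackeyAlgebra R G) r = r • 1 := Algebra.algebraMap_eq_smul_one r
    rw [this, Finset.sum_eq_single H]
    · rw [MackeyAlgebra.smul_apply, MackeyAlgebra.one_same, M.act_smul, M.act_id]
    · intro K _ hK
      rw [MackeyAlgebra.smul_apply, MackeyAlgebra.one_ne hK.symm, smul_zero, M.act_zero]
    · simp

theorem phi_ext {M : MackeyFunctor R G} {m m' : (Phi R G).obj M}
    (h : ∀ H, phiApply M H m = phiApply M H m') : m = m' := funext h

theorem phiApply_map {M N : MackeyFunctor R G} (f : M ⟶ N) (H : Subgroup G)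
    (m : (Phi R G).obj M) : phiApply N H (((Phi R G).map f).hom m) =
      (f.hom.app (op (orbit R H))).hom (phiApply M H m) := rfl

theorem phiApply_smul (M : MackeyFunctor R G) (a : MackeyAlgebra R G) (m : (Phi R G).obj M)
    (H : Subgroup G) : phiApply M H (a • m) = ∑ K : Subgroup G, M.act (a H K) (phiApply M K m) :=
  rfl

theorem phiApply_single (M : MackeyFunctor R G) (H : Subgroup G) (m : M.val (FinGSet.orbit H)) :
    phiApply M H (phiSingle M H m) = m := by
  classical
  exact Pi.single_eq_same (M := fun K : Subgroup G => M.val (FinGSet.orbit K)) H m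

theorem phiApply_single_ne (M : MackeyFunctor R G) {H K : Subgroup G} (h : K ≠ H)
    (m : M.val (FinGSet.orbit H)) : phiApply M K (phiSingle M H m) = 0 := by
  classical
  exact Pi.single_eq_of_ne (M := fun K : Subgroup G => M.val (FinGSet.orbit K)) h m

theorem single_smul_phi (M : MackeyFunctor R G) {H K : Subgroup G} (x : orbit R H ⟶ orbit R K)
    (m : (Phi R G).obj M) :
    MackeyAlgebra.single x • m = phiSingle M H (M.act x (phiApply M K m)) := by
  refine phi_ext fun L => ?_
  rw [phiApply_smul]
  by_cases h : L = H
  · subst h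
    rw [phiApply_single, Finset.sum_eq_single K, MackeyAlgebra.single_same]
    · intro K' _ hK
      rw [MackeyAlgebra.single_ne _ fun e => hK e.2, M.act_zero]
    · simp
  · rw [phiApply_single_ne M h]
    exact Finset.sum_eq_zero fun K' _ => by
      rw [MackeyAlgebra.single_ne _ fun e => h e.1, M.act_zero]

theorem map_phiSingle {M N : MackeyFunctor R G} (f : M ⟶ N) (H : Subgroup G)
    (m : M.val (FinGSet.orbit H)) : ((Phi R G).map f).hom (phiSingle M H m) =
      phiSingle N H ((f.hom.app (op (orbit R H))).hom m) := by
  refine phi_ext fun K => ?_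
  rw [phiApply_map]
  by_cases h : K = H
  · subst h
    rw [phiApply_single, phiApply_single]
  · rw [phiApply_single_ne M h, phiApply_single_ne N h, map_zero]

theorem sum_phiSingle {M : MackeyFunctor R G} (m : (Phi R G).obj M) :
    ∑ H : Subgroup G, phiSingle M H (phiApply M H m) = m := by
  refine phi_ext fun K => ?_
  rw [map_sum, Finset.sum_eq_single K, phiApply_single]
  · intro H _ h
    rw [phiApply_single_ne M h.symm]
  · simp

/-- The inclusion of the grade `H` as a linear map. -/
noncomputable def phiSingleL (M : MackeyFunctor R G) (H : Subgroup G) :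
    M.val (FinGSet.orbit H) →ₗ[R] (Phi R G).obj M where
  toFun := phiSingle M H
  map_add' m m' := by
    classical
    exact Pi.single_add (f := fun K : Subgroup G => M.val (FinGSet.orbit K)) H m m'
  map_smul' r m := by
    refine phi_ext fun K => ?_
    rw [map_smul]
    by_cases h : K = H
    · subst h
      rw [phiApply_single, phiApply_single]
      rfl
    · rw [phiApply_single_ne M h, phiApply_single_ne M h, smul_zero]

theorem hom_smul {M N : ModuleCat.{u} (MackeyAlgebra R G)} (φ : M ⟶ N) (a : MackeyAlgebra R G)
    (m : M) : φ.hom (a • m) = a • φ.hom m := φ.hom.map_smul a m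

/-- A morphism of modules is linear over `R`. -/
noncomputable def homR {M N : ModuleCat.{u} (MackeyAlgebra R G)} (φ : M ⟶ N) : M →ₗ[R] N where
  toFun := φ.hom
  map_add' := map_add φ.hom
  map_smul' r m := φ.hom.map_smul (algebraMap R (MackeyAlgebra R G) r) m

instance : (Phi R G).Faithful where
  map_injective {M N f g} h := MackeyFunctor.hom_ext_orbit fun H m => by
    have := congrArg (fun k => phiApply N H (k.hom (phiSingle M H m))) h
    simpa only [phiApply_map, phiApply_single] using this

/-- Commuting with multiplication by `single f` is exactly naturality for the morphism `f` between
orbits, so the components of a module map extend to all finite `G`-sets. -/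
instance : (Phi R G).Full where
  map_surjective {M N} φ := by
    have h1 : ∀ {H K : Subgroup G} (f : orbit R H ⟶ orbit R K) (m : M.val (FinGSet.orbit K)),
        phiApply N H (φ.hom (phiSingle M H (M.act f m))) =
          N.act f (phiApply N K (φ.hom (phiSingle M K m))) := by
      intro H K f m
      have := hom_smul φ (MackeyAlgebra.single f) (phiSingle M K m)
      rw [single_smul_phi, single_smul_phi, phiApply_single] at this
      rw [this, phiApply_single]
    obtain ⟨ψ, hψ⟩ := MackeyFunctor.exists_hom_of_orbit
      (fun H => phiApply N H ∘ₗ homR φ ∘ₗ phiSingleL M H) h1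
    refine ⟨ψ, ?_⟩
    refine ModuleCat.hom_ext (LinearMap.ext fun m => ?_)
    rw [← sum_phiSingle m, map_sum, map_sum]
    refine Finset.sum_congr rfl fun H _ => ?_
    rw [map_phiSingle, hψ]
    -- Since `φ` commutes with the idempotent of the grade `H`, it sends an element of that grade to
    -- an element concentrated in the grade `H`.
    have := hom_smul φ (MackeyAlgebra.single (𝟙 (orbit R H))) (phiSingle M H (phiApply M H m))
    rw [single_smul_phi, single_smul_phi, MackeyFunctor.act_id, MackeyFunctor.act_id,
      phiApply_single] at this
    exact this.symm

end Phi

/-! ### `Φ` is essentially surjective -/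

section EssSurj

/-- A morphism, as an element of the representable functor. -/
def toYoneda {X Y : FinGSet G} (f : of R Y ⟶ of R X) : (yoneda R X).val Y := f

theorem act_toYoneda {X Y Z : FinGSet G} (f : of R Y ⟶ of R X) (g : of R Z ⟶ of R Y) :
    (yoneda R X).act g (toYoneda f) = toYoneda (g ≫ f) := rfl

theorem yonedaMap_app {X Y Z : FinGSet G} (f : of R X ⟶ of R Y) (g : of R Z ⟶ of R X) :
    ((yonedaMap f).hom.app (op (of R Z))).hom (toYoneda g) = toYoneda (g ≫ f) := rfl

/-- The component of an element of `Φ(hom(-, X))`, as a morphism. -/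
noncomputable abbrev yonedaEntry {X : FinGSet G} (x : (Phi R G).obj (yoneda R X))
    (H : Subgroup G) : orbit R H ⟶ of R X := phiApply (yoneda R X) H x

theorem yonedaEntry_smul {X : FinGSet G} (a : MackeyAlgebra R G)
    (x : (Phi R G).obj (yoneda R X)) (H : Subgroup G) :
    yonedaEntry (a • x) H = ∑ K : Subgroup G, a H K ≫ yonedaEntry x K := rfl

variable (N : ModuleCat.{u} (MackeyAlgebra R G))

instance smulCommClass : SMulCommClass (MackeyAlgebra R G) R N :=
  IsScalarTower.to_smulCommClass'

/-- The Mackey functor `X ↦ Hom(Φ(hom(-, X)), N)`. -/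
noncomputable def Psi : MackeyFunctor R G where
  obj :=
    { obj := fun X => ModuleCat.of R
        ((Phi R G).obj (yoneda R X.unop.gset) →ₗ[MackeyAlgebra R G] N)
      map := fun f => ModuleCat.ofHom
        { toFun := fun φ => φ ∘ₗ ((Phi R G).map (yonedaMap f.unop)).hom
          map_add' := fun _ _ => rfl
          map_smul' := fun _ _ => rfl }
      map_id := fun X => by
        refine ModuleCat.hom_ext (LinearMap.ext fun φ => LinearMap.ext fun x => ?_)
        change φ _ = φ x
        refine congrArg φ (funext fun H => ?_)
        exact Category.comp_id (yonedaEntry x H)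
      map_comp := fun f g => by
        refine ModuleCat.hom_ext (LinearMap.ext fun φ => LinearMap.ext fun x => ?_)
        change φ _ = φ _
        refine congrArg φ (funext fun H => ?_)
        exact (Category.assoc (yonedaEntry x H) g.unop f.unop).symm }
  property := by
    refine ⟨fun X Y f g => ?_, fun X Y r f => ?_⟩
    · refine ModuleCat.hom_ext (LinearMap.ext fun φ => LinearMap.ext fun x => ?_)
      change φ _ = φ _ + φ _
      rw [← map_add]
      refine congrArg φ (funext fun H => ?_)
      exact Preadditive.comp_add _ _ _ (yonedaEntry x H) f g
    · refine ModuleCat.hom_ext (LinearMap.ext fun φ => LinearMap.ext fun x => ?_)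
      refine Eq.trans ?_ (map_smul φ (algebraMap R (MackeyAlgebra R G) r)
        (((Phi R G).map (yonedaMap f)).hom x))
      refine congrArg φ (phi_ext fun H => ?_)
      refine Eq.trans ?_ (map_smul (phiApply _ H) r _).symm
      exact Linear.comp_smul _ _ _ (yonedaEntry x H) r f

open Classical in
/-- The elements of `Φ(hom(-, G/K))` as elements of the Mackey algebra with one column. -/
noncomputable def column (K : Subgroup G) :
    (Phi R G).obj (yoneda R (FinGSet.orbit K)) →ₗ[MackeyAlgebra R G] MackeyAlgebra R G where
  toFun x := fun H => Pi.single K (yonedaEntry x H)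
  map_add' x y := by
    funext H
    exact Pi.single_add (f := fun L : Subgroup G => orbit R H ⟶ orbit R L) K
      (yonedaEntry x H) (yonedaEntry y H)
  map_smul' a x := by
    funext H L
    change _ = ∑ H', a H H' ≫ (Pi.single K (yonedaEntry x H') :
      ∀ L : Subgroup G, orbit R H' ⟶ orbit R L) L
    by_cases h : L = K
    · subst h
      simp only [Pi.single_eq_same]
      exact yonedaEntry_smul a x H
    · rw [Finset.sum_eq_zero fun H' _ => by rw [Pi.single_eq_of_ne h, Limits.comp_zero]]
      exact Pi.single_eq_of_ne (M := fun L : Subgroup G => orbit R H ⟶ orbit R L) h _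

/-- The generator `id` of `Φ(hom(-, G/H))`. -/
noncomputable def gen (H : Subgroup G) : (Phi R G).obj (yoneda R (FinGSet.orbit H)) :=
  phiSingle (yoneda R (FinGSet.orbit H)) H (toYoneda (𝟙 (orbit R H)))

theorem single_smul_gen {H K : Subgroup G} (f : orbit R H ⟶ orbit R K) :
    MackeyAlgebra.single f • gen K = phiSingle (yoneda R (FinGSet.orbit K)) H (toYoneda f) := by
  rw [single_smul_phi, gen, phiApply_single, act_toYoneda, Category.comp_id]

theorem map_gen {H K : Subgroup G} (f : orbit R H ⟶ orbit R K) :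
    ((Phi R G).map (yonedaMap f)).hom (gen H) = MackeyAlgebra.single f • gen K := by
  rw [single_smul_gen, gen, map_phiSingle, yonedaMap_app, Category.id_comp]

theorem eq_sum_smul_gen {K : Subgroup G} (x : (Phi R G).obj (yoneda R (FinGSet.orbit K))) :
    x = ∑ H : Subgroup G, MackeyAlgebra.single (yonedaEntry x H) • gen K := by
  conv_lhs => rw [← sum_phiSingle x]
  exact Finset.sum_congr rfl fun H _ => (single_smul_gen _).symm

/-- Only the column `K` of `a` acts nontrivially on a generator that lives in the grade `K`. -/
theorem smul_gen (a : MackeyAlgebra R G) (K : Subgroup G) :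
    a • gen (R := R) K = ∑ H : Subgroup G, MackeyAlgebra.single (a H K) • gen K := by
  rw [eq_sum_smul_gen (a • gen K)]
  refine Finset.sum_congr rfl fun H _ => ?_
  rw [yonedaEntry_smul, Finset.sum_eq_single K]
  · have : yonedaEntry (gen (R := R) K) K = 𝟙 _ := phiApply_single _ _ _
    rw [this, Category.comp_id]
  · intro L _ hL
    have : yonedaEntry (gen (R := R) K) L = 0 := phiApply_single_ne _ hL _
    rw [this, Limits.comp_zero]
  · simp

theorem column_gen (K : Subgroup G) :
    column K (gen (R := R) K) = MackeyAlgebra.single (𝟙 (orbit R K)) := by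
  classical
  funext H L
  change (Pi.single K (yonedaEntry (gen K) H) : ∀ L : Subgroup G, orbit R H ⟶ orbit R L) L = _
  by_cases h : L = K
  · subst h
    rw [Pi.single_eq_same]
    by_cases h' : H = L
    · subst h'
      rw [MackeyAlgebra.single_same]
      exact phiApply_single _ _ _
    · rw [MackeyAlgebra.single_ne _ fun e => h' e.1]
      exact phiApply_single_ne _ h' _
  · rw [MackeyAlgebra.single_ne _ fun e => h e.2, Pi.single_eq_of_ne h]

variable {N} in
/-- The component of an element of `Φ(Ψ N)`, as a linear map. -/
noncomputable def psiEntry (φ : (Phi R G).obj (Psi N)) (H : Subgroup G) :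
    (Phi R G).obj (yoneda R (FinGSet.orbit H)) →ₗ[MackeyAlgebra R G] N := phiApply (Psi N) H φ

theorem psiEntry_smul (a : MackeyAlgebra R G) (φ : (Phi R G).obj (Psi N)) (H : Subgroup G) (x) :
    psiEntry (a • φ) H x = ∑ K : Subgroup G,
      psiEntry φ K (((Phi R G).map (yonedaMap (a H K))).hom x) := by
  have : psiEntry (a • φ) H = ∑ K : Subgroup G,
    psiEntry φ K ∘ₗ ((Phi R G).map (yonedaMap (a H K))).hom := rfl
  rw [this, LinearMap.sum_apply]
  rfl

/-- The evaluation `Φ(Ψ N) → N` at the generators. -/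
noncomputable def phiPsi : (Phi R G).obj (Psi N) →ₗ[MackeyAlgebra R G] N where
  toFun φ := ∑ H : Subgroup G, psiEntry φ H (gen H)
  map_add' φ ψ := Finset.sum_add_distrib
  map_smul' a φ := by
    simp only [psiEntry_smul, RingHom.id_apply, Finset.smul_sum]
    rw [Finset.sum_comm]
    refine Finset.sum_congr rfl fun K _ => ?_
    rw [← map_smul, smul_gen, map_sum]
    simp only [map_gen]

theorem phiPsi_apply (φ : (Phi R G).obj (Psi N)) :
    phiPsi N φ = ∑ H : Subgroup G, psiEntry φ H (gen H) := rfl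

/-- The generator is fixed by the idempotent of its grade, hence so is its image. The summands of
`phiPsi` therefore lie in different grades of `N` and cannot cancel. -/
theorem single_smul_psiEntry (φ : (Phi R G).obj (Psi N)) (H : Subgroup G) :
    MackeyAlgebra.single (𝟙 (orbit R H)) • psiEntry φ H (gen H) = psiEntry φ H (gen H) := by
  rw [← map_smul, single_smul_gen]
  rfl

theorem single_id_mul_single_ne {H K L : Subgroup G} (h : H ≠ K) (f : orbit R K ⟶ orbit R L) :
    MackeyAlgebra.single (𝟙 (orbit R H)) * MackeyAlgebra.single f = 0 := by
  funext A B
  rw [MackeyAlgebra.mul_def]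
  refine Finset.sum_eq_zero fun C _ => ?_
  by_cases hC : C = H
  · rw [MackeyAlgebra.single_ne f fun e => h (hC.symm.trans e.1), Limits.comp_zero]
  · rw [MackeyAlgebra.single_ne _ fun e => hC e.2, Limits.zero_comp]

/-- This is Yoneda for modules. The module `Φ(hom(-, G/H))` is `μ e_H`, so a map from it to `N`
amounts to an element of `e_H N`, the image of the generator; and `N` is the direct sum of the `e_H
N` because the `e_H` are orthogonal idempotents with sum `1`. -/
theorem bijective_phiPsi : Function.Bijective (phiPsi N) := by
  constructor
  · rw [injective_iff_map_eq_zero]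
    intro φ hφ
    refine phi_ext fun H => ?_
    -- Multiplying the vanishing sum by the idempotent of `H` isolates its term for `H`.
    have h : psiEntry φ H (gen H) = 0 := by
      rw [← single_smul_psiEntry, ← smul_zero (MackeyAlgebra.single (𝟙 (orbit R H))), ← hφ,
        phiPsi_apply, Finset.smul_sum, Finset.sum_eq_single H]
      · intro K _ hK
        rw [← single_smul_psiEntry, ← mul_smul, single_id_mul_single_ne hK.symm, zero_smul]
      · simp
    refine LinearMap.ext fun x => ?_
    change psiEntry φ H x = 0
    rw [eq_sum_smul_gen x, map_sum]
    refine Finset.sum_eq_zero fun K _ => ?_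
    rw [map_smul, h, smul_zero]
  · intro n
    -- The component at `H` embeds `μ e_H` in `μ` as a column and then acts on `n`. The generator
    -- goes to `e_H n`, and these elements add up to `n`.
    let φ : (Phi R G).obj (Psi N) := fun H : Subgroup G =>
      (LinearMap.toSpanSingleton (MackeyAlgebra R G) N n ∘ₗ column H :
        (Phi R G).obj (yoneda R (FinGSet.orbit H)) →ₗ[MackeyAlgebra R G] N)
    have : ∀ H, psiEntry φ H (gen H) = MackeyAlgebra.single (𝟙 (orbit R H)) • n := fun H => by
      rw [← column_gen]
      rfl
    refine ⟨φ, ?_⟩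
    rw [phiPsi_apply]
    simp only [this]
    rw [← Finset.sum_smul, ← MackeyAlgebra.one_def, one_smul]

instance : (Phi R G).EssSurj where
  mem_essImage N :=
    ⟨Psi N, ⟨(LinearEquiv.ofBijective (phiPsi N) (bijective_phiPsi N)).toModuleIso⟩⟩

instance : (Phi R G).IsEquivalence where

end EssSurj

end MackeyBox

/-! ### Pairings on products and pairings on orbits -/

namespace MackeyBox

open FinGSet Omega

variable {R : Type u} [CommRing R] {G : Type u} [Group G]

namespace FinGSet

theorem map_comp_diag {X Y Z : FinGSet G} (f : Z →[G] X) (g : Z →[G] Y) :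
    (map f g).comp (diag Z) = pair f g := rfl

theorem diag_comp {X Y : FinGSet G} (f : X →[G] Y) : (diag Y).comp f = pair f f := rfl

/-- The first projection of a pullback. -/
def pullbackFst {V W Y : FinGSet G} (f : V →[G] Y) (g : W →[G] Y) : pullback f g →[G] V :=
  ⟨fun p => p.1.1, fun _ _ => rfl⟩

/-- The second projection of a pullback. -/
def pullbackSnd {V W Y : FinGSet G} (f : V →[G] Y) (g : W →[G] Y) : pullback f g →[G] W :=
  ⟨fun p => p.1.2, fun _ _ => rfl⟩

theorem pullback_condition {V W Y : FinGSet G} (f : V →[G] Y) (g : W →[G] Y) :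
    f.comp (pullbackFst f g) = g.comp (pullbackSnd f g) := MulActionHom.ext fun p => p.2

end FinGSet

theorem Omega.res_tr_pullback {V W Y : FinGSet G} (f : V →[G] Y) (g : W →[G] Y) :
    res (R := R) f ≫ tr g = tr (pullbackFst f g) ≫ res (pullbackSnd f g) :=
  res_tr _ _ _ _ (fun p => p.2) (fun _ _ h h' => Subtype.ext (Prod.ext h h'))
    (fun x y h => ⟨⟨(x, y), h⟩, rfl, rfl⟩)

namespace MackeyFunctor

theorem act_res_comp (M : MackeyFunctor R G) {X Y Z : FinGSet G} (f : X →[G] Y) (g : Y →[G] Z)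
    (m : M.val Z) : M.act (res f) (M.act (res g) m) = M.act (res (g.comp f)) m := by
  rw [← act_comp, res_comp]

theorem act_tr_comp (M : MackeyFunctor R G) {X Y Z : FinGSet G} (f : X →[G] Y) (g : Y →[G] Z)
    (m : M.val X) : M.act (tr g) (M.act (tr f) m) = M.act (tr (g.comp f)) m := by
  rw [← act_comp, tr_comp]

theorem act_res_id (M : MackeyFunctor R G) {X : FinGSet G} (m : M.val X) :
    M.act (res (MulActionHom.id G)) m = m := M.act_id X m

end MackeyFunctor

/-- A family of bilinear maps `M(X) × N(Y) → Q(X × Y)`, natural in `X` and `Y`. -/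
structure LewisPairing (M N Q : MackeyFunctor R G) where
  toFun : ∀ X Y : FinGSet G, M.val X →ₗ[R] N.val Y →ₗ[R] Q.val (X.prod Y)
  nat : ∀ {X Y X' Y' : FinGSet G} (f : of R X ⟶ of R Y) (g : of R X' ⟶ of R Y') (m : M.val Y)
    (n : N.val Y'), toFun X X' (M.act f m) (N.act g n) = Q.act (prodHom f g) (toFun Y Y' m n)

/-- Naturality for restrictions and transfers implies naturality for all morphisms. -/
theorem pairing_nat_of_res_tr {M N Q : MackeyFunctor R G}
    (l : ∀ X Y : FinGSet G, M.val X →ₗ[R] N.val Y →ₗ[R] Q.val (X.prod Y))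
    (hres : ∀ {X Y X' Y' : FinGSet G} (f : X →[G] Y) (g : X' →[G] Y') (m : M.val Y)
      (n : N.val Y'), l X X' (M.act (res f) m) (N.act (res g) n) =
        Q.act (res (map f g)) (l Y Y' m n))
    (htr : ∀ {X Y Z : FinGSet G} (f : X →[G] Y) (m : M.val X) (n : N.val Z),
      l Y Z (M.act (tr f) m) n = Q.act (tr (map f (MulActionHom.id G))) (l X Z m n))
    (htr' : ∀ {X Y Z : FinGSet G} (f : X →[G] Y) (m : M.val Z) (n : N.val X),
      l Z Y m (N.act (tr f) n) = Q.act (tr (map (MulActionHom.id G) f)) (l Z X m n))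
    {X Y X' Y' : FinGSet G} (f : of R X ⟶ of R Y) (g : of R X' ⟶ of R Y') (m : M.val Y)
    (n : N.val Y') : l X X' (M.act f m) (N.act g n) = Q.act (prodHom f g) (l Y Y' m n) := by
  -- One variable is treated at a time: both sides are linear in the morphism, so a span suffices,
  -- and a span is a transfer followed by a restriction. The two variables are combined at the end
  -- by `f × g = (f × 1) ≫ (1 × g)`.
  have h1 : ∀ {X Y Z : FinGSet G} (f : of R X ⟶ of R Y) (m : M.val Y) (n : N.val Z),
      l X Z (M.act f m) n = Q.act (prodHom f (𝟙 (of R Z))) (l Y Z m n) := by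
    intro X Y Z f m n
    induction f using hom_ind with
    | add a b ha hb =>
      rw [M.act_add, map_add, LinearMap.add_apply, ha, hb, prodHom_add_left, Q.act_add]
    | smul r a ha =>
      rw [M.act_smul, map_smul, LinearMap.smul_apply, ha, prodHom_smul_left, Q.act_smul]
    | span V a b =>
      have := hres b (MulActionHom.id G) m n
      rw [N.act_res_id] at this
      rw [M.act_comp, htr, this, ← Q.act_comp, ← Category.comp_id (𝟙 (of R Z)), prodHom_comp,
        ← prodHom_tr, ← prodHom_res]
      rfl
  have h2 : ∀ {X Y Z : FinGSet G} (f : of R X ⟶ of R Y) (m : M.val Z) (n : N.val Y),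
      l Z X m (N.act f n) = Q.act (prodHom (𝟙 (of R Z)) f) (l Z Y m n) := by
    intro X Y Z f m n
    induction f using hom_ind with
    | add a b ha hb =>
      rw [N.act_add, map_add, ha, hb, prodHom_add_right, Q.act_add]
    | smul r a ha =>
      rw [N.act_smul, map_smul, ha, prodHom_smul_right, Q.act_smul]
    | span V a b =>
      have := hres (MulActionHom.id G) b m n
      rw [M.act_res_id] at this
      rw [N.act_comp, htr', this, ← Q.act_comp, ← Category.comp_id (𝟙 (of R Z)), prodHom_comp,
        ← prodHom_tr, ← prodHom_res]
      rfl
  rw [h1, h2, ← Q.act_comp]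
  conv_rhs => rw [← Category.comp_id f, ← Category.id_comp g, prodHom_comp]

variable [Finite G]

/-- A family of bilinear maps `M(G/H) × N(G/H) → Q(G/H)`, compatible with restrictions and
satisfying Frobenius reciprocity. -/
structure OrbitPairing (M N Q : MackeyFunctor R G) where
  toFun : ∀ H : Subgroup G, M.val (FinGSet.orbit H) →ₗ[R] N.val (FinGSet.orbit H) →ₗ[R]
    Q.val (FinGSet.orbit H)
  res : ∀ {K H : Subgroup G} (f : FinGSet.orbit K →[G] FinGSet.orbit H) (m) (n),
    toFun K (M.act (res f) m) (N.act (res f) n) = Q.act (Omega.res f) (toFun H m n)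
  frobRight : ∀ {K H : Subgroup G} (f : FinGSet.orbit K →[G] FinGSet.orbit H) (m) (n),
    toFun H m (N.act (tr f) n) = Q.act (tr f) (toFun K (M.act (Omega.res f) m) n)
  frobLeft : ∀ {K H : Subgroup G} (f : FinGSet.orbit K →[G] FinGSet.orbit H) (m) (n),
    toFun H (M.act (tr f) m) n = Q.act (tr f) (toFun K m (N.act (Omega.res f) n))

namespace OrbitPairing

variable {M N Q : MackeyFunctor R G} (θ : OrbitPairing M N Q)

/-- The pairing with the two variables interchanged. -/
def flip : OrbitPairing N M Q where
  toFun H := (θ.toFun H).flip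
  res f m n := θ.res f n m
  frobRight f m n := θ.frobLeft f n m
  frobLeft f m n := θ.frobRight f n m

/-- The extension of an orbit pairing to all finite `G`-sets. -/
noncomputable def ext (X : FinGSet G) : M.val X →ₗ[R] N.val X →ₗ[R] Q.val X :=
  ∑ i : orbits X, ((θ.toFun (stab i)).compl₁₂ (M.act (Omega.res (emb i)))
    (N.act (Omega.res (emb i)))).compr₂ (Q.act (tr (emb i)))

theorem ext_apply {X : FinGSet G} (m : M.val X) (n : N.val X) : θ.ext X m n =
    ∑ i : orbits X, Q.act (tr (emb i)) (θ.toFun (stab i) (M.act (Omega.res (emb i)) m)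
      (N.act (Omega.res (emb i)) n)) := by
  simp only [ext, LinearMap.sum_apply]
  rfl

theorem flip_ext {X : FinGSet G} (m : M.val X) (n : N.val X) :
    θ.flip.ext X n m = θ.ext X m n := by
  rw [ext_apply, ext_apply]
  rfl

/-- The map `b` factors through a single orbit of `X`, and the terms of `ext` for all other orbits
restrict to zero there. Since elements of `Q(X)` are detected on orbits, this formula characterizes
`ext` without reference to orbit representatives. -/
theorem res_ext_orbit {X : FinGSet G} {H : Subgroup G} (b : FinGSet.orbit H →[G] X)
    (m : M.val X) (n : N.val X) : Q.act (Omega.res b) (θ.ext X m n) =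
      θ.toFun H (M.act (Omega.res b) m) (N.act (Omega.res b) n) := by
  obtain ⟨i, c, rfl⟩ := exists_eq_emb_comp b
  rw [← M.act_res_comp, ← N.act_res_comp, ← Q.act_res_comp, θ.res, ext_apply]
  congr 1
  rw [map_sum, Finset.sum_eq_single i]
  · rw [← Q.act_comp, res_emb_tr_emb_self, Q.act_id]
  · intro j _ hj
    rw [← Q.act_comp, res_emb_tr_emb_ne hj.symm, Q.act_zero]
  · simp

theorem ext_orbit (H : Subgroup G) : θ.ext (FinGSet.orbit H) = θ.toFun H := by
  refine LinearMap.ext₂ fun m n => Q.ext_orbit fun K b => ?_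
  rw [res_ext_orbit, θ.res]

theorem res_ext {X Y : FinGSet G} (f : X →[G] Y) (m : M.val Y) (n : N.val Y) :
    θ.ext X (M.act (Omega.res f) m) (N.act (Omega.res f) n) =
      Q.act (Omega.res f) (θ.ext Y m n) := by
  refine Q.ext_orbit fun K b => ?_
  rw [res_ext_orbit, M.act_res_comp, N.act_res_comp, Q.act_res_comp, res_ext_orbit]

/-- Splitting `n` along the orbits of `X` reduces the claim to transfers between orbits, which is
the reciprocity assumed of `θ`. -/
theorem ext_tr_orbit {X : FinGSet G} {H : Subgroup G} (f : X →[G] FinGSet.orbit H) (m)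
    (n : N.val X) : θ.toFun H m (N.act (tr f) n) =
      Q.act (tr f) (θ.ext X (M.act (Omega.res f) m) n) := by
  conv_lhs => rw [N.eq_sum_emb n]
  rw [ext_apply]
  simp only [map_sum]
  refine Finset.sum_congr rfl fun i _ => ?_
  rw [N.act_tr_comp, θ.frobRight, Q.act_tr_comp, M.act_res_comp]

/-- Frobenius reciprocity for the extension. -/
theorem ext_tr_right {X Y : FinGSet G} (f : X →[G] Y) (m : M.val Y) (n : N.val X) :
    θ.ext Y m (N.act (tr f) n) = Q.act (tr f) (θ.ext X (M.act (Omega.res f) m) n) := by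
  -- After restriction along `b : G/H → Y`, the Mackey formula for the pullback of `f` and `b`
  -- replaces the transfer along `f` by one with target `G/H`, where `ext_tr_orbit` applies.
  refine Q.ext_orbit fun H b => ?_
  rw [res_ext_orbit, ← N.act_comp, ← Q.act_comp, res_tr_pullback, N.act_comp, Q.act_comp,
    ext_tr_orbit, ← res_ext, M.act_res_comp, M.act_res_comp, pullback_condition]

theorem ext_tr_left {X Y : FinGSet G} (f : X →[G] Y) (m : M.val X) (n : N.val Y) :
    θ.ext Y (M.act (tr f) m) n = Q.act (tr f) (θ.ext X m (N.act (Omega.res f) n)) := by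
  rw [← flip_ext, ext_tr_right, flip_ext]

/-- The natural pairing `M(X) × N(Y) → Q(X × Y)` attached to an orbit pairing. -/
noncomputable def toLewis : LewisPairing M N Q where
  toFun X Y := (θ.ext (X.prod Y)).compl₁₂ (M.act (Omega.res (fst X Y)))
    (N.act (Omega.res (snd X Y)))
  nat := by
    intro X Y X' Y' f g m n
    refine pairing_nat_of_res_tr (fun X Y => (θ.ext (X.prod Y)).compl₁₂
      (M.act (Omega.res (fst X Y))) (N.act (Omega.res (snd X Y)))) ?_ ?_ ?_ f g m n
    · intro X Y X' Y' f g m n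
      simp only [LinearMap.compl₁₂_apply]
      rw [← res_ext, M.act_res_comp, M.act_res_comp, N.act_res_comp, N.act_res_comp]
      rfl
    · intro X Y Z f m n
      simp only [LinearMap.compl₁₂_apply]
      -- `X × Z` is the pullback of `f` along the projection `Y × Z → Y`. Base change thus turns the
      -- transfer along `f` into the one along `f × 1`, and Frobenius reciprocity for `ext` pulls it
      -- out.
      rw [← M.act_comp, res_tr (fst Y Z) f (map f (MulActionHom.id G)) (fst X Z), M.act_comp,
        ext_tr_left, N.act_res_comp]
      · rfl
      · exact fun _ => rfl
      · exact fun w w' h h' => Prod.ext h' (congrArg (Prod.snd : Y × Z → Z) h)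
      · exact fun x y h => ⟨(y, x.2), Prod.ext h.symm rfl, rfl⟩
    · intro X Y Z f m n
      simp only [LinearMap.compl₁₂_apply]
      rw [← N.act_comp, res_tr (snd Z Y) f (map (MulActionHom.id G) f) (snd Z X), N.act_comp,
        ext_tr_right, M.act_res_comp]
      · rfl
      · exact fun _ => rfl
      · exact fun w w' h h' => Prod.ext (congrArg (Prod.fst : Z × Y → Z) h) h'
      · exact fun x y h => ⟨(x.1, y), Prod.ext rfl h.symm, rfl⟩

/-- Both projections are left inverse to the diagonal, so passing to products and back to orbits
recovers `θ`. -/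
theorem res_diag_toLewis {H : Subgroup G} (m : M.val (FinGSet.orbit H))
    (n : N.val (FinGSet.orbit H)) :
    Q.act (Omega.res (diag _)) (θ.toLewis.toFun _ _ m n) = θ.toFun H m n := by
  change Q.act _ (θ.ext _ _ _) = _
  rw [← res_ext, ext_orbit, M.act_res_comp, N.act_res_comp]
  exact congrArg₂ (fun a b => θ.toFun H a b) (M.act_res_id m) (N.act_res_id n)

end OrbitPairing

namespace LewisPairing

variable {M N Q : MackeyFunctor R G} (l : LewisPairing M N Q)

-- A map to a product is a diagonal followed by a product of maps. Hence all restrictions of `l` to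
-- orbits are known once its diagonal restrictions are.
omit [Finite G] in
theorem res_pair {X Y Z : FinGSet G} (f : Z →[G] X) (g : Z →[G] Y) (m : M.val X) (n : N.val Y) :
    Q.act (Omega.res (pair f g)) (l.toFun X Y m n) =
      Q.act (Omega.res (diag Z)) (l.toFun Z Z (M.act (res f) m) (N.act (res g) n)) := by
  rw [l.nat, prodHom_res, Q.act_res_comp, map_comp_diag]

/-- The orbit pairing `(m, n) ↦ r_Δ(l(m, n))`. -/
noncomputable def toOrbit : OrbitPairing M N Q where
  toFun H := (l.toFun _ _).compr₂ (Q.act (Omega.res (diag _)))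
  res f m n := by
    simp only [LinearMap.compr₂_apply]
    rw [← res_pair, Q.act_res_comp, diag_comp]
  frobRight {K H} f m n := by
    simp only [LinearMap.compr₂_apply]
    have h1 := l.nat (𝟙 _) (tr f) m n
    have h2 := l.nat (Omega.res f) (𝟙 _) m n
    rw [M.act_id] at h1
    rw [N.act_id] at h2
    -- This is the origin of Frobenius reciprocity: the pullback of the diagonal of `G/H` along `1 ×
    -- f` is `G/K`, mapped by `f` on one side and by the graph `(f, 1)` on the other.
    rw [h1, h2, ← Q.act_comp, ← Q.act_comp, ← Q.act_comp, ← tr_id, prodHom_tr,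
      res_tr (diag (FinGSet.orbit H)) (map (MulActionHom.id G) f) f (pair f (MulActionHom.id G)),
      ← res_id, prodHom_res, Category.assoc, res_comp, map_comp_diag]
    · exact fun _ => rfl
    · exact fun w w' _ h => congrArg Prod.snd h
    · exact fun x y h => ⟨y.2, (congrArg Prod.snd h).symm,
        Prod.ext ((congrArg Prod.snd h).symm.trans (congrArg Prod.fst h)) rfl⟩
  frobLeft {K H} f m n := by
    simp only [LinearMap.compr₂_apply]
    have h1 := l.nat (tr f) (𝟙 _) m n
    have h2 := l.nat (𝟙 _) (Omega.res f) m n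
    rw [N.act_id] at h1
    rw [M.act_id] at h2
    rw [h1, h2, ← Q.act_comp, ← Q.act_comp, ← Q.act_comp, ← tr_id, prodHom_tr,
      res_tr (diag (FinGSet.orbit H)) (map f (MulActionHom.id G)) f (pair (MulActionHom.id G) f),
      ← res_id, prodHom_res, Category.assoc, res_comp, map_comp_diag]
    · exact fun _ => rfl
    · exact fun w w' _ h => congrArg Prod.fst h
    · exact fun x y h => ⟨y.1, (congrArg Prod.fst h).symm,
        Prod.ext rfl ((congrArg Prod.fst h).symm.trans (congrArg Prod.snd h))⟩

end LewisPairing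

end MackeyBox

/-! ### Generators of the box product of modules -/

namespace MackeyBox

open FinGSet Omega

variable {R : Type u} [CommRing R] {G : Type u} [Group G] [Finite G]

theorem MackeyAlgebra.eq_sum_single (a : MackeyAlgebra R G) :
    a = ∑ H : Subgroup G, ∑ K : Subgroup G, single (a H K) := by
  funext H K
  rw [sum_apply, Finset.sum_eq_single H, sum_apply, Finset.sum_eq_single K, single_same]
  · intro L _ hL
    exact single_ne _ fun h => hL h.2.symm
  · simp
  · intro L _ hL
    rw [sum_apply]
    exact Finset.sum_eq_zero fun _ _ => single_ne _ fun h => hL h.1.symm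
  · simp

theorem MackeyAlgebra.single_mul_single_ne {H K L M : Subgroup G} (h : K ≠ L)
    (x : orbit R H ⟶ orbit R K) (y : orbit R L ⟶ orbit R M) : single x * single y = 0 := by
  rw [← Category.comp_id x, ← single_mul_single, mul_assoc, single_id_mul_single_ne h, mul_zero]

section Grade

variable (N : ModuleCat.{u} (MackeyAlgebra R G))

theorem coe_gradeMap {H K : Subgroup G} (x : orbit R H ⟶ orbit R K) (n : grade N K) :
    (gradeMap N x n : N) = MackeyAlgebra.single x • (n : N) := rfl

theorem id_smul_grade {H : Subgroup G} (n : grade N H) :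
    (MackeyAlgebra.single (𝟙 (orbit R H)) : MackeyAlgebra R G) • (n : N) = n := by
  obtain ⟨_, n, rfl⟩ := n
  change MackeyAlgebra.single (𝟙 (orbit R H)) • MackeyAlgebra.single (𝟙 (orbit R H)) • n = _
  rw [← mul_smul, MackeyAlgebra.single_mul_single, Category.comp_id]
  rfl

theorem single_smul_grade_ne {H K L : Subgroup G} (h : K ≠ L) (x : orbit R H ⟶ orbit R K)
    (n : grade N L) : MackeyAlgebra.single x • (n : N) = 0 := by
  rw [← id_smul_grade N n, ← mul_smul, MackeyAlgebra.single_mul_single_ne h, zero_smul]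

theorem gradeMap_id {H : Subgroup G} (n : grade N H) : gradeMap N (𝟙 (orbit R H)) n = n :=
  Subtype.ext (id_smul_grade N n)

theorem gradeMap_comp {H K L : Subgroup G} (x : orbit R H ⟶ orbit R K)
    (y : orbit R K ⟶ orbit R L) (n : grade N L) :
    gradeMap N (x ≫ y) n = gradeMap N x (gradeMap N y n) := by
  refine Subtype.ext ?_
  rw [coe_gradeMap, coe_gradeMap, coe_gradeMap, ← mul_smul, MackeyAlgebra.single_mul_single]

theorem MackeyAlgebra.single_add {H K : Subgroup G} (x y : orbit R H ⟶ orbit R K) :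
    single (x + y) = single x + single y := by
  funext H' K'
  change _ = single x H' K' + single y H' K'
  by_cases h : H' = H ∧ K' = K
  · obtain ⟨rfl, rfl⟩ := h
    simp only [single_same]
  · simp only [single_ne _ h, add_zero]

theorem MackeyAlgebra.single_smul {H K : Subgroup G} (r : R) (x : orbit R H ⟶ orbit R K) :
    single (r • x) = r • single x := by
  funext H' K'
  change _ = r • single x H' K'
  by_cases h : H' = H ∧ K' = K
  · obtain ⟨rfl, rfl⟩ := h
    simp only [single_same]
  · simp only [single_ne _ h, smul_zero]

/-- `gradeMap` as a linear function of the morphism. -/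
noncomputable def gradeMapL {H K : Subgroup G} (n : grade N K) :
    (orbit R H ⟶ orbit R K) →ₗ[R] grade N H where
  toFun x := gradeMap N x n
  map_add' x y := Subtype.ext (by
    rw [Submodule.coe_add, coe_gradeMap, MackeyAlgebra.single_add, add_smul]
    rfl)
  map_smul' r x := Subtype.ext (by
    rw [RingHom.id_apply, Submodule.coe_smul, coe_gradeMap, MackeyAlgebra.single_smul, smul_assoc]
    rfl)

theorem gradeMap_add {H K : Subgroup G} (x y : orbit R H ⟶ orbit R K) (n : grade N K) :
    gradeMap N (x + y) n = gradeMap N x n + gradeMap N y n := map_add (gradeMapL N n) x y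

theorem gradeMap_smul {H K : Subgroup G} (r : R) (x : orbit R H ⟶ orbit R K) (n : grade N K) :
    gradeMap N (r • x) n = r • gradeMap N x n := map_smul (gradeMapL N n) r x

theorem gradeMap_zero {H K : Subgroup G} (n : grade N K) :
    gradeMap N (0 : orbit R H ⟶ orbit R K) n = 0 := map_zero (gradeMapL N n)

theorem gradeMap_sum {H K : Subgroup G} {ι : Type*} (s : Finset ι)
    (x : ι → (orbit R H ⟶ orbit R K)) (n : grade N K) :
    gradeMap N (∑ i ∈ s, x i) n = ∑ i ∈ s, gradeMap N (x i) n := map_sum (gradeMapL N n) x s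

variable {N} in
theorem gradeHom_gradeMap_apply {N' : ModuleCat.{u} (MackeyAlgebra R G)} (f : N ⟶ N')
    {H K : Subgroup G} (x : orbit R H ⟶ orbit R K) (n : grade N K) :
    gradeHom f H (gradeMap N x n) = gradeMap N' x (gradeHom f K n) :=
  LinearMap.congr_fun (gradeHom_gradeMap f x) n

theorem sum_id_smul (n : N) :
    ∑ H : Subgroup G, (MackeyAlgebra.single (𝟙 (orbit R H)) : MackeyAlgebra R G) • n = n := by
  rw [← Finset.sum_smul, ← MackeyAlgebra.one_def, one_smul]

variable {N} in
/-- Morphisms of modules are determined by their values on the grades. -/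
theorem hom_ext_grade {N' : ModuleCat.{u} (MackeyAlgebra R G)} {f g : N ⟶ N'}
    (h : ∀ H (n : grade N H), f.hom n = g.hom n) : f = g := by
  refine ModuleCat.hom_ext (LinearMap.ext fun n => ?_)
  rw [← sum_id_smul N n, map_sum, map_sum]
  exact Finset.sum_congr rfl fun H _ => h H ⟨_, single_smul_mem_grade N _ n⟩

end Grade

section Box

variable {M N : ModuleCat.{u} (MackeyAlgebra R G)}

theorem Chain.le {H L : Subgroup G} : Chain H L → L ≤ H
  | .nil _ => le_rfl
  | .cons h c => c.le.trans h.le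

variable (M N) in
open Classical in
/-- The inclusion of the summand of `A_H` indexed by a chain. -/
noncomputable def boxChain {H L : Subgroup G} (c : Chain H L) :
    gradeTensor M N L →ₗ[R] boxGrade M N H :=
  DirectSum.lof R (ChainFrom H) (fun p => gradeTensor M N p.1) ⟨L, c⟩

theorem boxCopy_boxChain {H K L : Subgroup G} (h : K < H) (c : Chain K L)
    (x : gradeTensor M N L) : boxCopy M N h (boxChain M N c x) = boxChain M N (.cons h c) x := by
  classical
  exact DirectSum.toModule_lof R _ _

theorem opC_boxChain (g : G) {H L : Subgroup G} (c : Chain H L) (x : gradeTensor M N L) :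
    opC M N g H (boxChain M N c x) = opCChain M N g c x := by
  classical
  exact DirectSum.toModule_lof R _ _

theorem opR_boxChain {J H L : Subgroup G} (h : J ≤ H) (c : Chain H L) (x : gradeTensor M N L) :
    opR M N h (boxChain M N c x) = opRChain M N c J h x := by
  classical
  exact DirectSum.toModule_lof R _ _

theorem boxTop_eq (H : Subgroup G) : boxTop M N H = boxChain M N (.nil H) := rfl

theorem opI_of_lt {H K : Subgroup G} (h : K < H) : opI M N h.le = boxCopy M N h := by
  rw [opI, dif_neg h.ne]

theorem opI_self (H : Subgroup G) (x : boxGrade M N H) : opI M N (le_refl H) x = x := by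
  simp [opI]

@[elab_as_elim]
theorem boxGrade_ind {H : Subgroup G} {p : boxGrade M N H → Prop} (zero : p 0)
    (add : ∀ x y, p x → p y → p (x + y))
    (chain : ∀ (L : Subgroup G) (c : Chain H L) m n, p (boxChain M N c (m ⊗ₜ n))) (x) : p x := by
  classical
  induction x using DirectSum.induction_on with
  | zero => exact zero
  | add x y hx hy => exact add x y hx hy
  | of c x =>
    change p (boxChain M N c.2 x)
    refine TensorProduct.induction_on x (by rwa [map_zero]) (chain _ _) fun x y hx hy => ?_
    rw [map_add]
    exact add _ _ hx hy

@[elab_as_elim]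
theorem boxTotal_ind {p : boxTotal M N → Prop} (zero : p 0)
    (add : ∀ x y, p x → p y → p (x + y)) (incl : ∀ H x, p (boxIncl M N H x)) (x) : p x := by
  classical
  induction x using DirectSum.induction_on with
  | zero => exact zero
  | add x y hx hy => exact add x y hx hy
  | of H x => exact incl H x

theorem extendZero_incl {H K : Subgroup G} (f : boxGrade M N H →ₗ[R] boxGrade M N K)
    (x : boxGrade M N H) :
    extendZero M N f (boxIncl M N H x) = boxIncl M N K (f x) := by
  simp [extendZero, boxIncl, DirectSum.component.lof_self]

theorem extendZero_incl_ne {H K L : Subgroup G} (h : L ≠ H)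
    (f : boxGrade M N H →ₗ[R] boxGrade M N K) (x : boxGrade M N L) :
    extendZero M N f (boxIncl M N L x) = 0 := by
  classical
  have : DirectSum.component R (Subgroup G) (fun H => boxGrade M N H) H (boxIncl M N L x) = 0 := by
    rw [boxIncl, DirectSum.component.of, dif_neg h]
  rw [extendZero, LinearMap.comp_apply, LinearMap.comp_apply, this, map_zero, map_zero]

variable (M N) in
/-- The canonical map as a linear map. -/
noncomputable def toBoxL : boxTotal M N →ₗ[R] box M N where
  toFun := toBox M N
  map_add' a b := by rw [toBox, TensorProduct.tmul_add, map_add]; rfl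
  map_smul' r a := by
    have : (1 : MackeyAlgebra R G) ⊗ₜ[R] (r • a) =
        algebraMap R (MackeyAlgebra R G) r • ((1 : MackeyAlgebra R G) ⊗ₜ[R] a) := by
      rw [TensorProduct.tmul_smul, algebraMap_smul]
    rw [toBox, this, map_smul]
    rfl

theorem smul_toBox_incl {H K : Subgroup G} (x : orbit R H ⟶ orbit R K)
    (f : boxGrade M N K →ₗ[R] boxGrade M N H)
    (hf : ∀ a, BoxRel M N (MackeyAlgebra.single x ⊗ₜ[R] a - 1 ⊗ₜ[R] extendZero M N f a))
    (a : boxGrade M N K) : MackeyAlgebra.single x • toBox M N (boxIncl M N K a) =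
      toBox M N (boxIncl M N H (f a)) := by
  rw [smul_toBox_of_rel M N _ _ _ (hf _), extendZero_incl]

theorem toBox_incl_mem (H : Subgroup G) (a : boxGrade M N H) :
    toBox M N (boxIncl M N H a) ∈ grade (box M N) H := by
  have := smul_toBox_incl (Omega.elI (le_refl H)) _ (BoxRel.actI (le_refl H)) a
  rw [opI_self, elI_self] at this
  exact ⟨_, this⟩

variable (M N) in
/-- The canonical map `A_H → I^H_H(M □ N)`. -/
noncomputable def toBoxGrade (H : Subgroup G) : boxGrade M N H →ₗ[R] grade (box M N) H :=
  (toBoxL M N ∘ₗ boxIncl M N H).codRestrict _ (toBox_incl_mem H)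

theorem coe_toBoxGrade (H : Subgroup G) (a : boxGrade M N H) :
    (toBoxGrade M N H a : box M N) = toBox M N (boxIncl M N H a) := rfl

theorem gradeMap_elI_toBoxGrade {H K : Subgroup G} (h : K ≤ H) (a : boxGrade M N K) :
    gradeMap _ (elI h) (toBoxGrade M N K a) = toBoxGrade M N H (opI M N h a) :=
  Subtype.ext (smul_toBox_incl _ _ (BoxRel.actI h) a)

theorem gradeMap_elC_toBoxGrade (g : G) (H : Subgroup G) (a : boxGrade M N H) :
    gradeMap _ (elC g H) (toBoxGrade M N H a) = toBoxGrade M N _ (opC M N g H a) :=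
  Subtype.ext (smul_toBox_incl _ _ (BoxRel.actC g H) a)

theorem gradeMap_elR_toBoxGrade {J H : Subgroup G} (h : J ≤ H) (a : boxGrade M N H) :
    gradeMap _ (elR h) (toBoxGrade M N H a) = toBoxGrade M N J (opR M N h a) :=
  Subtype.ext (smul_toBox_incl _ _ (BoxRel.actR h) a)

theorem boxMk_eq {H : Subgroup G} (m : grade M H) (n : grade N H) :
    boxMk m n = toBoxGrade M N H (boxTop M N H (m ⊗ₜ n)) := rfl

/-- In the quotient the inclusions of copies act as multiplications by the elements `I`, and these
compose along a chain. All chains from `H` down to `L` therefore give the same element. -/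
theorem toBoxGrade_boxChain {H L : Subgroup G} (c : Chain H L) (m : grade M L) (n : grade N L) :
    toBoxGrade M N H (boxChain M N c (m ⊗ₜ n)) = gradeMap _ (elI c.le) (boxMk m n) := by
  induction c with
  | nil H => rw [elI_self, gradeMap_id, boxMk_eq, boxTop_eq]
  | cons h c ih =>
    rw [← boxCopy_boxChain, ← opI_of_lt, ← gradeMap_elI_toBoxGrade, ih, ← gradeMap_comp, elI_elI]

/-- The bilinear map `(m, n) ↦ [m ⊗ n]`. -/
noncomputable def boxMkL (M N : ModuleCat.{u} (MackeyAlgebra R G)) (H : Subgroup G) :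
    grade M H →ₗ[R] grade N H →ₗ[R] grade (box M N) H :=
  (TensorProduct.mk R _ _).compr₂ (toBoxGrade M N H ∘ₗ boxTop M N H)

theorem boxMkL_apply {H : Subgroup G} (m : grade M H) (n : grade N H) :
    boxMkL M N H m n = boxMk m n := rfl

theorem boxMk_elC (g : G) {H : Subgroup G} (m : grade M H) (n : grade N H) :
    boxMk (gradeMap M (elC g H) m) (gradeMap N (elC g H) n) =
      gradeMap _ (elC g H) (boxMk m n) := by
  rw [boxMk_eq, boxMk_eq, gradeMap_elC_toBoxGrade, boxTop_eq H, opC_boxChain]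
  rfl

theorem boxMk_elR {J H : Subgroup G} (h : J ≤ H) (m : grade M H) (n : grade N H) :
    boxMk (gradeMap M (elR h) m) (gradeMap N (elR h) n) = gradeMap _ (elR h) (boxMk m n) := by
  rw [boxMk_eq, boxMk_eq, gradeMap_elR_toBoxGrade, boxTop_eq H, opR_boxChain]
  rfl

theorem toBoxGrade_eq_of_rel {H : Subgroup G} (a b : boxGrade M N H)
    (h : BoxRel M N (1 ⊗ₜ[R] boxIncl M N H (a - b))) :
    toBoxGrade M N H a = toBoxGrade M N H b := by
  rw [← sub_eq_zero, ← map_sub]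
  exact Subtype.ext ((Submodule.Quotient.mk_eq_zero _).2 (Submodule.subset_span h))

theorem elR_self (H : Subgroup G) : elR (R := R) (le_refl H) = 𝟙 (orbit R H) :=
  congrArg res (orbit_hom_ext (f' := MulActionHom.id G) rfl)

/-- For proper subgroups this is the imposed relation; the case `K = H`, where both sides are
trivially equal, is added to make later use uniform. -/
theorem boxMk_elI_right {K H : Subgroup G} (h : K ≤ H) (a : grade M H) (b : grade N K) :
    boxMk a (gradeMap N (elI h) b) = gradeMap _ (elI h) (boxMk (gradeMap M (elR h) a) b) := by
  obtain rfl | h := h.eq_or_lt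
  · rw [elI_self, elR_self, gradeMap_id, gradeMap_id, gradeMap_id]
  · rw [boxMk_eq, boxMk_eq, gradeMap_elI_toBoxGrade, opI_of_lt h]
    exact toBoxGrade_eq_of_rel _ _ (BoxRel.frobeniusRight h a b)

theorem boxMk_elI_left {K H : Subgroup G} (h : K ≤ H) (c : grade M K) (d : grade N H) :
    boxMk (gradeMap M (elI h) c) d = gradeMap _ (elI h) (boxMk c (gradeMap N (elR h) d)) := by
  obtain rfl | h := h.eq_or_lt
  · rw [elI_self, elR_self, gradeMap_id, gradeMap_id, gradeMap_id]
  · rw [boxMk_eq, boxMk_eq, gradeMap_elI_toBoxGrade, opI_of_lt h]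
    exact toBoxGrade_eq_of_rel _ _ (BoxRel.frobeniusLeft h c d)

/-- The images of the `A_H` are preserved by all morphisms between orbits. -/
theorem gradeMap_mem_range {H K : Subgroup G} (x : orbit R H ⟶ orbit R K) (a : boxGrade M N K) :
    gradeMap _ x (toBoxGrade M N K a) ∈ LinearMap.range (toBoxGrade M N H) := by
  induction x using orbit_hom_ind with
  | zero => rw [gradeMap_zero]; exact zero_mem _
  | add x y hx hy => rw [gradeMap_add]; exact add_mem hx hy
  | smul r x hx => rw [gradeMap_smul]; exact Submodule.smul_mem _ _ hx
  | span L h f =>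
    -- A morphism between orbits is a combination of composites of `I`, `R` and `C`, and each of
    -- these acts on the image of `A` by an operator of `A`.
    obtain ⟨g, h', e⟩ := res_eq_elR_elC (R := R) f
    rw [e, gradeMap_comp, gradeMap_comp, gradeMap_elC_toBoxGrade, gradeMap_elR_toBoxGrade,
      gradeMap_elI_toBoxGrade]
    exact ⟨_, rfl⟩

/-- The quotient is generated over `μ_R(G)` by the image of `A`. This image is already a submodule,
because `I`, `R` and `C` preserve it and generate the algebra. -/
theorem surjective_toBox : Function.Surjective (toBox M N) := by
  have h1 : ∀ (a : MackeyAlgebra R G) (t : boxTotal M N),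
      a • toBox M N t ∈ LinearMap.range (toBoxL M N) := by
    intro a t
    induction t using boxTotal_ind with
    | zero =>
      have : toBox M N 0 = 0 := map_zero (toBoxL M N)
      rw [this, smul_zero]
      exact zero_mem _
    | add x y hx hy =>
      have : toBox M N (x + y) = toBox M N x + toBox M N y := map_add (toBoxL M N) x y
      rw [this, smul_add]
      exact add_mem hx hy
    | incl L x =>
      rw [MackeyAlgebra.eq_sum_single a, Finset.sum_smul]
      refine Submodule.sum_mem _ fun H _ => ?_
      rw [Finset.sum_smul]
      refine Submodule.sum_mem _ fun K _ => ?_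
      rw [← coe_toBoxGrade]
      by_cases h : K = L
      · subst h
        obtain ⟨y, hy⟩ := gradeMap_mem_range (a H K) x
        exact ⟨boxIncl M N H y, congrArg Subtype.val hy⟩
      · rw [single_smul_grade_ne _ h]
        exact zero_mem _
  intro w
  obtain ⟨w, rfl⟩ := (boxSubmodule M N).mkQ_surjective w
  suffices (boxSubmodule M N).mkQ w ∈ LinearMap.range (toBoxL M N) from this
  induction w with
  | zero => rw [map_zero]; exact zero_mem (LinearMap.range (toBoxL M N))
  | add x y hx hy => rw [map_add]; exact add_mem (S := Submodule R (box M N)) hx hy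
  | tmul a t =>
    have : (boxSubmodule M N).mkQ (a ⊗ₜ[R] t) = a • toBox M N t := by
      change _ = a • (boxSubmodule M N).mkQ (1 ⊗ₜ[R] t)
      rw [← map_smul, TensorProduct.smul_tmul', smul_eq_mul, mul_one]
    rw [this]
    exact h1 a t

/-- The grade `H` of `M □ N` is generated by the elements `I^H_L [m ⊗ n]`. -/
@[elab_as_elim]
theorem grade_box_ind {H : Subgroup G} {p : grade (box M N) H → Prop} (zero : p 0)
    (add : ∀ x y, p x → p y → p (x + y))
    (mk : ∀ (L : Subgroup G) (h : L ≤ H) (m : grade M L) (n : grade N L),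
      p (gradeMap _ (elI h) (boxMk m n))) (w) : p w := by
  have h1 : ∀ a, p (toBoxGrade M N H a) := fun a => by
    induction a using boxGrade_ind with
    | zero => rwa [map_zero]
    | add x y hx hy => rw [map_add]; exact add _ _ hx hy
    | chain L c m n => rw [toBoxGrade_boxChain]; exact mk L _ m n
  obtain ⟨t, ht⟩ := surjective_toBox (w : box M N)
  -- As `w` is fixed by the idempotent of the grade `H`, it equals that idempotent times the class
  -- of `t`; this allows an induction over all of `A`, in which the other grades contribute zero.
  have h2 : w = ⟨_, single_smul_mem_grade _ (𝟙 (orbit R H)) (toBox M N t)⟩ :=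
    Subtype.ext ((id_smul_grade _ w).symm.trans (congrArg _ ht.symm))
  rw [h2]
  clear h2 ht
  induction t using boxTotal_ind with
  | zero =>
    have : toBox M N 0 = 0 := map_zero (toBoxL M N)
    simp only [this, smul_zero]
    exact zero
  | add x y hx hy =>
    have : toBox M N (x + y) = toBox M N x + toBox M N y := map_add (toBoxL M N) x y
    simp only [this, smul_add]
    exact add _ _ hx hy
  | incl L x =>
    simp only [← coe_toBoxGrade]
    by_cases h : H = L
    · subst h
      simp only [id_smul_grade]
      exact h1 x
    · simp only [single_smul_grade_ne _ h]
      exact zero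

/-- Morphisms out of `M □ N` are determined by their values on the elements `[m ⊗ n]`. -/
theorem box_hom_ext {Q : ModuleCat.{u} (MackeyAlgebra R G)} {f g : box M N ⟶ Q}
    (h : ∀ H (m : grade M H) (n : grade N H),
      gradeHom f H (boxMk m n) = gradeHom g H (boxMk m n)) : f = g := by
  refine hom_ext_grade fun H w => congrArg Subtype.val (?_ : gradeHom f H w = gradeHom g H w)
  induction w using grade_box_ind with
  | zero => rw [map_zero, map_zero]
  | add x y hx hy => rw [map_add, map_add, hx, hy]
  | mk L h' m n => rw [gradeHom_gradeMap_apply, gradeHom_gradeMap_apply, h]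

theorem gradeHom_boxMap {M' N' : ModuleCat.{u} (MackeyAlgebra R G)} (f : M ⟶ M') (g : N ⟶ N')
    {H : Subgroup G} (m : grade M H) (n : grade N H) :
    gradeHom (boxMap f g) H (boxMk m n) = boxMk (gradeHom f H m) (gradeHom g H n) := by
  refine Subtype.ext ?_
  change toBox M' N' (boxTotalMap f g _) = toBox M' N' _
  rw [boxTotalMap_incl, boxGradeMap_top, TensorProduct.map_tmul]

end Box

end MackeyBox

/-! ### Universal property of the box product of modules, and pairings of the modules `Φ M` -/

namespace MackeyBox

open FinGSet Omega

variable {R : Type u} [CommRing R] {G : Type u} [Group G] [Finite G]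

/-- A family of bilinear maps between the grades, compatible with `C` and `R` and satisfying
Frobenius reciprocity. -/
structure GradePairing (M N Q : ModuleCat.{u} (MackeyAlgebra R G)) where
  toFun : ∀ H : Subgroup G, grade M H →ₗ[R] grade N H →ₗ[R] grade Q H
  elC : ∀ (g : G) (H : Subgroup G) (m : grade M H) (n : grade N H),
    toFun _ (gradeMap M (elC g H) m) (gradeMap N (Omega.elC g H) n) =
      gradeMap Q (Omega.elC g H) (toFun H m n)
  elR : ∀ {J H : Subgroup G} (h : J ≤ H) (m : grade M H) (n : grade N H),
    toFun J (gradeMap M (elR h) m) (gradeMap N (Omega.elR h) n) =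
      gradeMap Q (Omega.elR h) (toFun H m n)
  frobRight : ∀ {K H : Subgroup G} (h : K ≤ H) (m : grade M H) (n : grade N K),
    toFun H m (gradeMap N (elI h) n) =
      gradeMap Q (elI h) (toFun K (gradeMap M (Omega.elR h) m) n)
  frobLeft : ∀ {K H : Subgroup G} (h : K ≤ H) (m : grade M K) (n : grade N H),
    toFun H (gradeMap M (elI h) m) n =
      gradeMap Q (elI h) (toFun K m (gradeMap N (Omega.elR h) n))

namespace GradePairing

variable {M N Q : ModuleCat.{u} (MackeyAlgebra R G)} (θ : GradePairing M N Q)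

open Classical in
/-- The map `A_H → I^H_H Q` attached to a pairing. -/
noncomputable def liftGrade (H : Subgroup G) : boxGrade M N H →ₗ[R] grade Q H :=
  DirectSum.toModule R (ChainFrom H) _ fun p =>
    gradeMap Q (Omega.elI p.2.le) ∘ₗ TensorProduct.lift (θ.toFun p.1)

theorem liftGrade_boxChain {H L : Subgroup G} (c : Chain H L) (m : grade M L) (n : grade N L) :
    θ.liftGrade H (boxChain M N c (m ⊗ₜ n)) = gradeMap Q (Omega.elI c.le) (θ.toFun L m n) := by
  classical
  exact DirectSum.toModule_lof R _ _

theorem liftGrade_boxTop (H : Subgroup G) (m : grade M H) (n : grade N H) :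
    θ.liftGrade H (boxTop M N H (m ⊗ₜ n)) = θ.toFun H m n := by
  rw [boxTop_eq, liftGrade_boxChain, elI_self, gradeMap_id]

theorem liftGrade_opI {H K : Subgroup G} (h : K ≤ H) (x : boxGrade M N K) :
    θ.liftGrade H (opI M N h x) = gradeMap Q (Omega.elI h) (θ.liftGrade K x) := by
  obtain rfl | h := h.eq_or_lt
  · rw [opI_self, elI_self, gradeMap_id]
  · rw [opI_of_lt h]
    induction x using boxGrade_ind with
    | zero => simp only [map_zero]
    | add x y hx hy => simp only [map_add, hx, hy]
    | chain L c m n =>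
      rw [boxCopy_boxChain, liftGrade_boxChain, liftGrade_boxChain, ← gradeMap_comp, elI_elI]

theorem liftGrade_boxCopy {H K : Subgroup G} (h : K < H) (x : boxGrade M N K) :
    θ.liftGrade H (boxCopy M N h x) = gradeMap Q (Omega.elI h.le) (θ.liftGrade K x) := by
  rw [← opI_of_lt h, liftGrade_opI]

/-- Induction along the chain: the recursive rule for `C` on a copy mirrors the identity `elC_elI`
in `μ_R(G)`. -/
theorem liftGrade_opCChain (g : G) {H L : Subgroup G} (c : Chain H L) (m : grade M L)
    (n : grade N L) : θ.liftGrade _ (opCChain M N g c (m ⊗ₜ n)) =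
      gradeMap Q (Omega.elC g H) (gradeMap Q (Omega.elI c.le) (θ.toFun L m n)) := by
  induction c with
  | nil H =>
    rw [opCChain, LinearMap.comp_apply, TensorProduct.map_tmul, liftGrade_boxTop, θ.elC, elI_self,
      gradeMap_id]
  | cons h c ih =>
    rw [opCChain, LinearMap.comp_apply, liftGrade_boxCopy, ih, ← gradeMap_comp, ← gradeMap_comp,
      ← gradeMap_comp, ← elI_elI c.le h.le, ← Category.assoc, elC_elI]

theorem liftGrade_opC (g : G) (H : Subgroup G) (x : boxGrade M N H) :
    θ.liftGrade _ (opC M N g H x) = gradeMap Q (Omega.elC g H) (θ.liftGrade H x) := by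
  induction x using boxGrade_ind with
  | zero => simp only [map_zero]
  | add x y hx hy => simp only [map_add, hx, hy]
  | chain L c m n => rw [opC_boxChain, liftGrade_opCChain, liftGrade_boxChain]

/-- Induction along the chain: the recursive rule for `R` on a copy mirrors the double coset formula
`elR_elI`. The subgroup `J` has to vary, since the recursion passes to `K ∩ Jᵍ`. -/
theorem liftGrade_opRChain {H L : Subgroup G} (c : Chain H L) (J : Subgroup G) (h : J ≤ H)
    (m : grade M L) (n : grade N L) : θ.liftGrade _ (opRChain M N c J h (m ⊗ₜ n)) =
      gradeMap Q (Omega.elR h) (gradeMap Q (Omega.elI c.le) (θ.toFun L m n)) := by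
  induction c generalizing J with
  | nil H =>
    rw [opRChain, LinearMap.comp_apply, TensorProduct.map_tmul, liftGrade_boxTop, θ.elR, elI_self,
      gradeMap_id]
  | @cons H K L h' c ih =>
    rw [opRChain, LinearMap.sum_apply, map_sum, ← elI_elI c.le h'.le, gradeMap_comp Q (elI h'.le),
      ← gradeMap_comp Q (Omega.elR h), elR_elI, gradeMap_sum]
    refine Finset.sum_congr rfl fun g _ => ?_
    rw [LinearMap.comp_apply, LinearMap.comp_apply, liftGrade_opI, liftGrade_opC, ih,
      gradeMap_comp, gradeMap_comp]

theorem liftGrade_opR {J H : Subgroup G} (h : J ≤ H) (x : boxGrade M N H) :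
    θ.liftGrade _ (opR M N h x) = gradeMap Q (Omega.elR h) (θ.liftGrade H x) := by
  induction x using boxGrade_ind with
  | zero => simp only [map_zero]
  | add x y hx hy => simp only [map_add, hx, hy]
  | chain L c m n => rw [opR_boxChain, liftGrade_opRChain, liftGrade_boxChain]

open Classical in
/-- The map `A → Q` attached to a pairing. -/
noncomputable def liftTotal : boxTotal M N →ₗ[R] Q :=
  DirectSum.toModule R (Subgroup G) _ fun H => (grade Q H).subtype ∘ₗ θ.liftGrade H

theorem liftTotal_incl (H : Subgroup G) (x : boxGrade M N H) :
    θ.liftTotal (boxIncl M N H x) = θ.liftGrade H x := by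
  classical
  exact DirectSum.toModule_lof R _ _

theorem liftTotal_extendZero {H K : Subgroup G} (x : orbit R H ⟶ orbit R K)
    (f : boxGrade M N K →ₗ[R] boxGrade M N H)
    (hf : ∀ a, θ.liftGrade H (f a) = gradeMap Q x (θ.liftGrade K a)) (a : boxTotal M N) :
    θ.liftTotal (extendZero M N f a) = MackeyAlgebra.single x • θ.liftTotal a := by
  induction a using boxTotal_ind with
  | zero => simp only [map_zero, smul_zero]
  | add a b ha hb => simp only [map_add, smul_add, ha, hb]
  | incl L a =>
    rw [liftTotal_incl]
    by_cases h : L = K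
    · subst h
      rw [extendZero_incl, liftTotal_incl, hf, coe_gradeMap]
    · rw [extendZero_incl_ne h, map_zero, single_smul_grade_ne _ (Ne.symm h)]

/-- The map `μ_R(G) ⊗ A → Q` attached to a pairing. -/
noncomputable def liftTensor : MackeyAlgebra R G ⊗[R] boxTotal M N →ₗ[MackeyAlgebra R G] Q :=
  TensorProduct.AlgebraTensorModule.lift
    (LinearMap.toSpanSingleton (MackeyAlgebra R G) (boxTotal M N →ₗ[R] Q) θ.liftTotal)

theorem liftTensor_tmul (a : MackeyAlgebra R G) (t : boxTotal M N) :
    θ.liftTensor (a ⊗ₜ t) = a • θ.liftTotal t := rfl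

theorem liftTensor_rel {x : MackeyAlgebra R G ⊗[R] boxTotal M N} (h : BoxRel M N x) :
    θ.liftTensor x = 0 := by
  cases h with
  | actI h a =>
    rw [map_sub, liftTensor_tmul, liftTensor_tmul, one_smul,
      liftTotal_extendZero θ _ _ (θ.liftGrade_opI h), sub_self]
  | actC g H a =>
    rw [map_sub, liftTensor_tmul, liftTensor_tmul, one_smul,
      liftTotal_extendZero θ _ _ (θ.liftGrade_opC g H), sub_self]
  | actR h a =>
    rw [map_sub, liftTensor_tmul, liftTensor_tmul, one_smul,
      liftTotal_extendZero θ _ _ (θ.liftGrade_opR h), sub_self]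
  | frobeniusRight h a b =>
    rw [liftTensor_tmul, one_smul, liftTotal_incl, map_sub, liftGrade_boxTop, liftGrade_boxCopy,
      liftGrade_boxTop, θ.frobRight, sub_self]
    rfl
  | frobeniusLeft h c d =>
    rw [liftTensor_tmul, one_smul, liftTotal_incl, map_sub, liftGrade_boxTop, liftGrade_boxCopy,
      liftGrade_boxTop, θ.frobLeft, sub_self]
    rfl

/-- The universal property of the box product of modules. -/
noncomputable def lift : box M N ⟶ Q :=
  ModuleCat.ofHom ((boxSubmodule M N).liftQ θ.liftTensor
    (Submodule.span_le.2 fun _ h => θ.liftTensor_rel h))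

theorem lift_boxMk {H : Subgroup G} (m : grade M H) (n : grade N H) :
    gradeHom θ.lift H (boxMk m n) = θ.toFun H m n := by
  refine Subtype.ext ?_
  change (1 : MackeyAlgebra R G) • θ.liftTotal _ = _
  rw [one_smul, liftTotal_incl, liftGrade_boxTop]

end GradePairing

section PhiGrade

theorem gradeMap_phiGrade (M : MackeyFunctor R G) {H K : Subgroup G} (x : orbit R H ⟶ orbit R K)
    (m : M.val (FinGSet.orbit K)) :
    gradeMap ((Phi R G).obj M) x (phiGrade M K m) = phiGrade M H (M.act x m) := by
  refine Subtype.ext ?_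
  rw [coe_gradeMap, single_smul_phi]
  change phiSingle M H (M.act x (phiApply M K (phiSingle M K m))) = _
  rw [phiApply_single]
  rfl

theorem gradeHom_phiGrade {M N : MackeyFunctor R G} (f : M ⟶ N) (H : Subgroup G)
    (m : M.val (FinGSet.orbit H)) : gradeHom ((Phi R G).map f) H (phiGrade M H m) =
      phiGrade N H ((f.hom.app (op (orbit R H))).hom m) :=
  Subtype.ext (map_phiSingle f H m)

/-- The identification of `M(G/H)` with the grade `H` of `Φ M`. -/
noncomputable def phiGradeL (M : MackeyFunctor R G) (H : Subgroup G) :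
    M.val (FinGSet.orbit H) →ₗ[R] grade ((Phi R G).obj M) H :=
  (phiSingleL M H).codRestrict _ (phiSingle_mem_grade M H)

theorem phiGradeL_apply (M : MackeyFunctor R G) (H : Subgroup G) (m) :
    phiGradeL M H m = phiGrade M H m := rfl

/-- The identification of the grade `H` of `Φ M` with `M(G/H)`. -/
noncomputable def gradeVal (M : MackeyFunctor R G) (H : Subgroup G) :
    grade ((Phi R G).obj M) H →ₗ[R] M.val (FinGSet.orbit H) :=
  phiApply M H ∘ₗ (grade ((Phi R G).obj M) H).subtype

theorem gradeVal_phiGrade (M : MackeyFunctor R G) (H : Subgroup G)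
    (m : M.val (FinGSet.orbit H)) : gradeVal M H (phiGrade M H m) = m := phiApply_single M H m

theorem phiGrade_gradeVal (M : MackeyFunctor R G) (H : Subgroup G)
    (m : grade ((Phi R G).obj M) H) : phiGrade M H (gradeVal M H m) = m := by
  refine Subtype.ext ?_
  have := id_smul_grade _ m
  rw [single_smul_phi, M.act_id] at this
  exact this

theorem gradeVal_gradeMap (M : MackeyFunctor R G) {H K : Subgroup G} (x : orbit R H ⟶ orbit R K)
    (m : grade ((Phi R G).obj M) K) :
    gradeVal M H (gradeMap _ x m) = M.act x (gradeVal M K m) := by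
  conv_lhs => rw [← phiGrade_gradeVal M K m, gradeMap_phiGrade, gradeVal_phiGrade]

theorem gradeVal_gradeHom {M N : MackeyFunctor R G} (f : M ⟶ N) (H : Subgroup G)
    (m : grade ((Phi R G).obj M) H) : gradeVal N H (gradeHom ((Phi R G).map f) H m) =
      (f.hom.app (op (orbit R H))).hom (gradeVal M H m) := rfl

end PhiGrade

namespace OrbitPairing

variable {M N Q : MackeyFunctor R G}

/-- An orbit pairing as a pairing of the grades of modules. -/
noncomputable def toGrade (θ : OrbitPairing M N Q) :
    GradePairing ((Phi R G).obj M) ((Phi R G).obj N) ((Phi R G).obj Q) where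
  toFun H := ((θ.toFun H).compl₁₂ (gradeVal M H) (gradeVal N H)).compr₂ (phiGradeL Q H)
  elC g H m n := by
    simp only [LinearMap.compr₂_apply, LinearMap.compl₁₂_apply, phiGradeL_apply,
      gradeVal_gradeMap, gradeMap_phiGrade]
    rw [elC_eq, θ.res]
  elR h m n := by
    simp only [LinearMap.compr₂_apply, LinearMap.compl₁₂_apply, phiGradeL_apply,
      gradeVal_gradeMap, gradeMap_phiGrade]
    rw [elR, θ.res]
  frobRight h m n := by
    simp only [LinearMap.compr₂_apply, LinearMap.compl₁₂_apply, phiGradeL_apply,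
      gradeVal_gradeMap, gradeMap_phiGrade]
    rw [elR, elI, θ.frobRight]
  frobLeft h m n := by
    simp only [LinearMap.compr₂_apply, LinearMap.compl₁₂_apply, phiGradeL_apply,
      gradeVal_gradeMap, gradeMap_phiGrade]
    rw [elR, elI, θ.frobLeft]

theorem lift_toGrade (θ : OrbitPairing M N Q) {H : Subgroup G} (m : M.val (FinGSet.orbit H))
    (n : N.val (FinGSet.orbit H)) :
    gradeHom θ.toGrade.lift H (boxMk (phiGrade M H m) (phiGrade N H n)) =
      phiGrade Q H (θ.toFun H m n) := by
  rw [GradePairing.lift_boxMk]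
  simp only [toGrade, LinearMap.compr₂_apply, LinearMap.compl₁₂_apply, phiGradeL_apply,
    gradeVal_phiGrade]

omit [Finite G] in
theorem comp_eq_id {X Y : FinGSet G} (f : X →[G] Y) (g : Y →[G] X) (h : ∀ x, g (f x) = x) :
    g.comp f = MulActionHom.id G := MulActionHom.ext h

/-- Frobenius reciprocity for an invertible map follows from compatibility with restrictions. -/
theorem frob_of_bijective
    (θ : ∀ H : Subgroup G, M.val (FinGSet.orbit H) →ₗ[R] N.val (FinGSet.orbit H) →ₗ[R]
      Q.val (FinGSet.orbit H)) {K H : Subgroup G} (c : FinGSet.orbit K →[G] FinGSet.orbit H)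
    (d : FinGSet.orbit H →[G] FinGSet.orbit K) (hcd : ∀ x, c (d x) = x) (hdc : ∀ x, d (c x) = x)
    (hd : ∀ m n, θ H (M.act (Omega.res d) m) (N.act (Omega.res d) n) =
      Q.act (Omega.res d) (θ K m n)) (m : M.val (FinGSet.orbit H)) (n : N.val (FinGSet.orbit K)) :
    θ H m (N.act (tr c) n) = Q.act (tr c) (θ K (M.act (Omega.res c) m) n) := by
  rw [tr_eq_res c d hdc hcd, ← hd, M.act_res_comp d c, comp_eq_id d c hcd, M.act_res_id]

/-- A map of orbits is a projection followed by a bijection. Reciprocity is assumed for the first,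
automatic for the second by `frob_of_bijective`, and it is preserved by composition. -/
theorem frob_of_generators
    (θ : ∀ H : Subgroup G, M.val (FinGSet.orbit H) →ₗ[R] N.val (FinGSet.orbit H) →ₗ[R]
      Q.val (FinGSet.orbit H))
    (hres : ∀ {K H : Subgroup G} (f : FinGSet.orbit K →[G] FinGSet.orbit H) m n,
      θ K (M.act (Omega.res f) m) (N.act (Omega.res f) n) = Q.act (Omega.res f) (θ H m n))
    (hI : ∀ {K H : Subgroup G} (h : K ≤ H) m n, θ H m (N.act (elI h) n) =
      Q.act (elI h) (θ K (M.act (elR h) m) n))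
    {K H : Subgroup G} (f : FinGSet.orbit K →[G] FinGSet.orbit H) (m : M.val (FinGSet.orbit H))
    (n : N.val (FinGSet.orbit K)) :
    θ H m (N.act (tr f) n) = Q.act (tr f) (θ K (M.act (Omega.res f) m) n) := by
  obtain ⟨g, h, rfl⟩ := exists_eq_conjInv_comp_proj f
  have h1 := frob_of_bijective θ (conjInv g H) (conj g H) (conjInv_conj g H) (conj_conjInv g H)
    (hres _) m (N.act (tr (proj h)) n)
  have h2 := hI h (M.act (Omega.res (conjInv g H)) m) n
  rw [elI, elR] at h2
  rw [← N.act_tr_comp (proj h) (conjInv g H), h1, h2, Q.act_tr_comp (proj h) (conjInv g H),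
    M.act_res_comp (proj h) (conjInv g H)]

/-- An orbit pairing from relations for the generators `C`, `R`, `I` only. -/
noncomputable def ofGenerators
    (θ : ∀ H : Subgroup G, M.val (FinGSet.orbit H) →ₗ[R] N.val (FinGSet.orbit H) →ₗ[R]
      Q.val (FinGSet.orbit H))
    (hC : ∀ (g : G) (H : Subgroup G) m n, θ _ (M.act (elC g H) m) (N.act (elC g H) n) =
      Q.act (elC g H) (θ H m n))
    (hR : ∀ {J H : Subgroup G} (h : J ≤ H) m n, θ J (M.act (elR h) m) (N.act (elR h) n) =
      Q.act (elR h) (θ H m n))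
    (hI : ∀ {K H : Subgroup G} (h : K ≤ H) m n, θ H m (N.act (elI h) n) =
      Q.act (elI h) (θ K (M.act (elR h) m) n))
    (hI' : ∀ {K H : Subgroup G} (h : K ≤ H) m n, θ H (M.act (elI h) m) n =
      Q.act (elI h) (θ K m (N.act (elR h) n))) : OrbitPairing M N Q :=
  have hres : ∀ {K H : Subgroup G} (f : FinGSet.orbit K →[G] FinGSet.orbit H) m n,
      θ K (M.act (Omega.res f) m) (N.act (Omega.res f) n) = Q.act (Omega.res f) (θ H m n) := by
    intro K H f m n
    obtain ⟨g, h, e⟩ := res_eq_elR_elC (R := R) f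
    rw [e, M.act_comp, N.act_comp, Q.act_comp, hR, hC]
  { toFun := θ
    res := hres
    frobRight := frob_of_generators θ hres hI
    frobLeft := fun f m n => frob_of_generators (M := N) (N := M) (fun H => (θ H).flip)
      (fun f m n => hres f n m) (fun h m n => hI' h n m) f n m }

/-- The orbit pairing attached to a morphism out of a box product of modules. -/
noncomputable def ofHom (f : box ((Phi R G).obj M) ((Phi R G).obj N) ⟶ (Phi R G).obj Q) :
    OrbitPairing M N Q :=
  ofGenerators (fun H => ((boxMkL _ _ H).compl₁₂ (phiGradeL M H) (phiGradeL N H)).compr₂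
      (gradeVal Q H ∘ₗ gradeHom f H))
    (fun g H m n => by
      simp only [LinearMap.compr₂_apply, LinearMap.compl₁₂_apply, phiGradeL_apply,
        LinearMap.comp_apply, boxMkL_apply, ← gradeMap_phiGrade, boxMk_elC,
        gradeHom_gradeMap_apply, gradeVal_gradeMap])
    (fun h m n => by
      simp only [LinearMap.compr₂_apply, LinearMap.compl₁₂_apply, phiGradeL_apply,
        LinearMap.comp_apply, boxMkL_apply, ← gradeMap_phiGrade, boxMk_elR,
        gradeHom_gradeMap_apply, gradeVal_gradeMap])
    (fun h m n => by
      simp only [LinearMap.compr₂_apply, LinearMap.compl₁₂_apply, phiGradeL_apply,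
        LinearMap.comp_apply, boxMkL_apply, ← gradeMap_phiGrade, boxMk_elI_right,
        gradeHom_gradeMap_apply, gradeVal_gradeMap])
    (fun h m n => by
      simp only [LinearMap.compr₂_apply, LinearMap.compl₁₂_apply, phiGradeL_apply,
        LinearMap.comp_apply, boxMkL_apply, ← gradeMap_phiGrade, boxMk_elI_left,
        gradeHom_gradeMap_apply, gradeVal_gradeMap])

theorem ofHom_apply (f : box ((Phi R G).obj M) ((Phi R G).obj N) ⟶ (Phi R G).obj Q)
    {H : Subgroup G} (m : M.val (FinGSet.orbit H)) (n : N.val (FinGSet.orbit H)) :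
    (ofHom f).toFun H m n =
      gradeVal Q H (gradeHom f H (boxMk (phiGrade M H m) (phiGrade N H n))) := rfl

end OrbitPairing

/-- Morphisms `Φ M □ Φ N → Q` are determined by their values on `[m ⊗ n]`. -/
theorem box_phi_hom_ext {M N : MackeyFunctor R G} {Q : ModuleCat.{u} (MackeyAlgebra R G)}
    {f g : box ((Phi R G).obj M) ((Phi R G).obj N) ⟶ Q}
    (h : ∀ H m n, gradeHom f H (boxMk (phiGrade M H m) (phiGrade N H n)) =
      gradeHom g H (boxMk (phiGrade M H m) (phiGrade N H n))) : f = g := by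
  refine box_hom_ext fun H m n => ?_
  rw [← phiGrade_gradeVal M H m, ← phiGrade_gradeVal N H n]
  exact h H _ _

end MackeyBox

/-! ### Existence of the Kan extension -/

namespace MackeyBox

open FinGSet Omega
open scoped MonoidalCategory.ExternalProduct

variable {R : Type u} [CommRing R] {G : Type u} [Group G]

/-- The component `M(X) → N(X)` of a morphism of Mackey functors. -/
noncomputable abbrev ev {M N : MackeyFunctor R G} (φ : M ⟶ N) (X : FinGSet G) :
    M.val X →ₗ[R] N.val X :=
  (φ.hom.app (op (of R X))).hom

section Subfunctor

/-- A natural transformation `M(X) ⊗ N(Y) → F(X × Y)`, on elements. -/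
noncomputable def natApp {M N : MackeyFunctor R G} {F : (Omega R G)ᵒᵖ ⥤ ModuleCat.{u} R}
    (α : M.obj ⊠ N.obj ⟶ Omega.prodFunctor ⋙ F) (X Y : FinGSet G) :
    M.val X →ₗ[R] N.val Y →ₗ[R] F.obj (op (of R (X.prod Y))) :=
  (TensorProduct.mk R (M.val X) (N.val Y)).compr₂ (α.app (op (of R X), op (of R Y))).hom

theorem natApp_nat {M N : MackeyFunctor R G} {F : (Omega R G)ᵒᵖ ⥤ ModuleCat.{u} R}
    (α : M.obj ⊠ N.obj ⟶ Omega.prodFunctor ⋙ F) {X Y X' Y' : FinGSet G} (f : of R X ⟶ of R Y)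
    (g : of R X' ⟶ of R Y') (m : M.val Y) (n : N.val Y') :
    natApp α X X' (M.act f m) (N.act g n) = (F.map (prodHom f g).op).hom (natApp α Y Y' m n) := by
  have := α.naturality (X := (op (of R Y), op (of R Y'))) (Y := (op (of R X), op (of R X')))
    (Prod.mkHom f.op g.op)
  exact congrArg (fun k => k.hom (m ⊗ₜ[R] n)) this

variable (F : (Omega R G)ᵒᵖ ⥤ ModuleCat.{u} R)

/-- The largest subfunctor on which `F` is `R`-linear. -/
def linearPart (X : FinGSet G) : Submodule R (F.obj (op (of R X))) where
  carrier := {q | ∀ Y : FinGSet G,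
    (∀ f g : of R Y ⟶ of R X, (F.map (f + g).op).hom q = (F.map f.op).hom q + (F.map g.op).hom q) ∧
    ∀ (r : R) (f : of R Y ⟶ of R X), (F.map (r • f).op).hom q = r • (F.map f.op).hom q}
  zero_mem' := fun Y => by simp only [map_zero, add_zero, smul_zero, implies_true, and_self]
  add_mem' := fun {a b} ha hb Y => by
    refine ⟨fun f g => ?_, fun r f => ?_⟩
    · simp only [map_add, (ha Y).1, (hb Y).1]
      abel
    · simp only [map_add, (ha Y).2, (hb Y).2, smul_add]
  smul_mem' := fun c a ha Y => by
    refine ⟨fun f g => ?_, fun r f => ?_⟩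
    · simp only [map_smul, (ha Y).1, smul_add]
    · simp only [map_smul, (ha Y).2, smul_comm c r]

theorem map_comp_apply {X Y Z : FinGSet G} (f : of R X ⟶ of R Y) (g : of R Y ⟶ of R Z)
    (q : F.obj (op (of R Z))) :
    (F.map (f ≫ g).op).hom q = (F.map f.op).hom ((F.map g.op).hom q) :=
  congrArg (fun k => k.hom q) (F.map_comp g.op f.op)

theorem map_mem_linearPart {X Y : FinGSet G} (f : of R X ⟶ of R Y) {q : F.obj (op (of R Y))}
    (hq : q ∈ linearPart F Y) : (F.map f.op).hom q ∈ linearPart F X := fun Z => by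
  refine ⟨fun g h => ?_, fun r g => ?_⟩
  · rw [← map_comp_apply, ← map_comp_apply, ← map_comp_apply, Preadditive.add_comp, (hq Z).1]
  · rw [← map_comp_apply, ← map_comp_apply, Linear.smul_comp, (hq Z).2]

/-- The largest `R`-linear subfunctor of `F`. -/
noncomputable def linearSub : MackeyFunctor R G where
  obj :=
    { obj := fun X => ModuleCat.of R (linearPart F X.unop.gset)
      map := fun {X Y} f => ModuleCat.ofHom ((F.map f).hom.restrict
        fun q hq => map_mem_linearPart F f.unop hq)
      map_id := fun X => ModuleCat.hom_ext (LinearMap.ext fun q => Subtype.ext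
        (congrArg (fun k => k.hom q.1) (F.map_id X)))
      map_comp := fun f g => ModuleCat.hom_ext (LinearMap.ext fun q => Subtype.ext
        (congrArg (fun k => k.hom q.1) (F.map_comp f g))) }
  property := by
    refine ⟨fun X Y f g => ?_, fun X Y r f => ?_⟩
    · exact ModuleCat.hom_ext (LinearMap.ext fun q => Subtype.ext ((q.2 X).1 f g))
    · exact ModuleCat.hom_ext (LinearMap.ext fun q => Subtype.ext ((q.2 X).2 r f))

/-- The inclusion of the largest `R`-linear subfunctor. -/
noncomputable def linearSubIncl : (linearSub F).obj ⟶ F where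
  app X := ModuleCat.ofHom (linearPart F X.unop.gset).subtype
  naturality _ _ _ := rfl

variable {F}

/-- The left inclusion in a disjoint union. -/
def FinGSet.inl (X Y : FinGSet G) : X →[G] X.sum Y := ⟨Sum.inl, fun _ _ => rfl⟩

/-- The right inclusion in a disjoint union. -/
def FinGSet.inr (X Y : FinGSet G) : Y →[G] X.sum Y := ⟨Sum.inr, fun _ _ => rfl⟩

/-- A natural transformation out of `M(X) ⊗ N(Y)` has its values in the linear part. -/
theorem natApp_mem_linearPart {M N : MackeyFunctor R G}
    (α : M.obj ⊠ N.obj ⟶ Omega.prodFunctor ⋙ F) {X Y : FinGSet G} (m : M.val X) (n : N.val Y) :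
    natApp α X Y m n ∈ linearPart F (X.prod Y) := fun Z => by
  have key : ∀ {W : FinGSet G} (s : of R W ⟶ of R X),
      (F.map (prodHom s (𝟙 (of R Y))).op).hom (natApp α X Y m n) = natApp α W Y (M.act s m) n := by
    intro W s
    rw [← natApp_nat, N.act_id]
  refine ⟨fun f g => ?_, fun r f => ?_⟩
  · let i := inl X X
    let j := inr X X
    have hi : res (R := R) i ≫ tr i = 𝟙 _ := res_tr_of_injective _ Sum.inl_injective
    have hj : res (R := R) j ≫ tr j = 𝟙 _ := res_tr_of_injective _ Sum.inr_injective
    have hij : res (R := R) i ≫ tr j = 0 := res_tr_of_disjoint _ _ fun _ _ => Sum.inl_ne_inr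
    have hji : res (R := R) j ≫ tr i = 0 := res_tr_of_disjoint _ _ fun _ _ => Sum.inr_ne_inl
    let h : of R Z ⟶ of R ((X.sum X).prod Y) :=
      f ≫ prodHom (res i) (𝟙 _) + g ≫ prodHom (res j) (𝟙 _)
    have z : prodHom (0 : of R X ⟶ of R X) (𝟙 (of R Y)) = 0 := by
      rw [← zero_smul R (0 : of R X ⟶ of R X), prodHom_smul_left, zero_smul]
    have h1 : h ≫ prodHom (tr i) (𝟙 _) = f := by
      rw [Preadditive.add_comp, Category.assoc, Category.assoc, ← prodHom_comp, ← prodHom_comp, hi,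
        hji, Category.comp_id, z, prodHom_id, Category.comp_id, Limits.comp_zero, add_zero]
    have h2 : h ≫ prodHom (tr j) (𝟙 _) = g := by
      rw [Preadditive.add_comp, Category.assoc, Category.assoc, ← prodHom_comp, ← prodHom_comp, hj,
        hij, Category.comp_id, z, prodHom_id, Category.comp_id, Limits.comp_zero, zero_add]
    have h3 : f + g = h ≫ prodHom (tr i + tr j) (𝟙 _) := by
      rw [prodHom_add_left, Preadditive.comp_add, h1, h2]
    rw [h3, map_comp_apply, key, M.act_add, map_add, LinearMap.add_apply, map_add, ← key, ← key,
      ← map_comp_apply, ← map_comp_apply, h1, h2]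
  · have h1 : r • f = f ≫ prodHom (r • 𝟙 _) (𝟙 _) := by
      rw [prodHom_smul_left, prodHom_id, Linear.comp_smul, Category.comp_id]
    rw [h1, map_comp_apply, key, M.act_smul, M.act_id, map_smul, LinearMap.smul_apply, map_smul]

/-- The pairing with values in the linear part given by a natural transformation. -/
noncomputable def linearPairing {M N : MackeyFunctor R G}
    (α : M.obj ⊠ N.obj ⟶ Omega.prodFunctor ⋙ F) : LewisPairing M N (linearSub F) where
  toFun X Y := LinearMap.mk₂ R (fun m n => (⟨natApp α X Y m n, natApp_mem_linearPart α m n⟩ :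
      linearPart F (X.prod Y)))
    (fun _ _ _ => Subtype.ext (LinearMap.map_add₂ _ _ _ _))
    (fun _ _ _ => Subtype.ext (LinearMap.map_smul₂ _ _ _ _))
    (fun _ _ _ => Subtype.ext (map_add _ _ _)) (fun _ _ _ => Subtype.ext (map_smul _ _ _))
  nat f g m n := Subtype.ext (natApp_nat α f g m n)

end Subfunctor

/-- A pairing as a natural transformation. -/
noncomputable def LewisPairing.natTrans {M N Q : MackeyFunctor R G} (l : LewisPairing M N Q) :
    M.obj ⊠ N.obj ⟶ Omega.prodFunctor ⋙ Q.obj where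
  app P := ModuleCat.ofHom (TensorProduct.lift (l.toFun P.1.unop.gset P.2.unop.gset))
  naturality P P' f := by
    refine ModuleCat.hom_ext (TensorProduct.ext' fun m n => ?_)
    exact l.nat f.1.unop f.2.unop m n

theorem natTrans_ext {M N : MackeyFunctor R G} {F : (Omega R G)ᵒᵖ ⥤ ModuleCat.{u} R}
    {α β : M.obj ⊠ N.obj ⟶ Omega.prodFunctor ⋙ F}
    (h : ∀ (X Y : FinGSet G) (m : M.val X) (n : N.val Y), natApp α X Y m n = natApp β X Y m n) :
    α = β := by
  refine NatTrans.ext (funext fun P => ModuleCat.hom_ext (TensorProduct.ext' fun m n => ?_))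
  exact h P.1.unop.gset P.2.unop.gset m n

variable [Finite G]

section Existence

variable (M N : MackeyFunctor R G)

/-- A Mackey functor that corresponds to the box product of modules. -/
noncomputable def boxFunctor : MackeyFunctor R G :=
  (Phi R G).objPreimage (box ((Phi R G).obj M) ((Phi R G).obj N))

/-- The isomorphism that defines `boxFunctor`. -/
noncomputable def boxFunctorIso :
    (Phi R G).obj (boxFunctor M N) ≅ box ((Phi R G).obj M) ((Phi R G).obj N) :=
  (Phi R G).objObjPreimageIso _

/-- The universal pairing. -/
noncomputable def boxPairing : LewisPairing M N (boxFunctor M N) :=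
  (OrbitPairing.ofHom (boxFunctorIso M N).inv).toLewis

variable {M N}

/-- The universal pairing extends the orbit pairing read off from the inverse of `boxFunctorIso`,
and its diagonal restriction gives that orbit pairing back. This is the link between `m ⊠ n` and `[m
⊗ n]`. -/
theorem phiGrade_res_diag_boxPairing {H : Subgroup G} (m : M.val (FinGSet.orbit H))
    (n : N.val (FinGSet.orbit H)) :
    phiGrade _ H ((boxFunctor M N).act (res (diag _)) ((boxPairing M N).toFun _ _ m n)) =
      gradeHom (boxFunctorIso M N).inv H (boxMk (phiGrade M H m) (phiGrade N H n)) := by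
  rw [boxPairing, OrbitPairing.res_diag_toLewis, OrbitPairing.ofHom_apply, phiGrade_gradeVal]

theorem gradeHom_comp {A B C : ModuleCat.{u} (MackeyAlgebra R G)} (f : A ⟶ B) (g : B ⟶ C)
    {H : Subgroup G} (a : grade A H) :
    gradeHom (f ≫ g) H a = gradeHom g H (gradeHom f H a) := rfl

theorem gradeHom_id {A : ModuleCat.{u} (MackeyAlgebra R G)}
    {H : Subgroup G} (a : grade A H) : gradeHom (𝟙 A) H a = a := rfl

/-- On orbits, the grades of the module box product are generated by `I^H_L [m ⊗ n]`, and `[m ⊗ n]`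
is a diagonal restriction of a value of the universal pairing. General finite `G`-sets follow by
splitting into orbits. -/
theorem boxFunctor_ind {p : ∀ X : FinGSet G, (boxFunctor M N).val X → Prop}
    (add : ∀ X a b, p X a → p X b → p X (a + b))
    (act : ∀ {X Y : FinGSet G} (f : of R X ⟶ of R Y) a, p Y a → p X ((boxFunctor M N).act f a))
    (mk : ∀ (X Y : FinGSet G) m n, p _ ((boxPairing M N).toFun X Y m n)) (X a) : p X a := by
  have zero : ∀ X, p X 0 := fun X => by
    have := act (0 : of R X ⟶ _) _ (mk X X 0 0)
    rwa [MackeyFunctor.act_zero] at this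
  have h1 : ∀ (H : Subgroup G) (w : grade (box ((Phi R G).obj M) ((Phi R G).obj N)) H),
      p _ (gradeVal _ H (gradeHom (boxFunctorIso M N).inv H w)) := by
    intro H w
    induction w using grade_box_ind with
    | zero => rw [map_zero, map_zero]; exact zero _
    | add x y hx hy => rw [map_add, map_add]; exact add _ _ _ hx hy
    | mk L h m n =>
      rw [gradeHom_gradeMap_apply, gradeVal_gradeMap, ← phiGrade_gradeVal M L m,
        ← phiGrade_gradeVal N L n, ← phiGrade_res_diag_boxPairing, gradeVal_phiGrade]
      exact act _ _ (act _ _ (mk _ _ _ _))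
  have h2 : ∀ (H : Subgroup G) (a : (boxFunctor M N).val (FinGSet.orbit H)), p _ a := fun H a => by
    have := h1 H (gradeHom (boxFunctorIso M N).hom H (phiGrade _ H a))
    rwa [← gradeHom_comp, Iso.hom_inv_id, gradeHom_id, gradeVal_phiGrade] at this
  rw [(boxFunctor M N).eq_sum_emb a]
  exact Finset.sum_induction _ _ (add X) (zero X) fun i _ => act _ _ (h2 _ _)

/-- The target is an arbitrary functor to `R`-modules, since uniqueness in a Kan extension is tested
against all of them. -/
theorem boxFunctor_hom_ext {F : (Omega R G)ᵒᵖ ⥤ ModuleCat.{u} R}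
    {φ ψ : (boxFunctor M N).obj ⟶ F}
    (h : ∀ (X Y : FinGSet G) m n, (φ.app (op (of R (X.prod Y)))).hom
        ((boxPairing M N).toFun X Y m n) =
      (ψ.app (op (of R (X.prod Y)))).hom ((boxPairing M N).toFun X Y m n)) : φ = ψ := by
  refine NatTrans.ext (funext fun X => ModuleCat.hom_ext (LinearMap.ext fun a => ?_))
  refine boxFunctor_ind (p := fun X a => (φ.app (op (of R X))).hom a =
    (ψ.app (op (of R X))).hom a) ?_ ?_ h X.unop.gset a
  · intro X a b ha hb
    rw [map_add, map_add, ha, hb]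
  · intro X Y f a ha
    have h1 := congrArg (fun k => k.hom a) (φ.naturality f.op)
    have h2 := congrArg (fun k => k.hom a) (ψ.naturality f.op)
    exact h1.trans ((congrArg (F.map f.op).hom ha).trans h2.symm)

/-- The universal property of `boxFunctor` for Mackey functors. -/
theorem exists_boxFunctor_desc {Q : MackeyFunctor R G} (l : LewisPairing M N Q) :
    ∃ φ : boxFunctor M N ⟶ Q, ∀ (X Y : FinGSet G) m n,
      ev φ (X.prod Y) ((boxPairing M N).toFun X Y m n) = l.toFun X Y m n := by
  -- Fullness of `Φ` converts the module morphism given by the universal property of `box` into a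
  -- morphism of Mackey functors.
  obtain ⟨φ, hφ⟩ := (Phi R G).map_surjective ((boxFunctorIso M N).hom ≫ l.toOrbit.toGrade.lift)
  refine ⟨φ, fun X Y m n => Q.ext_orbit fun H b => ?_⟩
  -- Written as a pair, restriction along `b` becomes a diagonal restriction on `G/H`, where `φ` is
  -- controlled by `h1`.
  have hb : b = pair ((fst X Y).comp b) ((snd X Y).comp b) := rfl
  have h1 : ∀ (m : M.val (FinGSet.orbit H)) (n : N.val (FinGSet.orbit H)),
      ev φ (FinGSet.orbit H) ((boxFunctor M N).act (res (diag _))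
        ((boxPairing M N).toFun _ _ m n)) = Q.act (res (diag _)) (l.toFun _ _ m n) := by
    intro m n
    have := congrArg (fun k => gradeVal Q H (gradeHom k H (phiGrade _ H
      ((boxFunctor M N).act (res (diag _)) ((boxPairing M N).toFun _ _ m n))))) hφ
    simp only [gradeVal_gradeHom, gradeVal_phiGrade, gradeHom_comp] at this
    rw [this, phiGrade_res_diag_boxPairing, ← gradeHom_comp (boxFunctorIso M N).inv,
      Iso.inv_hom_id, gradeHom_id, OrbitPairing.lift_toGrade, gradeVal_phiGrade]
    rfl
  rw [hb, l.res_pair, ← MackeyFunctor.hom_act, (boxPairing M N).res_pair, h1]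

variable (R G) in
/-- A choice of box products of Mackey functors. -/
noncomputable def lewisBox : LewisBox R G where
  obj := boxFunctor
  unit M N := (boxPairing M N).natTrans
  isKan M N := by
    have h : ∀ (E : (Omega.prodFunctor (R := R) (G := G)).LeftExtension (M.obj ⊠ N.obj)),
        ∃ φ : (boxFunctor M N).obj ⟶ E.right,
          (boxPairing M N).natTrans ≫ Functor.whiskerLeft _ φ = E.hom := by
      intro E
      -- `E.right` need not be `R`-linear. Its largest linear subfunctor contains all values of
      -- `E.hom`, and the universal property for Mackey functors applies to that subfunctor.
      obtain ⟨φ, hφ⟩ := exists_boxFunctor_desc (linearPairing E.hom)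
      refine ⟨φ.hom ≫ linearSubIncl E.right, natTrans_ext fun X Y m n => ?_⟩
      exact congrArg Subtype.val (hφ X Y m n)
    choose φ hφ using h
    refine ⟨⟨Limits.IsInitial.ofUniqueHom (fun E => StructuredArrow.homMk (φ E) (hφ E))
      fun E k => ?_⟩⟩
    refine StructuredArrow.ext _ _ (boxFunctor_hom_ext fun X Y m n => ?_)
    have h1 := congrArg (fun α => natApp α X Y m n) (StructuredArrow.w k)
    have h2 := congrArg (fun α => natApp α X Y m n) (hφ E)
    exact h1.trans h2.symm

end Existence

end MackeyBox

/-! ### Naturality of the canonical bijections in `Ω_R(G)` -/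

namespace MackeyBox

open FinGSet Omega

variable {R : Type u} [CommRing R] {G : Type u} [Group G]

namespace Omega

/-- Naturality of restrictions along bijections, on spans. -/
theorem span_res_eq_res_span {X Y X' Y' V V' : FinGSet G} {e : X →[G] X'} {e' : Y →[G] Y'}
    {v : V →[G] V'} {a : V →[G] X} {b : V →[G] Y} {a' : V' →[G] X'} {b' : V' →[G] Y'}
    (he : Function.Bijective e) (hv : Function.Bijective v) (h : ∀ w, e (a w) = a' (v w))
    (h' : ∀ w, e' (b w) = b' (v w)) :
    (tr (R := R) a ≫ res b) ≫ res e' = res e ≫ tr a' ≫ res b' := by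
  have h1 := res_tr (R := R) e a' a v h (fun w w' _ hw => hv.1 hw) (fun x y hxy => by
    obtain ⟨w, rfl⟩ := hv.2 y
    exact ⟨w, he.1 ((h w).trans hxy.symm), rfl⟩)
  have h2 : e'.comp b = b'.comp v := MulActionHom.ext h'
  rw [Category.assoc, res_comp b e', h2, ← Category.assoc, h1, Category.assoc, res_comp v b']

theorem prodHom_span {X Y X' Y' V V' : FinGSet G} (a : V →[G] X) (b : V →[G] Y) (a' : V' →[G] X')
    (b' : V' →[G] Y') : prodHom (tr (R := R) a ≫ res b) (tr a' ≫ res b') =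
      tr (map a a') ≫ res (map b b') := by
  rw [prodHom_comp, prodHom_tr, prodHom_res]

/-- Both sides are bilinear, so it suffices to treat two spans. There the exchange of the factors of
the apices is a bijection compatible with all legs. -/
theorem prodHom_swap {X Y X' Y' : FinGSet G} (f : of R X ⟶ of R Y) (g : of R X' ⟶ of R Y') :
    prodHom f g ≫ res (swap Y Y') = res (swap X X') ≫ prodHom g f := by
  induction f using hom_ind with
  | add a b ha hb => rw [prodHom_add_left, prodHom_add_right, Preadditive.add_comp,
      Preadditive.comp_add, ha, hb]
  | smul r a ha => rw [prodHom_smul_left, prodHom_smul_right, Linear.smul_comp, Linear.comp_smul,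
      ha]
  | span V a b =>
    induction g using hom_ind with
    | add a b ha hb => rw [prodHom_add_left, prodHom_add_right, Preadditive.add_comp,
        Preadditive.comp_add, ha, hb]
    | smul r a ha => rw [prodHom_smul_left, prodHom_smul_right, Linear.smul_comp,
        Linear.comp_smul, ha]
    | span W c d =>
      rw [prodHom_span, prodHom_span]
      exact span_res_eq_res_span (v := swap V W) (bijective_swap _ _) (bijective_swap _ _)
        (fun _ => rfl) (fun _ => rfl)

theorem prodHom_assoc {X Y X' Y' X'' Y'' : FinGSet G} (f : of R X ⟶ of R Y)
    (g : of R X' ⟶ of R Y') (h : of R X'' ⟶ of R Y'') :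
    prodHom (prodHom f g) h ≫ res (assoc Y Y' Y'') =
      res (assoc X X' X'') ≫ prodHom f (prodHom g h) := by
  induction f using hom_ind with
  | add a b ha hb => rw [prodHom_add_left, prodHom_add_left, prodHom_add_left,
      Preadditive.add_comp, Preadditive.comp_add, ha, hb]
  | smul r a ha => rw [prodHom_smul_left, prodHom_smul_left, prodHom_smul_left, Linear.smul_comp,
      Linear.comp_smul, ha]
  | span V a b =>
    induction g using hom_ind with
    | add a b ha hb => rw [prodHom_add_left, prodHom_add_right, prodHom_add_right,
        prodHom_add_left, Preadditive.add_comp, Preadditive.comp_add, ha, hb]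
    | smul r a ha => rw [prodHom_smul_left, prodHom_smul_right, prodHom_smul_right,
        prodHom_smul_left, Linear.smul_comp, Linear.comp_smul, ha]
    | span W c d =>
      induction h using hom_ind with
      | add a b ha hb => rw [prodHom_add_right, prodHom_add_right, prodHom_add_right,
          Preadditive.add_comp, Preadditive.comp_add, ha, hb]
      | smul r a ha => rw [prodHom_smul_right, prodHom_smul_right, prodHom_smul_right,
          Linear.smul_comp, Linear.comp_smul, ha]
      | span U i j =>
        rw [prodHom_span, prodHom_span, prodHom_span, prodHom_span]
        exact span_res_eq_res_span (v := assoc V W U) (bijective_assoc _ _ _)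
          (bijective_assoc _ _ _) (fun _ => rfl) (fun _ => rfl)

variable [Finite G]

instance subsingleton_orbit_top : Subsingleton (FinGSet.orbit (⊤ : Subgroup G)) :=
  QuotientGroup.subsingleton_quotient_top

theorem bijective_snd (X : FinGSet G) :
    Function.Bijective (snd (FinGSet.orbit (⊤ : Subgroup G)) X) :=
  ⟨fun _ _ h => Prod.ext (Subsingleton.elim _ _) h,
    fun x => ⟨(((1 : G) : G ⧸ (⊤ : Subgroup G)), x), rfl⟩⟩

theorem prodHom_snd {X Y : FinGSet G} (f : of R X ⟶ of R Y) :
    prodHom (𝟙 (orbit R (⊤ : Subgroup G))) f ≫ res (snd _ Y) = res (snd _ X) ≫ f := by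
  induction f using hom_ind with
  | add a b ha hb => rw [prodHom_add_right, Preadditive.add_comp, Preadditive.comp_add, ha, hb]
  | smul r a ha => rw [prodHom_smul_right, Linear.smul_comp, Linear.comp_smul, ha]
  | span V a b =>
    have h := prodHom_span (R := R) (MulActionHom.id G) (MulActionHom.id G) a b
      (V := FinGSet.orbit (⊤ : Subgroup G))
    rw [res_id, tr_id, Category.id_comp] at h
    rw [h]
    exact span_res_eq_res_span (v := snd _ V) (bijective_snd _) (bijective_snd _)
        (fun _ => rfl) (fun _ => rfl)

theorem res_snd_tr_snd (X : FinGSet G) :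
    res (R := R) (snd (FinGSet.orbit (⊤ : Subgroup G)) X) ≫ tr (snd _ X) = 𝟙 _ :=
  res_tr_of_injective _ (bijective_snd X).1

theorem tr_snd_res_snd (X : FinGSet G) :
    tr (R := R) (snd (FinGSet.orbit (⊤ : Subgroup G)) X) ≫ res (snd _ X) = 𝟙 _ := by
  have h := res_tr (R := R) (MulActionHom.id G) (MulActionHom.id G)
    (snd (FinGSet.orbit (⊤ : Subgroup G)) X) (snd _ X) (fun _ => rfl)
    (fun _ _ h _ => (bijective_snd X).1 h) (fun x y h => by
      obtain ⟨w, hw⟩ := (bijective_snd X).2 x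
      exact ⟨w, hw, hw.trans h⟩)
  rw [← h, res_id, tr_id, Category.comp_id]

/-- Since `G/G` is a point, `snd` is invertible and its transfer is the inverse. This is
`prodHom_snd` read through that inverse, and it makes the inverse unitor natural. -/
theorem tr_snd_prodHom {X Y : FinGSet G} (f : of R X ⟶ of R Y) :
    tr (snd _ X) ≫ prodHom (𝟙 (orbit R (⊤ : Subgroup G))) f = f ≫ tr (snd _ Y) := by
  have h : prodHom (𝟙 (orbit R (⊤ : Subgroup G))) f = res (snd _ X) ≫ f ≫ tr (snd _ Y) := by
    rw [← Category.assoc, ← prodHom_snd, Category.assoc, res_snd_tr_snd, Category.comp_id]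
  rw [h, ← Category.assoc, tr_snd_res_snd, Category.id_comp]

end Omega

end MackeyBox

/-! ### Elements `m ⊠ n` of an arbitrary choice of Kan extensions -/

namespace MackeyBox

open FinGSet Omega

variable {R : Type u} [CommRing R] {G : Type u} [Group G]

theorem ev_act {M N : MackeyFunctor R G} (φ : M ⟶ N) {X Y : FinGSet G} (f : of R X ⟶ of R Y)
    (m : M.val Y) : ev φ X (M.act f m) = N.act f (ev φ Y m) := MackeyFunctor.hom_act φ f m

theorem ev_comp {M N P : MackeyFunctor R G} (φ : M ⟶ N) (ψ : N ⟶ P) {X : FinGSet G}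
    (m : M.val X) : ev (φ ≫ ψ) X m = ev ψ X (ev φ X m) := rfl

theorem ev_id {M : MackeyFunctor R G} {X : FinGSet G} (m : M.val X) : ev (𝟙 M) X m = m := rfl

namespace LewisBox

variable (L : LewisBox R G)

/-- The universal pairing `(m, n) ↦ m ⊠ n`. -/
noncomputable def pairing (M N : MackeyFunctor R G) : LewisPairing M N (L.obj M N) where
  toFun := natApp (L.unit M N)
  nat := natApp_nat (L.unit M N)

theorem pairing_apply {M N : MackeyFunctor R G} {X Y : FinGSet G} (m : M.val X) (n : N.val Y) :
    (L.pairing M N).toFun X Y m n = L.tmul m n := rfl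

theorem tmul_act {M N : MackeyFunctor R G} {X Y X' Y' : FinGSet G} (f : of R X ⟶ of R Y)
    (g : of R X' ⟶ of R Y') (m : M.val Y) (n : N.val Y') :
    L.tmul (M.act f m) (N.act g n) = (L.obj M N).act (prodHom f g) (L.tmul m n) :=
  (L.pairing M N).nat f g m n

theorem tmul_act_left {M N : MackeyFunctor R G} {X Y Z : FinGSet G} (f : of R X ⟶ of R Y)
    (m : M.val Y) (n : N.val Z) :
    L.tmul (M.act f m) n = (L.obj M N).act (prodHom f (𝟙 _)) (L.tmul m n) := by
  rw [← tmul_act, N.act_id]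

theorem tmul_act_right {M N : MackeyFunctor R G} {X Y Z : FinGSet G} (f : of R X ⟶ of R Y)
    (m : M.val Z) (n : N.val Y) :
    L.tmul m (N.act f n) = (L.obj M N).act (prodHom (𝟙 _) f) (L.tmul m n) := by
  rw [← tmul_act, M.act_id]

theorem tmul_res_left {M N : MackeyFunctor R G} {X Y Z : FinGSet G} (f : X →[G] Y)
    (m : M.val Y) (n : N.val Z) : L.tmul (M.act (res f) m) n =
      (L.obj M N).act (res (FinGSet.map f (MulActionHom.id G))) (L.tmul m n) := by
  rw [tmul_act_left, ← prodHom_res, res_id]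

theorem tmul_res_right {M N : MackeyFunctor R G} {X Y Z : FinGSet G} (f : X →[G] Y)
    (m : M.val Z) (n : N.val Y) : L.tmul m (N.act (res f) n) =
      (L.obj M N).act (res (FinGSet.map (MulActionHom.id G) f)) (L.tmul m n) := by
  rw [tmul_act_right, ← prodHom_res, res_id]

variable {L}

/-- The morphism out of `M □ N` given by a pairing. -/
noncomputable def lift {M N Q : MackeyFunctor R G} (l : LewisPairing M N Q) : L.obj M N ⟶ Q :=
  haveI := L.isKan M N
  ObjectProperty.homMk ((L.obj M N).obj.descOfIsLeftKanExtension (L.unit M N) Q.obj l.natTrans)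

theorem lift_tmul {M N Q : MackeyFunctor R G} (l : LewisPairing M N Q) {X Y : FinGSet G}
    (m : M.val X) (n : N.val Y) :
    ev (lift (L := L) l) (X.prod Y) (L.tmul m n) = l.toFun X Y m n := by
  have := L.isKan M N
  have := (L.obj M N).obj.descOfIsLeftKanExtension_fac_app (L.unit M N) Q.obj l.natTrans
    (op (Omega.of R X), op (Omega.of R Y))
  exact congrArg (fun k => k.hom (m ⊗ₜ[R] n)) this

theorem hom_ext {M N Q : MackeyFunctor R G} {φ ψ : L.obj M N ⟶ Q}
    (h : ∀ (X Y : FinGSet G) (m : M.val X) (n : N.val Y),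
      ev φ (X.prod Y) (L.tmul m n) = ev ψ (X.prod Y) (L.tmul m n)) : φ = ψ := by
  have := L.isKan M N
  refine ObjectProperty.hom_ext _ ((L.obj M N).obj.hom_ext_of_isLeftKanExtension (L.unit M N) _ _
    (natTrans_ext h))

variable [Finite G]

/-- Generation by the elements `m ⊠ n` is known for `boxFunctor`, and every other Kan extension is a
retract of it by the two universal properties. -/
theorem tmul_ind {M N : MackeyFunctor R G} {p : ∀ X : FinGSet G, (L.obj M N).val X → Prop}
    (add : ∀ X a b, p X a → p X b → p X (a + b))
    (act : ∀ {X Y : FinGSet G} (f : of R X ⟶ of R Y) a, p Y a → p X ((L.obj M N).act f a))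
    (tmul : ∀ (X Y : FinGSet G) (m : M.val X) (n : N.val Y), p _ (L.tmul m n)) (X a) : p X a := by
  obtain ⟨ψ, hψ⟩ := exists_boxFunctor_desc (L.pairing M N)
  have h1 : ∀ X b, p X (ev ψ X b) := by
    refine boxFunctor_ind ?_ ?_ ?_
    · intro X a b ha hb
      rw [map_add]
      exact add _ _ _ ha hb
    · intro X Y f a ha
      rw [ev_act]
      exact act _ _ ha
    · intro X Y m n
      rw [hψ]
      exact tmul _ _ _ _
  have h2 : lift (L := L) (boxPairing M N) ≫ ψ = 𝟙 _ := hom_ext fun X Y m n => by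
    rw [ev_comp, lift_tmul, hψ, ev_id, pairing_apply]
  have h3 := h1 X (ev (lift (boxPairing M N)) X a)
  rwa [← ev_comp, h2, ev_id] at h3

/-- The elements `m ⊠ n` generate the inner product under sums and the action of morphisms, and both
operations pass through the outer `⊠`. The variants for other bracketings rest on the same reason.
-/
theorem hom_ext_left {M N P Q : MackeyFunctor R G} {φ ψ : L.obj (L.obj M N) P ⟶ Q}
    (h : ∀ (X Y Z : FinGSet G) (m : M.val X) (n : N.val Y) (p : P.val Z),
      ev φ ((X.prod Y).prod Z) (L.tmul (L.tmul m n) p) =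
        ev ψ ((X.prod Y).prod Z) (L.tmul (L.tmul m n) p)) : φ = ψ := by
  refine hom_ext fun X Z w p => ?_
  refine tmul_ind (p := fun X w => ev φ (X.prod Z) (L.tmul w p) = ev ψ (X.prod Z) (L.tmul w p))
    ?_ ?_ (fun X Y m n => h X Y Z m n p) X w
  · intro X a b ha hb
    simp only [← pairing_apply, map_add, LinearMap.add_apply] at ha hb ⊢
    rw [ha, hb]
  · intro X Y f a ha
    rw [tmul_act_left, ev_act, ev_act, ha]

theorem hom_ext_right {M N P Q : MackeyFunctor R G} {φ ψ : L.obj M (L.obj N P) ⟶ Q}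
    (h : ∀ (X Y Z : FinGSet G) (m : M.val X) (n : N.val Y) (p : P.val Z),
      ev φ (X.prod (Y.prod Z)) (L.tmul m (L.tmul n p)) =
        ev ψ (X.prod (Y.prod Z)) (L.tmul m (L.tmul n p))) : φ = ψ := by
  refine hom_ext fun Z X m w => ?_
  refine tmul_ind (p := fun X w => ev φ (Z.prod X) (L.tmul m w) = ev ψ (Z.prod X) (L.tmul m w))
    ?_ ?_ (fun X Y n p => h Z X Y m n p) X w
  · intro X a b ha hb
    simp only [← pairing_apply, map_add] at ha hb ⊢
    rw [ha, hb]
  · intro X Y f a ha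
    rw [tmul_act_right, ev_act, ev_act, ha]

theorem hom_ext_four {M N P K Q : MackeyFunctor R G} {φ ψ : L.obj (L.obj (L.obj M N) P) K ⟶ Q}
    (h : ∀ (X Y Z W : FinGSet G) (m : M.val X) (n : N.val Y) (p : P.val Z) (k : K.val W),
      ev φ (((X.prod Y).prod Z).prod W) (L.tmul (L.tmul (L.tmul m n) p) k) =
        ev ψ (((X.prod Y).prod Z).prod W) (L.tmul (L.tmul (L.tmul m n) p) k)) : φ = ψ := by
  refine hom_ext_left fun X Z W w p k => ?_
  refine tmul_ind (p := fun X w => ev φ ((X.prod Z).prod W) (L.tmul (L.tmul w p) k) =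
    ev ψ ((X.prod Z).prod W) (L.tmul (L.tmul w p) k))
    ?_ ?_ (fun X Y m n => h X Y Z W m n p k) X w
  · intro X a b ha hb
    simp only [← pairing_apply, map_add, LinearMap.add_apply] at ha hb ⊢
    rw [ha, hb]
  · intro X Y f a ha
    rw [tmul_act_left, tmul_act_left, ev_act, ev_act, ha]

end LewisBox

end MackeyBox

/-! ### Associator, unitors and braiding of Mackey functors -/

namespace MackeyBox

open FinGSet Omega

variable {R : Type u} [CommRing R] {G : Type u} [Group G]

/-- The Mackey functor `X ↦ Q(X × Z)`. -/
noncomputable def shift (Q : MackeyFunctor R G) (Z : FinGSet G) : MackeyFunctor R G where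
  obj :=
    { obj := fun X => Q.val (X.unop.gset.prod Z)
      map := fun {X Y} f =>
        ModuleCat.ofHom (Q.act (X := Y.unop.gset.prod Z) (Y := X.unop.gset.prod Z)
          (prodHom f.unop (𝟙 (of R Z))))
      map_id := fun X => ModuleCat.hom_ext (LinearMap.ext fun q =>
        (congrArg (fun f => Q.act f q) (prodHom_id X.unop.gset Z)).trans (Q.act_id _ q))
      map_comp := fun {X Y W} f g => ModuleCat.hom_ext (LinearMap.ext fun q => by
        have h := prodHom_comp (R := R) (X := W.unop.gset) (Y := Y.unop.gset) (Z := X.unop.gset)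
          g.unop f.unop (𝟙 (of R Z)) (𝟙 (of R Z))
        rw [Category.id_comp] at h
        exact (congrArg (fun f => Q.act f q) h).trans (Q.act_comp _ _ q)) }
  property := by
    refine ⟨fun X Y f g => ?_, fun X Y r f => ?_⟩
    · refine ModuleCat.hom_ext (LinearMap.ext fun q => ?_)
      exact (congrArg (fun f => Q.act f q) (prodHom_add_left (X := X.gset) (Y := Y.gset) f g
        (𝟙 (of R Z)))).trans (Q.act_add _ _ q)
    · refine ModuleCat.hom_ext (LinearMap.ext fun q => ?_)
      exact (congrArg (fun f => Q.act f q) (prodHom_smul_left (X := X.gset) (Y := Y.gset) r f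
        (𝟙 (of R Z)))).trans (Q.act_smul _ _ q)

/-- Evaluation of a morphism to `X ↦ Q(X × Z)`. -/
noncomputable def evShift {M Q : MackeyFunctor R G} {Z : FinGSet G} (φ : M ⟶ shift Q Z)
    (X : FinGSet G) : M.val X →ₗ[R] Q.val (X.prod Z) := ev φ X

theorem evShift_act {M Q : MackeyFunctor R G} {Z : FinGSet G} (φ : M ⟶ shift Q Z)
    {X Y : FinGSet G} (f : of R X ⟶ of R Y) (m : M.val Y) :
    evShift φ X (M.act f m) = Q.act (prodHom f (𝟙 _)) (evShift φ Y m) := ev_act φ f m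

namespace LewisBox

variable (L : LewisBox R G)

theorem ev_map_tmul [Finite G] {M N M' N' : MackeyFunctor R G} (f : M ⟶ M') (g : N ⟶ N') {X Y : FinGSet G}
    (m : M.val X) (n : N.val Y) :
    ev (L.map f g) (X.prod Y) (L.tmul m n) = L.tmul (ev f X m) (ev g Y n) := L.map_tmul f g m n

/-- The pairing `(m, n) ↦ r_τ(n ⊠ m)`. -/
noncomputable def braidPairing (M N : MackeyFunctor R G) : LewisPairing M N (L.obj N M) where
  toFun X Y := ((L.pairing N M).toFun Y X).flip.compr₂ ((L.obj N M).act (res (swap X Y)))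
  nat f g m n := by
    simp only [LinearMap.compr₂_apply, LinearMap.flip_apply, pairing_apply]
    rw [tmul_act, ← MackeyFunctor.act_comp, ← MackeyFunctor.act_comp, prodHom_swap]

/-- The braiding. -/
noncomputable def braidHom (M N : MackeyFunctor R G) : L.obj M N ⟶ L.obj N M :=
  lift (L.braidPairing M N)

theorem braidHom_tmul {M N : MackeyFunctor R G} {X Y : FinGSet G} (m : M.val X) (n : N.val Y) :
    ev (L.braidHom M N) _ (L.tmul m n) = (L.obj N M).act (res (swap X Y)) (L.tmul n m) :=
  lift_tmul _ m n

theorem braidHom_braidHom (M N : MackeyFunctor R G) : L.braidHom M N ≫ L.braidHom N M = 𝟙 _ := by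
  refine hom_ext fun X Y m n => ?_
  rw [ev_comp, braidHom_tmul, ev_act, braidHom_tmul, MackeyFunctor.act_res_comp, ev_id]
  exact MackeyFunctor.act_res_id _ _

/-- The braiding as an isomorphism. -/
noncomputable def braid (M N : MackeyFunctor R G) : L.obj M N ≅ L.obj N M where
  hom := L.braidHom M N
  inv := L.braidHom N M
  hom_inv_id := L.braidHom_braidHom M N
  inv_hom_id := L.braidHom_braidHom N M

/-- The pairing `(m, n) ↦ r_α(m ⊠ (n ⊠ p))` for fixed `p`. -/
noncomputable def assocPairingAux (M N : MackeyFunctor R G) {P : MackeyFunctor R G} {Z : FinGSet G}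
    (p : P.val Z) : LewisPairing M N (shift (L.obj M (L.obj N P)) Z) where
  toFun X Y := (((L.pairing M (L.obj N P)).toFun X (Y.prod Z)).compl₂
    (((L.pairing N P).toFun Y Z).flip p)).compr₂
      ((L.obj M (L.obj N P)).act (res (FinGSet.assoc X Y Z)))
  nat {X Y X' Y'} f g m n := by
    change (L.obj M (L.obj N P)).act (res (FinGSet.assoc X X' Z))
        (L.tmul (M.act f m) (L.tmul (N.act g n) p)) =
      (L.obj M (L.obj N P)).act (prodHom (prodHom f g) (𝟙 _))
        ((L.obj M (L.obj N P)).act (res (FinGSet.assoc Y Y' Z)) (L.tmul m (L.tmul n p)))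
    rw [L.tmul_act_left g n p, tmul_act, ← MackeyFunctor.act_comp, ← MackeyFunctor.act_comp,
      prodHom_assoc]

/-- The value `w ↦ r_α(m ⊠ (n ⊠ p))` for `w = m ⊠ n`. -/
noncomputable def assocAux (M N : MackeyFunctor R G) {P : MackeyFunctor R G} (X : FinGSet G)
    {Z : FinGSet G} (p : P.val Z) :
    (L.obj M N).val X →ₗ[R] (L.obj M (L.obj N P)).val (X.prod Z) :=
  evShift (lift (L.assocPairingAux M N p)) X

theorem assocAux_tmul {M N P : MackeyFunctor R G} {X Y Z : FinGSet G} (m : M.val X) (n : N.val Y)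
    (p : P.val Z) : L.assocAux M N (X.prod Y) p (L.tmul m n) =
      (L.obj M (L.obj N P)).act (res (FinGSet.assoc X Y Z)) (L.tmul m (L.tmul n p)) :=
  lift_tmul (L.assocPairingAux M N p) m n

theorem assocAux_act {M N P : MackeyFunctor R G} {X Y Z : FinGSet G} (f : of R X ⟶ of R Y)
    (w : (L.obj M N).val Y) (p : P.val Z) : L.assocAux M N X p ((L.obj M N).act f w) =
      (L.obj M (L.obj N P)).act (prodHom f (𝟙 _)) (L.assocAux M N Y p w) :=
  evShift_act _ f w

variable [Finite G]

/-- Uniqueness for maps out of `M □ N` with `p` fixed. It yields additivity, `R`-linearity and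
naturality in `p`, none of which is visible in the construction of `assocAux`. -/
theorem assocAux_eq {M N P : MackeyFunctor R G} {Z : FinGSet G} (p : P.val Z) (F : ∀ X,
    (L.obj M N).val X →ₗ[R] (L.obj M (L.obj N P)).val (X.prod Z))
    (act : ∀ {X Y : FinGSet G} (f : of R X ⟶ of R Y) w, F X ((L.obj M N).act f w) =
      (L.obj M (L.obj N P)).act (prodHom f (𝟙 _)) (F Y w))
    (tmul : ∀ (X Y : FinGSet G) (m : M.val X) (n : N.val Y), F _ (L.tmul m n) =
      (L.obj M (L.obj N P)).act (res (FinGSet.assoc X Y Z)) (L.tmul m (L.tmul n p)))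
    (X) (w) : L.assocAux M N X p w = F X w := by
  refine tmul_ind (p := fun X w => L.assocAux M N X p w = F X w) ?_ ?_ ?_ X w
  · intro X a b ha hb
    rw [map_add, map_add, ha, hb]
  · intro X Y f a ha
    rw [assocAux_act, act, ha]
  · intro X Y m n
    rw [assocAux_tmul, tmul]

/-- The pairing `(m ⊠ n, p) ↦ r_α(m ⊠ (n ⊠ p))`. -/
noncomputable def assocPairing (M N P : MackeyFunctor R G) :
    LewisPairing (L.obj M N) P (L.obj M (L.obj N P)) where
  toFun X Z := LinearMap.mk₂ R (fun w p => L.assocAux M N X p w)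
    (fun w w' p => map_add _ w w') (fun r w p => map_smul _ r w)
    (fun w p p' => by
      refine L.assocAux_eq (p + p') (fun X => L.assocAux M N X p + L.assocAux M N X p') ?_ ?_ X w
      · intro X Y f w
        simp only [LinearMap.add_apply, assocAux_act, map_add]
      · intro X Y m n
        simp only [LinearMap.add_apply, assocAux_tmul]
        simp only [← pairing_apply, map_add])
    (fun r w p => by
      refine L.assocAux_eq (r • p) (fun X => r • L.assocAux M N X p) ?_ ?_ X w
      · intro X Y f w
        simp only [LinearMap.smul_apply, assocAux_act, map_smul]
      · intro X Y m n
        simp only [LinearMap.smul_apply, assocAux_tmul]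
        simp only [← pairing_apply, map_smul])
  nat {X Y X' Y'} f g w p := by
    have h : L.assocAux M N Y (P.act g p) w =
        (L.obj M (L.obj N P)).act (prodHom (𝟙 _) g) (L.assocAux M N Y p w) := by
      refine L.assocAux_eq (P.act g p)
        (fun X => (L.obj M (L.obj N P)).act (prodHom (𝟙 _) g) ∘ₗ L.assocAux M N X p) ?_ ?_ Y w
      · intro X Y f w
        simp only [LinearMap.comp_apply, assocAux_act]
        rw [← MackeyFunctor.act_comp, ← MackeyFunctor.act_comp, ← prodHom_comp, ← prodHom_comp,
          Category.id_comp, Category.id_comp, Category.comp_id, Category.comp_id]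
      · intro X Y m n
        simp only [LinearMap.comp_apply, assocAux_tmul]
        rw [tmul_act_right, tmul_act_right, ← MackeyFunctor.act_comp, ← MackeyFunctor.act_comp,
          ← prodHom_assoc, prodHom_id]
    simp only [LinearMap.mk₂_apply]
    rw [assocAux_act, h, ← MackeyFunctor.act_comp, ← prodHom_comp, Category.id_comp,
      Category.comp_id]

/-- The associator. -/
noncomputable def assocHom (M N P : MackeyFunctor R G) :
    L.obj (L.obj M N) P ⟶ L.obj M (L.obj N P) := lift (L.assocPairing M N P)

theorem assocHom_tmul {M N P : MackeyFunctor R G} {X Y Z : FinGSet G} (m : M.val X) (n : N.val Y)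
    (p : P.val Z) : ev (L.assocHom M N P) _ (L.tmul (L.tmul m n) p) =
      (L.obj M (L.obj N P)).act (res (FinGSet.assoc X Y Z)) (L.tmul m (L.tmul n p)) :=
  (lift_tmul _ _ _).trans (L.assocAux_tmul m n p)

/-- The inverse of the associator, obtained from the associator and the braiding. -/
noncomputable def assocInv (M N P : MackeyFunctor R G) :
    L.obj M (L.obj N P) ⟶ L.obj (L.obj M N) P :=
  L.braidHom _ _ ≫ L.map (L.braidHom _ _) (𝟙 _) ≫ L.assocHom P N M ≫ L.braidHom _ _ ≫
    L.map (L.braidHom _ _) (𝟙 _)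

/-- The inverse of the canonical bijection `(X × Y) × Z → X × (Y × Z)`. -/
def _root_.MackeyBox.FinGSet.assocSymm (X Y Z : FinGSet G) :
    X.prod (Y.prod Z) →[G] (X.prod Y).prod Z :=
  ⟨fun p => ((p.1, p.2.1), p.2.2), fun _ _ => rfl⟩

/-- The factors are reversed by braidings, reassociated as `(p ⊠ n) ⊠ m ↦ p ⊠ (n ⊠ m)`, and reversed
again. Every stage is a restriction along a bijection, and their composite is the inverse
reassociation. -/
theorem assocInv_tmul {M N P : MackeyFunctor R G} {X Y Z : FinGSet G} (m : M.val X) (n : N.val Y)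
    (p : P.val Z) : ev (L.assocInv M N P) _ (L.tmul m (L.tmul n p)) =
      (L.obj (L.obj M N) P).act (res (assocSymm X Y Z)) (L.tmul (L.tmul m n) p) := by
  simp only [assocInv, ev_comp, braidHom_tmul, ev_act, ev_map_tmul, ev_id, tmul_res_left,
    assocHom_tmul, MackeyFunctor.act_res_comp]
  rfl

/-- The associator as an isomorphism. -/
noncomputable def assoc (M N P : MackeyFunctor R G) :
    L.obj (L.obj M N) P ≅ L.obj M (L.obj N P) where
  hom := L.assocHom M N P
  inv := L.assocInv M N P
  hom_inv_id := hom_ext_left fun X Y Z m n p => by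
    rw [ev_comp, assocHom_tmul, ev_act, assocInv_tmul, MackeyFunctor.act_res_comp, ev_id]
    exact MackeyFunctor.act_res_id _ _
  inv_hom_id := hom_ext_right fun X Y Z m n p => by
    rw [ev_comp, assocInv_tmul, ev_act, assocHom_tmul, MackeyFunctor.act_res_comp, ev_id]
    exact MackeyFunctor.act_res_id _ _

/-- An element of `B^G(X)` as a morphism. -/
noncomputable def _root_.MackeyBox.burnsideHom {X : FinGSet G} :
    (burnside R G).val X →ₗ[R] (of R X ⟶ orbit R (⊤ : Subgroup G)) := LinearMap.id

theorem _root_.MackeyBox.burnsideHom_act {X Y : FinGSet G} (f : of R X ⟶ of R Y)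
    (x : (burnside R G).val Y) :
    burnsideHom ((burnside R G).act f x) = f ≫ burnsideHom x := rfl

/-- The element `id_{G/G}` of `B^G(G/G)`. -/
noncomputable def _root_.MackeyBox.burnsideOne (R : Type u) [CommRing R] (G : Type u) [Group G]
    [Finite G] : (burnside R G).val (FinGSet.orbit ⊤) := 𝟙 (orbit R (⊤ : Subgroup G))

/-- By Yoneda, the identity of `G/G` generates `B^G`; morphisms out of a product with `B^G` can thus
be tested on this one element. -/
theorem _root_.MackeyBox.act_burnsideOne {X : FinGSet G} (x : (burnside R G).val X) :
    (burnside R G).act (burnsideHom x) (burnsideOne R G) = x :=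
  Category.comp_id (burnsideHom x)

theorem _root_.MackeyBox.burnsideHom_burnsideOne :
    burnsideHom (burnsideOne R G) = 𝟙 (orbit R (⊤ : Subgroup G)) := rfl

/-- The pairing `(x, m) ↦ x · m` of the Burnside functor with a Mackey functor. -/
noncomputable def unitPairing (M : MackeyFunctor R G) : LewisPairing (burnside R G) M M where
  toFun X Y := LinearMap.mk₂ R
    (fun x m => M.act (prodHom (burnsideHom x) (𝟙 _) ≫ res (snd _ Y)) m)
    (fun x x' m => by rw [map_add, prodHom_add_left, Preadditive.add_comp, M.act_add])
    (fun r x m => by rw [map_smul, prodHom_smul_left, Linear.smul_comp, M.act_smul])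
    (fun x m m' => map_add _ _ _) (fun r x m => map_smul _ _ _)
  nat f g x m := by
    simp only [LinearMap.mk₂_apply]
    rw [← M.act_comp, ← M.act_comp, burnsideHom_act, Category.assoc, ← prodHom_snd,
      ← Category.assoc, ← Category.assoc, ← prodHom_comp, ← prodHom_comp, Category.id_comp,
      Category.comp_id, Category.comp_id]

/-- The left unitor. -/
noncomputable def leftUnitHom (M : MackeyFunctor R G) : L.obj (burnside R G) M ⟶ M :=
  lift (unitPairing M)

theorem leftUnitHom_tmul {M : MackeyFunctor R G} {X Y : FinGSet G} (x : (burnside R G).val X)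
    (m : M.val Y) : ev (L.leftUnitHom M) _ (L.tmul x m) =
      M.act (prodHom (burnsideHom x) (𝟙 _) ≫ res (snd _ Y)) m := lift_tmul _ x m

theorem leftUnitHom_one_tmul {M : MackeyFunctor R G} {Y : FinGSet G}
    (m : M.val Y) : ev (L.leftUnitHom M) _ (L.tmul (burnsideOne R G) m) =
      M.act (res (snd _ Y)) m := by
  rw [leftUnitHom_tmul, burnsideHom_burnsideOne, prodHom_id, Category.id_comp]

/-- The inverse of the left unitor. -/
noncomputable def leftUnitInv (M : MackeyFunctor R G) : M ⟶ L.obj (burnside R G) M :=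
  MackeyFunctor.homMk (fun X => (L.obj (burnside R G) M).act (tr (snd _ X)) ∘ₗ
      (L.pairing (burnside R G) M).toFun _ X (burnsideOne R G)) (fun {X Y} f m => by
    simp only [LinearMap.comp_apply, pairing_apply]
    rw [tmul_act_right, ← MackeyFunctor.act_comp, ← MackeyFunctor.act_comp, tr_snd_prodHom])

theorem ev_leftUnitInv {M : MackeyFunctor R G} {X : FinGSet G} (m : M.val X) :
    ev (L.leftUnitInv M) X m =
      (L.obj (burnside R G) M).act (tr (snd _ X)) (L.tmul (burnsideOne R G) m) := rfl

/-- The left unitor as an isomorphism. -/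
noncomputable def leftUnit (M : MackeyFunctor R G) : L.obj (burnside R G) M ≅ M where
  hom := L.leftUnitHom M
  inv := L.leftUnitInv M
  hom_inv_id := hom_ext fun X Y x m => by
    -- Because `x` is `id_{G/G}` acted on by `x` itself, the action of `x × 1` carries `id_{G/G} ⊠
    -- m` to `x ⊠ m`.
    rw [ev_comp, leftUnitHom_tmul, ev_act, ev_leftUnitInv, ← MackeyFunctor.act_comp,
      Category.assoc, res_snd_tr_snd, Category.comp_id, ← tmul_act_left, act_burnsideOne, ev_id]
  inv_hom_id := MackeyFunctor.hom_ext fun X m => by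
    change ev (L.leftUnitInv M ≫ L.leftUnitHom M) X m = m
    rw [ev_comp, ev_leftUnitInv, ev_act, leftUnitHom_one_tmul, ← MackeyFunctor.act_comp,
      tr_snd_res_snd, MackeyFunctor.act_id]

theorem rightUnitHom_tmul_one {M : MackeyFunctor R G} {Y : FinGSet G} (m : M.val Y) :
    ev (L.braidHom M _ ≫ L.leftUnitHom M) _ (L.tmul m (burnsideOne R G)) =
      M.act (res (fst Y _)) m := by
  rw [ev_comp, braidHom_tmul, ev_act, leftUnitHom_one_tmul, MackeyFunctor.act_res_comp]
  rfl

/-- The associators, unitors and braidings of the box product of Mackey functors. -/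
noncomputable def coherence : L.Coherence where
  assoc := L.assoc
  leftUnit := L.leftUnit
  rightUnit M := L.braid M _ ≪≫ L.leftUnit M
  braid := L.braid
  assoc_tmul := L.assocHom_tmul
  leftUnit_tmul := L.leftUnitHom_one_tmul
  rightUnit_tmul := L.rightUnitHom_tmul_one
  braid_tmul := L.braidHom_tmul

end LewisBox

end MackeyBox

/-! ### Symmetric monoidal axioms for Mackey functors -/

namespace MackeyBox

open FinGSet Omega

variable {R : Type u} [CommRing R] {G : Type u} [Group G]

namespace LewisBox

variable [Finite G] (L : LewisBox R G)

theorem map_id (M N : MackeyFunctor R G) : L.map (𝟙 M) (𝟙 N) = 𝟙 _ :=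
  hom_ext fun X Y m n => by rw [ev_map_tmul, ev_id, ev_id, ev_id]

theorem map_comp {M N M' N' M'' N'' : MackeyFunctor R G} (f : M ⟶ M') (f' : M' ⟶ M'')
    (g : N ⟶ N') (g' : N' ⟶ N'') : L.map (f ≫ f') (g ≫ g') = L.map f g ≫ L.map f' g' :=
  hom_ext fun X Y m n => by
    rw [ev_map_tmul, ev_comp, ev_comp, ev_comp, ev_map_tmul, ev_map_tmul]

theorem braid_naturality {M N M' N' : MackeyFunctor R G} (f : M ⟶ M') (g : N ⟶ N') :
    L.map f g ≫ L.braidHom M' N' = L.braidHom M N ≫ L.map g f :=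
  hom_ext fun X Y m n => by
    rw [ev_comp, ev_comp, ev_map_tmul, braidHom_tmul, braidHom_tmul, ev_act, ev_map_tmul]

theorem hom_ext_unit {M Q : MackeyFunctor R G} {φ ψ : L.obj (burnside R G) M ⟶ Q}
    (h : ∀ (X : FinGSet G) (m : M.val X), ev φ _ (L.tmul (burnsideOne R G) m) =
      ev ψ _ (L.tmul (burnsideOne R G) m)) : φ = ψ :=
  hom_ext fun X Y x m => by
    rw [← act_burnsideOne x, tmul_act_left, ev_act, ev_act, h]

theorem hom_ext_middle_unit {M N Q : MackeyFunctor R G}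
    {φ ψ : L.obj (L.obj M (burnside R G)) N ⟶ Q}
    (h : ∀ (X Y : FinGSet G) (m : M.val X) (n : N.val Y),
      ev φ _ (L.tmul (L.tmul m (burnsideOne R G)) n) =
        ev ψ _ (L.tmul (L.tmul m (burnsideOne R G)) n)) : φ = ψ :=
  hom_ext_left fun X Y Z m x n => by
    rw [← act_burnsideOne x, tmul_act_right, tmul_act_left, ev_act, ev_act, h]

theorem assoc_naturality {M N P M' N' P' : MackeyFunctor R G} (f : M ⟶ M') (g : N ⟶ N')
    (h : P ⟶ P') : L.map (L.map f g) h ≫ L.assocHom M' N' P' =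
      L.assocHom M N P ≫ L.map f (L.map g h) :=
  hom_ext_left fun X Y Z m n p => by
    rw [ev_comp, ev_comp, ev_map_tmul, ev_map_tmul, assocHom_tmul, assocHom_tmul, ev_act,
      ev_map_tmul, ev_map_tmul]

theorem leftUnit_naturality {M N : MackeyFunctor R G} (f : M ⟶ N) :
    L.map (𝟙 _) f ≫ L.leftUnitHom N = L.leftUnitHom M ≫ f :=
  L.hom_ext_unit fun X m => by
    rw [ev_comp, ev_comp, ev_map_tmul, leftUnitHom_one_tmul, ev_act, ev_id, leftUnitHom_one_tmul]

theorem rightUnit_naturality {M N : MackeyFunctor R G} (f : M ⟶ N) :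
    L.map f (𝟙 _) ≫ L.braidHom N _ ≫ L.leftUnitHom N =
      (L.braidHom M _ ≫ L.leftUnitHom M) ≫ f := by
  rw [← Category.assoc, braid_naturality, Category.assoc, Category.assoc, leftUnit_naturality]

/-- On a fourfold element both sides are restrictions of the same element along reassociating
bijections, and these agree definitionally. The triangle and the hexagons work alike. -/
theorem pentagon (M N P K : MackeyFunctor R G) :
    L.map (L.assocHom M N P) (𝟙 K) ≫ L.assocHom M (L.obj N P) K ≫
        L.map (𝟙 M) (L.assocHom N P K) =
      L.assocHom (L.obj M N) P K ≫ L.assocHom M N (L.obj P K) :=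
  hom_ext_four fun X Y Z W m n p k => by
    simp only [ev_comp, ev_map_tmul, ev_id, assocHom_tmul, ev_act, tmul_res_left, tmul_res_right,
      MackeyFunctor.act_res_comp]
    rfl

theorem triangle (M N : MackeyFunctor R G) :
    L.assocHom M (burnside R G) N ≫ L.map (𝟙 M) (L.leftUnitHom N) =
      L.map (L.braidHom M _ ≫ L.leftUnitHom M) (𝟙 N) :=
  L.hom_ext_middle_unit fun X Y m n => by
    rw [ev_comp, assocHom_tmul, ev_act, ev_map_tmul, ev_map_tmul, rightUnitHom_tmul_one,
      leftUnitHom_one_tmul, ev_id, ev_id, tmul_res_left, tmul_res_right,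
      MackeyFunctor.act_res_comp]
    rfl

theorem hexagon_forward (M N P : MackeyFunctor R G) :
    L.assocHom M N P ≫ L.braidHom M (L.obj N P) ≫ L.assocHom N P M =
      L.map (L.braidHom M N) (𝟙 P) ≫ L.assocHom N M P ≫ L.map (𝟙 N) (L.braidHom M P) :=
  hom_ext_left fun X Y Z m n p => by
    simp only [ev_comp, ev_map_tmul, ev_id, assocHom_tmul, ev_act, tmul_res_left, tmul_res_right,
      MackeyFunctor.act_res_comp, braidHom_tmul]
    rfl

theorem hexagon_reverse (M N P : MackeyFunctor R G) :
    L.assocInv M N P ≫ L.braidHom (L.obj M N) P ≫ L.assocInv P M N =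
      L.map (𝟙 M) (L.braidHom N P) ≫ L.assocInv M P N ≫ L.map (L.braidHom M P) (𝟙 N) :=
  hom_ext_right fun X Y Z m n p => by
    simp only [ev_comp, ev_map_tmul, ev_id, assocInv_tmul, ev_act, tmul_res_left, tmul_res_right,
      MackeyFunctor.act_res_comp, braidHom_tmul]
    rfl

theorem isMonoidal : IsMonoidal L.coherence.toStruct :=
  ⟨{ L.coherence.toStruct with
      tensorHom_def := fun {M M' N N'} f g => by
        change L.map f g = L.map f (𝟙 N) ≫ L.map (𝟙 M') g
        rw [← map_comp, Category.id_comp, Category.comp_id]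
      id_tensorHom_id := L.map_id
      tensorHom_comp_tensorHom := fun f f' g g' => (L.map_comp f g f' g').symm
      whiskerLeft_id := L.map_id
      id_whiskerRight := L.map_id
      associator_naturality := L.assoc_naturality
      leftUnitor_naturality := L.leftUnit_naturality
      rightUnitor_naturality := L.rightUnit_naturality
      pentagon := L.pentagon
      triangle := L.triangle }, rfl⟩

/-- The symmetry of the box product of Mackey functors. -/
@[reducible]
noncomputable def symmetric :
    letI := L.isMonoidal.toMonoidalCategory
    SymmetricCategory (MackeyFunctor R G) :=
  letI := L.isMonoidal.toMonoidalCategory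
  { braiding := L.braid
    braiding_naturality_left := fun f N => L.braid_naturality f (𝟙 N)
    braiding_naturality_right := fun M _ _ g => L.braid_naturality (𝟙 M) g
    hexagon_forward := L.hexagon_forward
    hexagon_reverse := L.hexagon_reverse
    symmetry := L.braidHom_braidHom }

end LewisBox

end MackeyBox

/-! ### Testing morphisms out of iterated box products of modules -/

namespace MackeyBox

open FinGSet Omega

variable {R : Type u} [CommRing R] {G : Type u} [Group G] [Finite G]

section Ext

variable {M N P Q : ModuleCat.{u} (MackeyAlgebra R G)}

theorem boxMap_id (M N : ModuleCat.{u} (MackeyAlgebra R G)) : boxMap (𝟙 M) (𝟙 N) = 𝟙 _ :=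
  box_hom_ext fun H m n => by
    rw [gradeHom_boxMap, gradeHom_id, gradeHom_id, gradeHom_id]

theorem boxMap_comp {M' N' M'' N'' : ModuleCat.{u} (MackeyAlgebra R G)} (f : M ⟶ M')
    (f' : M' ⟶ M'') (g : N ⟶ N') (g' : N' ⟶ N'') :
    boxMap (f ≫ f') (g ≫ g') = boxMap f g ≫ boxMap f' g' :=
  box_hom_ext fun H m n => by
    rw [gradeHom_boxMap, gradeHom_comp, gradeHom_comp, gradeHom_comp, gradeHom_boxMap,
      gradeHom_boxMap]

/-- Isomorphisms induce isomorphisms of box products. -/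
noncomputable def boxMapIso {M' N' : ModuleCat.{u} (MackeyAlgebra R G)} (e : M ≅ M')
    (e' : N ≅ N') : box M N ≅ box M' N' where
  hom := boxMap e.hom e'.hom
  inv := boxMap e.inv e'.inv
  hom_inv_id := by rw [← boxMap_comp, Iso.hom_inv_id, Iso.hom_inv_id, boxMap_id]
  inv_hom_id := by rw [← boxMap_comp, Iso.inv_hom_id, Iso.inv_hom_id, boxMap_id]

/-- Frobenius reciprocity rewrites `[I^H_L [m ⊗ n] ⊗ p]` as `I^H_L` applied to `[[m ⊗ n] ⊗ R^H_L
p]`, so symbols with all entries in one grade suffice. -/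
theorem box_hom_ext_left {f g : box (box M N) P ⟶ Q}
    (h : ∀ H (m : grade M H) (n : grade N H) (p : grade P H),
      gradeHom f H (boxMk (boxMk m n) p) = gradeHom g H (boxMk (boxMk m n) p)) : f = g := by
  refine box_hom_ext fun H w p => ?_
  induction w using grade_box_ind with
  | zero => simp only [← boxMkL_apply, map_zero, LinearMap.zero_apply]
  | add x y hx hy =>
    simp only [← boxMkL_apply, map_add, LinearMap.add_apply] at hx hy ⊢
    rw [hx, hy]
  | mk L h' m n => rw [boxMk_elI_left, gradeHom_gradeMap_apply, gradeHom_gradeMap_apply, h]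

theorem box_hom_ext_right {f g : box M (box N P) ⟶ Q}
    (h : ∀ H (m : grade M H) (n : grade N H) (p : grade P H),
      gradeHom f H (boxMk m (boxMk n p)) = gradeHom g H (boxMk m (boxMk n p))) : f = g := by
  refine box_hom_ext fun H m w => ?_
  induction w using grade_box_ind with
  | zero => simp only [← boxMkL_apply, map_zero]
  | add x y hx hy =>
    simp only [← boxMkL_apply, map_add] at hx hy ⊢
    rw [hx, hy]
  | mk L h' n p => rw [boxMk_elI_right, gradeHom_gradeMap_apply, gradeHom_gradeMap_apply, h]

theorem box_hom_ext_four {K : ModuleCat.{u} (MackeyAlgebra R G)}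
    {f g : box (box (box M N) P) K ⟶ Q}
    (h : ∀ H (m : grade M H) (n : grade N H) (p : grade P H) (k : grade K H),
      gradeHom f H (boxMk (boxMk (boxMk m n) p) k) =
        gradeHom g H (boxMk (boxMk (boxMk m n) p) k)) : f = g := by
  refine box_hom_ext_left fun H w p k => ?_
  induction w using grade_box_ind with
  | zero => simp only [← boxMkL_apply, map_zero, LinearMap.zero_apply]
  | add x y hx hy =>
    simp only [← boxMkL_apply, map_add, LinearMap.add_apply] at hx hy ⊢
    rw [hx, hy]
  | mk L h' m n =>
    rw [boxMk_elI_left, boxMk_elI_left, gradeHom_gradeMap_apply, gradeHom_gradeMap_apply, h]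

end Ext

section Braid

/-- The pairing `(m, n) ↦ [n ⊗ m]`. -/
noncomputable def boxBraidPairing (M N : ModuleCat.{u} (MackeyAlgebra R G)) :
    GradePairing M N (box N M) where
  toFun _ := (boxMkL N M _).flip
  elC g _ m n := boxMk_elC g n m
  elR h m n := boxMk_elR h n m
  frobRight h m n := boxMk_elI_left h n m
  frobLeft h m n := boxMk_elI_right h n m

/-- The braiding of the box product of modules. -/
noncomputable def boxBraidHom (M N : ModuleCat.{u} (MackeyAlgebra R G)) : box M N ⟶ box N M :=
  (boxBraidPairing M N).lift

theorem boxBraidHom_boxMk {M N : ModuleCat.{u} (MackeyAlgebra R G)} {H : Subgroup G}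
    (m : grade M H) (n : grade N H) : gradeHom (boxBraidHom M N) H (boxMk m n) = boxMk n m :=
  (boxBraidPairing M N).lift_boxMk m n

theorem boxBraidHom_boxBraidHom (M N : ModuleCat.{u} (MackeyAlgebra R G)) :
    boxBraidHom M N ≫ boxBraidHom N M = 𝟙 _ :=
  box_hom_ext fun H m n => by
    rw [gradeHom_comp, boxBraidHom_boxMk, boxBraidHom_boxMk, gradeHom_id]

/-- The braiding as an isomorphism. -/
noncomputable def boxBraid (M N : ModuleCat.{u} (MackeyAlgebra R G)) : box M N ≅ box N M where
  hom := boxBraidHom M N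
  inv := boxBraidHom N M
  hom_inv_id := boxBraidHom_boxBraidHom M N
  inv_hom_id := boxBraidHom_boxBraidHom N M

end Braid

section Unit

variable (R G) in
/-- The unit module is `Φ` of the Burnside functor. -/
noncomputable def unitIso : unitModule R G ≅ (Phi R G).obj (burnside R G) where
  hom := ModuleCat.ofHom (X := UnitCarrier R G) (Y := PhiCarrier (burnside R G))
    { toFun := fun x => x
      map_add' := fun _ _ => rfl
      map_smul' := fun _ _ => rfl }
  inv := ModuleCat.ofHom (Y := UnitCarrier R G) (X := PhiCarrier (burnside R G))
    { toFun := fun x => x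
      map_add' := fun _ _ => rfl
      map_smul' := fun _ _ => rfl }
  hom_inv_id := rfl
  inv_hom_id := rfl

/-- The element `n_H` in the Burnside functor. -/
theorem gradeHom_unitIso_unitGrade (H : Subgroup G) :
    gradeHom (unitIso R G).hom H (unitGrade R H) =
      phiGrade (burnside R G) H ((burnside R G).act (elR le_top) (burnsideOne R G)) := by
  have h : (burnside R G).act (elR le_top) (burnsideOne R G) =
      (elR le_top : orbit R H ⟶ orbit R ⊤) := Category.comp_id (elR le_top)
  rw [h]
  rfl

/-- Morphisms `G/H → G/G` are combinations of some `I^H_L` followed by a restriction from `G/L` to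
`G/G`, and there is only one map `G/L → G/G`. So the grade `H` of the unit is spanned by the
elements `I^H_L n_L`. -/
theorem grade_unit_ind {H : Subgroup G} {p : grade (unitModule R G) H → Prop} (zero : p 0)
    (add : ∀ x y, p x → p y → p (x + y)) (smul : ∀ (r : R) x, p x → p (r • x))
    (mk : ∀ (L : Subgroup G) (h : L ≤ H), p (gradeMap _ (elI h) (unitGrade R L))) (u) : p u := by
  have key : ∀ x : orbit R H ⟶ orbit R ⊤, p (gradeHom (unitIso R G).inv H
      (phiGradeL (burnside R G) H ((burnside R G).actL (burnsideOne R G) x))) := by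
    intro x
    induction x using orbit_hom_ind with
    | zero => rw [map_zero, map_zero, map_zero]; exact zero
    | add a b ha hb => rw [map_add, map_add, map_add]; exact add _ _ ha hb
    | smul r a ha => rw [map_smul, map_smul, map_smul]; exact smul r _ ha
    | span L h g =>
      have hg : res (R := R) g = elR le_top := congrArg res
        (MulActionHom.ext fun x => Subsingleton.elim _ _)
      have e : (burnside R G).actL (burnsideOne R G) (elI (R := R) h ≫ res g) =
          (burnside R G).act (elI h) ((burnside R G).act (elR le_top) (burnsideOne R G)) := by
        rw [hg]
        exact (burnside R G).act_comp (elI h) (elR le_top) (burnsideOne R G)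
      rw [e, phiGradeL_apply, ← gradeMap_phiGrade, gradeHom_gradeMap_apply,
        ← gradeHom_unitIso_unitGrade, ← gradeHom_comp, Iso.hom_inv_id, gradeHom_id]
      exact mk L h
  have h1 := key (burnsideHom (gradeVal _ H (gradeHom (unitIso R G).hom H u)))
  have h2 : (burnside R G).actL (burnsideOne R G)
      (burnsideHom (gradeVal _ H (gradeHom (unitIso R G).hom H u))) =
        gradeVal _ H (gradeHom (unitIso R G).hom H u) := act_burnsideOne _
  rwa [h2, phiGradeL_apply, phiGrade_gradeVal, ← gradeHom_comp, Iso.hom_inv_id, gradeHom_id] at h1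

theorem box_hom_ext_unit {M Q : ModuleCat.{u} (MackeyAlgebra R G)}
    {f g : box (unitModule R G) M ⟶ Q}
    (h : ∀ H (m : grade M H), gradeHom f H (boxMk (unitGrade R H) m) =
      gradeHom g H (boxMk (unitGrade R H) m)) : f = g := by
  refine box_hom_ext fun H u m => ?_
  induction u using grade_unit_ind with
  | zero => simp only [← boxMkL_apply, map_zero, LinearMap.zero_apply]
  | add x y hx hy =>
    simp only [← boxMkL_apply, map_add, LinearMap.add_apply] at hx hy ⊢
    rw [hx, hy]
  | smul r x hx =>
    simp only [← boxMkL_apply, map_smul, LinearMap.smul_apply] at hx ⊢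
    rw [hx]
  | mk L h' => rw [boxMk_elI_left, gradeHom_gradeMap_apply, gradeHom_gradeMap_apply, h]

theorem box_hom_ext_middle_unit {M N Q : ModuleCat.{u} (MackeyAlgebra R G)}
    {f g : box (box M (unitModule R G)) N ⟶ Q}
    (h : ∀ H (m : grade M H) (n : grade N H), gradeHom f H (boxMk (boxMk m (unitGrade R H)) n) =
      gradeHom g H (boxMk (boxMk m (unitGrade R H)) n)) : f = g := by
  refine box_hom_ext_left fun H m u n => ?_
  induction u using grade_unit_ind with
  | zero => simp only [← boxMkL_apply, map_zero, LinearMap.zero_apply]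
  | add x y hx hy =>
    simp only [← boxMkL_apply, map_add, LinearMap.add_apply] at hx hy ⊢
    rw [hx, hy]
  | smul r x hx =>
    simp only [← boxMkL_apply, map_smul, LinearMap.smul_apply] at hx ⊢
    rw [hx]
  | mk L h' =>
    rw [boxMk_elI_right, boxMk_elI_left, gradeHom_gradeMap_apply, gradeHom_gradeMap_apply, h]

end Unit

end MackeyBox

/-! ### Transport of the monoidal structure to modules -/

namespace MackeyBox

open FinGSet Omega

variable {R : Type u} [CommRing R] {G : Type u} [Group G] [Finite G]

theorem gradeHom_inv_hom {M N : ModuleCat.{u} (MackeyAlgebra R G)} (e : M ≅ N) {H : Subgroup G}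
    (n : grade N H) : gradeHom e.hom H (gradeHom e.inv H n) = n := by
  rw [← gradeHom_comp, Iso.inv_hom_id, gradeHom_id]

theorem gradeHom_hom_inv {M N : ModuleCat.{u} (MackeyAlgebra R G)} (e : M ≅ N) {H : Subgroup G}
    (m : grade M H) : gradeHom e.inv H (gradeHom e.hom H m) = m := by
  rw [← gradeHom_comp, Iso.hom_inv_id, gradeHom_id]

theorem gradeHom_boxMapIso_hom {M N M' N' : ModuleCat.{u} (MackeyAlgebra R G)} (e : M ≅ M')
    (e' : N ≅ N') {H : Subgroup G} (m : grade M H) (n : grade N H) :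
    gradeHom (boxMapIso e e').hom H (boxMk m n) = boxMk (gradeHom e.hom H m) (gradeHom e'.hom H n) :=
  gradeHom_boxMap _ _ m n

theorem gradeHom_boxMapIso_inv {M N M' N' : ModuleCat.{u} (MackeyAlgebra R G)} (e : M ≅ M')
    (e' : N ≅ N') {H : Subgroup G} (m : grade M' H) (n : grade N' H) :
    gradeHom (boxMapIso e e').inv H (boxMk m n) = boxMk (gradeHom e.inv H m) (gradeHom e'.inv H n) :=
  gradeHom_boxMap _ _ m n

namespace LewisBox

variable (L : LewisBox R G)

/-- Uniqueness of box products of Mackey functors. -/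
noncomputable def boxFunctorIsoObj (M N : MackeyFunctor R G) : boxFunctor M N ≅ L.obj M N where
  hom := (exists_boxFunctor_desc (L.pairing M N)).choose
  inv := lift (boxPairing M N)
  hom_inv_id := ObjectProperty.hom_ext _ (boxFunctor_hom_ext fun X Y m n => by
    refine (congrArg (ev (lift (boxPairing M N)) _)
      ((exists_boxFunctor_desc (L.pairing M N)).choose_spec X Y m n)).trans ?_
    exact lift_tmul (boxPairing M N) m n)
  inv_hom_id := hom_ext fun X Y m n => by
    rw [ev_comp, lift_tmul]
    exact (exists_boxFunctor_desc (L.pairing M N)).choose_spec X Y m n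

theorem ev_boxFunctorIsoObj {M N : MackeyFunctor R G} {X Y : FinGSet G} (m : M.val X)
    (n : N.val Y) : ev (L.boxFunctorIsoObj M N).hom _ ((boxPairing M N).toFun X Y m n) =
      L.tmul m n :=
  (exists_boxFunctor_desc (L.pairing M N)).choose_spec X Y m n

/-- The isomorphism `Φ M □ Φ N ≅ Φ (M □ N)`. -/
noncomputable def boxPhi (M N : MackeyFunctor R G) :
    box ((Phi R G).obj M) ((Phi R G).obj N) ≅ (Phi R G).obj (L.obj M N) :=
  (boxFunctorIso M N).symm ≪≫ (Phi R G).mapIso (L.boxFunctorIsoObj M N)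

/-- By `box_phi_hom_ext` this formula determines the isomorphism; the compatibilities with the
braiding and the associator are read off from it. -/
theorem boxPhi_hom_boxMk {M N : MackeyFunctor R G} {H : Subgroup G}
    (m : M.val (FinGSet.orbit H)) (n : N.val (FinGSet.orbit H)) :
    gradeHom (L.boxPhi M N).hom H (boxMk (phiGrade M H m) (phiGrade N H n)) =
      phiGrade _ H ((L.obj M N).act (res (diag _)) (L.tmul m n)) := by
  have h : (L.boxPhi M N).hom =
      (boxFunctorIso M N).inv ≫ (Phi R G).map (L.boxFunctorIsoObj M N).hom := rfl
  rw [h, gradeHom_comp, ← phiGrade_res_diag_boxPairing, gradeHom_phiGrade]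
  refine congrArg _ ?_
  rw [← ev_boxFunctorIsoObj]
  exact ev_act _ _ _

theorem boxPhi_inv_phiGrade {M N : MackeyFunctor R G} {H : Subgroup G}
    (m : M.val (FinGSet.orbit H)) (n : N.val (FinGSet.orbit H)) :
    gradeHom (L.boxPhi M N).inv H
        (phiGrade _ H ((L.obj M N).act (res (diag _)) (L.tmul m n))) =
      boxMk (phiGrade M H m) (phiGrade N H n) := by
  rw [← boxPhi_hom_boxMk, gradeHom_hom_inv]

theorem gradeHom_mapIso {M N : MackeyFunctor R G} (e : M ≅ N) {H : Subgroup G}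
    (m : M.val (FinGSet.orbit H)) : gradeHom ((Phi R G).mapIso e).hom H (phiGrade M H m) =
      phiGrade N H (ev e.hom _ m) := gradeHom_phiGrade e.hom H m

theorem iso_trans_apply {A B C : ModuleCat.{u} (MackeyAlgebra R G)} (e : A ≅ B) (f : B ≅ C)
    {H : Subgroup G} (a : grade A H) :
    gradeHom (e ≪≫ f).hom H a = gradeHom f.hom H (gradeHom e.hom H a) := rfl

theorem iso_symm_hom {A B : ModuleCat.{u} (MackeyAlgebra R G)} (e : A ≅ B) :
    e.symm.hom = e.inv := rfl

/-- The associator of the box product of modules of the form `Φ M`. -/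
noncomputable def boxAssocPhi (M N P : MackeyFunctor R G) :
    box (box ((Phi R G).obj M) ((Phi R G).obj N)) ((Phi R G).obj P) ≅
      box ((Phi R G).obj M) (box ((Phi R G).obj N) ((Phi R G).obj P)) :=
  boxMapIso (L.boxPhi M N) (Iso.refl _) ≪≫ L.boxPhi _ P ≪≫ (Phi R G).mapIso (L.assoc M N P) ≪≫
    (L.boxPhi M _).symm ≪≫ (boxMapIso (Iso.refl _) (L.boxPhi N P)).symm

theorem boxAssocPhi_boxMk {M N P : MackeyFunctor R G} {H : Subgroup G}
    (m : M.val (FinGSet.orbit H)) (n : N.val (FinGSet.orbit H)) (p : P.val (FinGSet.orbit H)) :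
    gradeHom (L.boxAssocPhi M N P).hom H
        (boxMk (boxMk (phiGrade M H m) (phiGrade N H n)) (phiGrade P H p)) =
      boxMk (phiGrade M H m) (boxMk (phiGrade N H n) (phiGrade P H p)) := by
  -- Both sides are the restriction of `m ⊠ (n ⊠ p)` along the triple diagonal of `G/H`.
  have h : ev (L.assoc M N P).hom _ ((L.obj (L.obj M N) P).act (res (diag (FinGSet.orbit H)))
      (L.tmul ((L.obj M N).act (res (diag _)) (L.tmul m n)) p)) =
      (L.obj M (L.obj N P)).act (res (diag _))
        (L.tmul m ((L.obj N P).act (res (diag _)) (L.tmul n p))) := by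
    rw [tmul_res_left, tmul_res_right, MackeyFunctor.act_res_comp, MackeyFunctor.act_res_comp,
      ev_act]
    refine (congrArg _ (L.assocHom_tmul m n p)).trans ?_
    rw [MackeyFunctor.act_res_comp]
    rfl
  simp only [boxAssocPhi, iso_trans_apply, iso_symm_hom]
  rw [gradeHom_boxMapIso_hom, boxPhi_hom_boxMk]
  change gradeHom _ H (gradeHom _ H (gradeHom _ H (gradeHom _ H (boxMk _ (phiGrade P H p))))) = _
  rw [boxPhi_hom_boxMk, gradeHom_mapIso, h, boxPhi_inv_phiGrade, gradeHom_boxMapIso_inv,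
    boxPhi_inv_phiGrade]
  rfl

/-- The left unitor of the box product of modules of the form `Φ M`. -/
noncomputable def boxLeftUnitPhi (M : MackeyFunctor R G) :
    box (unitModule R G) ((Phi R G).obj M) ≅ (Phi R G).obj M :=
  boxMapIso (unitIso R G) (Iso.refl _) ≪≫ L.boxPhi _ M ≪≫ (Phi R G).mapIso (L.leftUnit M)

theorem boxLeftUnitPhi_boxMk {M : MackeyFunctor R G} {H : Subgroup G}
    (m : M.val (FinGSet.orbit H)) : gradeHom (L.boxLeftUnitPhi M).hom H
        (boxMk (unitGrade R H) (phiGrade M H m)) = phiGrade M H m := by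
  have h : ev (L.leftUnit M).hom _ ((L.obj (burnside R G) M).act (res (diag (FinGSet.orbit H)))
      (L.tmul ((burnside R G).act (elR le_top) (burnsideOne R G)) m)) = m := by
    rw [elR, tmul_res_left, MackeyFunctor.act_res_comp, ev_act]
    refine (congrArg _ (L.leftUnitHom_one_tmul m)).trans ?_
    rw [MackeyFunctor.act_res_comp]
    exact M.act_res_id m
  simp only [boxLeftUnitPhi, iso_trans_apply]
  rw [gradeHom_boxMapIso_hom, gradeHom_unitIso_unitGrade]
  change gradeHom _ H (gradeHom _ H (boxMk _ (phiGrade M H m))) = _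
  rw [boxPhi_hom_boxMk, gradeHom_mapIso, h]

/-- A module is isomorphic to one of the form `Φ M`. -/
noncomputable def preIso (M : ModuleCat.{u} (MackeyAlgebra R G)) :
    (Phi R G).obj ((Phi R G).objPreimage M) ≅ M := (Phi R G).objObjPreimageIso M

theorem exists_phiGrade {M : ModuleCat.{u} (MackeyAlgebra R G)} {H : Subgroup G} (m : grade M H) :
    ∃ m', gradeHom (preIso M).hom H (phiGrade _ H m') = m :=
  ⟨gradeVal _ H (gradeHom (preIso M).inv H m), by rw [phiGrade_gradeVal, gradeHom_inv_hom]⟩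

/-- The associator of the box product of modules. -/
noncomputable def boxAssoc (M N P : ModuleCat.{u} (MackeyAlgebra R G)) :
    box (box M N) P ≅ box M (box N P) :=
  (boxMapIso (boxMapIso (preIso M) (preIso N)) (preIso P)).symm ≪≫ L.boxAssocPhi _ _ _ ≪≫
    boxMapIso (preIso M) (boxMapIso (preIso N) (preIso P))

/-- All elements can be taken from modules of the form `Φ M`, where the formula is known. It
involves neither `L` nor the chosen preimages, and it determines the isomorphism, so this does not
depend on them either. -/
theorem boxAssoc_boxMk {M N P : ModuleCat.{u} (MackeyAlgebra R G)} {H : Subgroup G}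
    (m : grade M H) (n : grade N H) (p : grade P H) :
    gradeHom (L.boxAssoc M N P).hom H (boxMk (boxMk m n) p) = boxMk m (boxMk n p) := by
  obtain ⟨m, rfl⟩ := exists_phiGrade m
  obtain ⟨n, rfl⟩ := exists_phiGrade n
  obtain ⟨p, rfl⟩ := exists_phiGrade p
  simp only [boxAssoc, iso_trans_apply, iso_symm_hom, gradeHom_boxMapIso_inv, gradeHom_hom_inv,
    boxAssocPhi_boxMk, gradeHom_boxMapIso_hom]

theorem boxAssoc_inv_boxMk {M N P : ModuleCat.{u} (MackeyAlgebra R G)} {H : Subgroup G}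
    (m : grade M H) (n : grade N H) (p : grade P H) :
    gradeHom (L.boxAssoc M N P).inv H (boxMk m (boxMk n p)) = boxMk (boxMk m n) p := by
  rw [← L.boxAssoc_boxMk, gradeHom_hom_inv]

/-- The left unitor of the box product of modules. -/
noncomputable def boxLeftUnit (M : ModuleCat.{u} (MackeyAlgebra R G)) :
    box (unitModule R G) M ≅ M :=
  boxMapIso (Iso.refl _) (preIso M).symm ≪≫ L.boxLeftUnitPhi _ ≪≫ preIso M

theorem boxLeftUnit_boxMk {M : ModuleCat.{u} (MackeyAlgebra R G)} {H : Subgroup G}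
    (m : grade M H) : gradeHom (L.boxLeftUnit M).hom H (boxMk (unitGrade R H) m) = m := by
  obtain ⟨m, rfl⟩ := exists_phiGrade m
  simp only [boxLeftUnit, iso_trans_apply, gradeHom_boxMapIso_hom, iso_symm_hom, gradeHom_hom_inv]
  exact congrArg _ (L.boxLeftUnitPhi_boxMk m)

theorem boxRightUnit_boxMk {M : ModuleCat.{u} (MackeyAlgebra R G)} {H : Subgroup G}
    (m : grade M H) : gradeHom (boxBraidHom M _ ≫ (L.boxLeftUnit M).hom) H
      (boxMk m (unitGrade R H)) = m := by
  rw [gradeHom_comp, boxBraidHom_boxMk, boxLeftUnit_boxMk]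

/-- The associators, unitors and braidings of the box product of modules. -/
noncomputable def boxCoherence : BoxCoherence R G where
  assoc := L.boxAssoc
  leftUnit := L.boxLeftUnit
  rightUnit M := boxBraid M _ ≪≫ L.boxLeftUnit M
  braid := boxBraid
  assoc_tmul m n p := congrArg Subtype.val (L.boxAssoc_boxMk m n p)
  leftUnit_tmul m := congrArg Subtype.val (L.boxLeftUnit_boxMk m)
  rightUnit_tmul m := congrArg Subtype.val (L.boxRightUnit_boxMk m)
  braid_tmul m n := congrArg Subtype.val (boxBraidHom_boxMk m n)

theorem box_leftUnit_naturality {M N : ModuleCat.{u} (MackeyAlgebra R G)} (f : M ⟶ N) :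
    boxMap (𝟙 _) f ≫ (L.boxLeftUnit N).hom = (L.boxLeftUnit M).hom ≫ f :=
  box_hom_ext_unit fun H m => by
    rw [gradeHom_comp, gradeHom_comp, gradeHom_boxMap, gradeHom_id, boxLeftUnit_boxMk,
      boxLeftUnit_boxMk]

theorem _root_.MackeyBox.boxBraid_naturality {M N M' N' : ModuleCat.{u} (MackeyAlgebra R G)}
    (f : M ⟶ M') (g : N ⟶ N') :
    boxMap f g ≫ boxBraidHom M' N' = boxBraidHom M N ≫ boxMap g f :=
  box_hom_ext fun H m n => by
    rw [gradeHom_comp, gradeHom_comp, gradeHom_boxMap, boxBraidHom_boxMk, boxBraidHom_boxMk,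
      gradeHom_boxMap]

theorem box_rightUnit_naturality {M N : ModuleCat.{u} (MackeyAlgebra R G)} (f : M ⟶ N) :
    boxMap f (𝟙 _) ≫ boxBraidHom N _ ≫ (L.boxLeftUnit N).hom =
      (boxBraidHom M _ ≫ (L.boxLeftUnit M).hom) ≫ f := by
  rw [← Category.assoc, boxBraid_naturality, Category.assoc, Category.assoc,
    box_leftUnit_naturality]

/-- Every coherence axiom is tested on symbols in one grade, where the associator only moves
brackets and the unitors only delete `n_H`. -/
theorem isMonoidal_box : IsMonoidal L.boxCoherence.toStruct :=
  ⟨{ L.boxCoherence.toStruct with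
      tensorHom_def := fun {M M' N N'} f g => by
        change boxMap f g = boxMap f (𝟙 N) ≫ boxMap (𝟙 M') g
        rw [← boxMap_comp, Category.id_comp, Category.comp_id]
      id_tensorHom_id := boxMap_id
      tensorHom_comp_tensorHom := fun f f' g g' => (boxMap_comp f g f' g').symm
      whiskerLeft_id := boxMap_id
      id_whiskerRight := boxMap_id
      associator_naturality := fun f g h => by
        refine box_hom_ext_left fun H m n p => ?_
        change gradeHom (boxMap (boxMap f g) h ≫ (L.boxAssoc _ _ _).hom) H _ =
          gradeHom ((L.boxAssoc _ _ _).hom ≫ boxMap f (boxMap g h)) H _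
        simp only [gradeHom_comp, gradeHom_boxMap, boxAssoc_boxMk]
      leftUnitor_naturality := L.box_leftUnit_naturality
      rightUnitor_naturality := L.box_rightUnit_naturality
      pentagon := fun M N P K => by
        refine box_hom_ext_four fun H m n p k => ?_
        change gradeHom (boxMap (L.boxAssoc M N P).hom (𝟙 K) ≫ (L.boxAssoc _ _ _).hom ≫
          boxMap (𝟙 M) (L.boxAssoc _ _ _).hom) H _ =
          gradeHom ((L.boxAssoc _ _ _).hom ≫ (L.boxAssoc _ _ _).hom) H _
        simp only [gradeHom_comp, gradeHom_boxMap, boxAssoc_boxMk, gradeHom_id]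
      triangle := fun M N => by
        refine box_hom_ext_middle_unit fun H m n => ?_
        change gradeHom ((L.boxAssoc _ _ _).hom ≫ boxMap (𝟙 M) (L.boxLeftUnit N).hom) H _ =
          gradeHom (boxMap (boxBraidHom M _ ≫ (L.boxLeftUnit M).hom) (𝟙 N)) H _
        rw [gradeHom_comp, boxAssoc_boxMk, gradeHom_boxMap, gradeHom_boxMap, boxLeftUnit_boxMk,
          boxRightUnit_boxMk, gradeHom_id, gradeHom_id] }, rfl⟩

/-- The symmetry of the box product of modules. -/
@[reducible]
noncomputable def boxSymmetric :
    letI := L.isMonoidal_box.toMonoidalCategory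
    SymmetricCategory (ModuleCat.{u} (MackeyAlgebra R G)) :=
  letI := L.isMonoidal_box.toMonoidalCategory
  { braiding := boxBraid
    braiding_naturality_left := fun f N => boxBraid_naturality f (𝟙 N)
    braiding_naturality_right := fun M _ _ g => boxBraid_naturality (𝟙 M) g
    hexagon_forward := fun M N P => by
      refine box_hom_ext_left fun H m n p => ?_
      change gradeHom ((L.boxAssoc M N P).hom ≫ boxBraidHom M (box N P) ≫
          (L.boxAssoc N P M).hom) H _ =
        gradeHom (boxMap (boxBraidHom M N) (𝟙 P) ≫ (L.boxAssoc N M P).hom ≫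
          boxMap (𝟙 N) (boxBraidHom M P)) H _
      simp only [gradeHom_comp, gradeHom_boxMap, boxAssoc_boxMk, gradeHom_id, boxBraidHom_boxMk]
    hexagon_reverse := fun M N P => by
      refine box_hom_ext_right fun H m n p => ?_
      change gradeHom ((L.boxAssoc M N P).inv ≫ boxBraidHom (box M N) P ≫
          (L.boxAssoc P M N).inv) H _ =
        gradeHom (boxMap (𝟙 M) (boxBraidHom N P) ≫ (L.boxAssoc M P N).inv ≫
          boxMap (boxBraidHom M P) (𝟙 N)) H _
      simp only [gradeHom_comp, gradeHom_boxMap, boxAssoc_inv_boxMk, gradeHom_id,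
        boxBraidHom_boxMk]
    symmetry := boxBraidHom_boxBraidHom }

end LewisBox

end MackeyBox

/-! ### `Φ` is a symmetric monoidal functor -/

namespace MackeyBox

open FinGSet Omega

variable {R : Type u} [CommRing R] {G : Type u} [Group G] [Finite G]

namespace LewisBox

variable (L : LewisBox R G)

theorem boxPhi_naturality {M N M' N' : MackeyFunctor R G} (f : M ⟶ M') (g : N ⟶ N') :
    boxMap ((Phi R G).map f) ((Phi R G).map g) ≫ (L.boxPhi M' N').hom =
      (L.boxPhi M N).hom ≫ (Phi R G).map (L.map f g) :=
  box_phi_hom_ext fun H m n => by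
    rw [gradeHom_comp, gradeHom_comp, gradeHom_boxMap, gradeHom_phiGrade, gradeHom_phiGrade,
      boxPhi_hom_boxMk, boxPhi_hom_boxMk, gradeHom_phiGrade]
    refine congrArg _ ?_
    rw [← ev_map_tmul]
    exact (ev_act _ _ _).symm

/-- The exchange of factors fixes the diagonal of `G/H`. -/
theorem boxPhi_braid (M N : MackeyFunctor R G) :
    (L.boxPhi M N).hom ≫ (Phi R G).map (L.braidHom M N) =
      boxBraidHom _ _ ≫ (L.boxPhi N M).hom :=
  box_phi_hom_ext fun H m n => by
    rw [gradeHom_comp, gradeHom_comp, boxBraidHom_boxMk, boxPhi_hom_boxMk, boxPhi_hom_boxMk,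
      gradeHom_phiGrade]
    refine congrArg _ ((ev_act _ _ _).trans ?_)
    rw [braidHom_tmul, MackeyFunctor.act_res_comp]
    rfl

/-- For `boxAssocPhi` the square commutes by construction. It then remains to identify `boxAssocPhi`
with `boxAssoc`, and both act on symbols by moving brackets. -/
theorem boxPhi_assoc (M N P : MackeyFunctor R G) :
    boxMap (L.boxPhi M N).hom (𝟙 ((Phi R G).obj P)) ≫ (L.boxPhi (L.obj M N) P).hom ≫
        (Phi R G).map (L.assocHom M N P) =
      (L.boxAssoc _ _ _).hom ≫ boxMap (𝟙 ((Phi R G).obj M)) (L.boxPhi N P).hom ≫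
        (L.boxPhi M (L.obj N P)).hom := by
  have h : (L.boxAssocPhi M N P).hom ≫ boxMap (𝟙 ((Phi R G).obj M)) (L.boxPhi N P).hom ≫
        (L.boxPhi M (L.obj N P)).hom =
      boxMap (L.boxPhi M N).hom (𝟙 ((Phi R G).obj P)) ≫ (L.boxPhi (L.obj M N) P).hom ≫
        (Phi R G).map (L.assocHom M N P) := by
    have h1 : (boxMapIso (Iso.refl _) (L.boxPhi N P)).inv ≫
        boxMap (𝟙 ((Phi R G).obj M)) (L.boxPhi N P).hom = 𝟙 _ :=
      (boxMapIso (Iso.refl _) (L.boxPhi N P)).inv_hom_id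
    simp only [boxAssocPhi, Iso.trans_hom, Iso.symm_hom, Category.assoc]
    rw [reassoc_of% h1, Iso.inv_hom_id, Category.comp_id]
    rfl
  rw [← h]
  congr 1
  refine box_hom_ext_left fun H m n p => ?_
  rw [← phiGrade_gradeVal _ _ m, ← phiGrade_gradeVal _ _ n, ← phiGrade_gradeVal _ _ p,
    boxAssocPhi_boxMk, boxAssoc_boxMk]

theorem boxPhi_leftUnit (M : MackeyFunctor R G) :
    (L.boxLeftUnit ((Phi R G).obj M)).hom =
      boxMap (unitIso R G).hom (𝟙 ((Phi R G).obj M)) ≫ (L.boxPhi _ M).hom ≫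
        (Phi R G).map (L.leftUnitHom M) := by
  refine box_hom_ext_unit fun H m => ?_
  rw [← phiGrade_gradeVal _ _ m, boxLeftUnit_boxMk]
  exact (L.boxLeftUnitPhi_boxMk _).symm

/-- Both right unitors are the braiding followed by the left unitor, so the claim follows from the
left unit and the compatibility with braidings. -/
theorem boxPhi_rightUnit (M : MackeyFunctor R G) :
    boxBraidHom _ _ ≫ (L.boxLeftUnit ((Phi R G).obj M)).hom =
      boxMap (𝟙 ((Phi R G).obj M)) (unitIso R G).hom ≫ (L.boxPhi M _).hom ≫
        (Phi R G).map (L.braidHom M _ ≫ L.leftUnitHom M) := by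
  rw [Functor.map_comp, ← Category.assoc (L.boxPhi M _).hom, boxPhi_braid, Category.assoc,
    ← Category.assoc (boxMap _ _), boxBraid_naturality, Category.assoc, boxPhi_leftUnit]

/-- `Φ` as a strong monoidal functor. -/
@[reducible]
noncomputable def coreMonoidal :
    letI := L.isMonoidal.toMonoidalCategory
    letI := L.isMonoidal_box.toMonoidalCategory
    (Phi R G).CoreMonoidal :=
  letI := L.isMonoidal.toMonoidalCategory
  letI := L.isMonoidal_box.toMonoidalCategory
  { εIso := unitIso R G
    μIso := L.boxPhi
    μIso_hom_natural_left := fun f N => by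
      have h := L.boxPhi_naturality f (𝟙 N)
      rw [CategoryTheory.Functor.map_id] at h
      exact h
    μIso_hom_natural_right := fun M f => by
      have h := L.boxPhi_naturality (𝟙 M) f
      rw [CategoryTheory.Functor.map_id] at h
      exact h
    associativity := L.boxPhi_assoc
    left_unitality := L.boxPhi_leftUnit
    right_unitality := L.boxPhi_rightUnit }

/-- `Φ` as a symmetric monoidal functor. -/
@[reducible]
noncomputable def phiBraided :
    letI := L.isMonoidal.toMonoidalCategory
    letI := L.isMonoidal_box.toMonoidalCategory
    letI := L.symmetric
    letI := L.boxSymmetric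
    (Phi R G).Braided :=
  letI := L.isMonoidal.toMonoidalCategory
  letI := L.isMonoidal_box.toMonoidalCategory
  letI := L.symmetric
  letI := L.boxSymmetric
  { toMonoidal := L.coreMonoidal.toMonoidal
    braided := L.boxPhi_braid }

end LewisBox

end MackeyBox

/-! ### The main theorem -/

theorem mainTheorem1 (R : Type u) [CommRing R] (G : Type u) [Group G] [Finite G] :
    (Phi R G).IsEquivalence ∧
    (∀ M N : ModuleCat.{u} (MackeyAlgebra R G), Function.Surjective (toBox M N)) ∧
    Nonempty (LewisBox R G) ∧
    ∀ L : LewisBox R G,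
      ∃ (a : L.Coherence) (b : BoxCoherence R G) (ha : IsMonoidal a.toStruct)
        (hb : IsMonoidal b.toStruct),
        letI : MonoidalCategory (MackeyFunctor R G) := ha.toMonoidalCategory
        letI : MonoidalCategory (ModuleCat.{u} (MackeyAlgebra R G)) := hb.toMonoidalCategory
        ∃ (_ : SymmetricCategory (MackeyFunctor R G))
          (_ : SymmetricCategory (ModuleCat.{u} (MackeyAlgebra R G)))
          (_ : (Phi R G).Braided),
          (∀ M N : MackeyFunctor R G, β_ M N = a.braid M N) ∧
          (∀ M N : ModuleCat.{u} (MackeyAlgebra R G), β_ M N = b.braid M N) ∧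
          (∀ M N : MackeyFunctor R G,
            let μ : box ((Phi R G).obj M) ((Phi R G).obj N) ⟶ (Phi R G).obj (L.obj M N) :=
              Functor.LaxMonoidal.μ (Phi R G) M N
            ∀ (H : Subgroup G) (m : M.val (FinGSet.orbit H)) (n : N.val (FinGSet.orbit H)),
              μ.hom (boxMk (phiGrade M H m) (phiGrade N H n)).1 =
              phiSingle (L.obj M N) H
                ((L.obj M N).act (Omega.res (FinGSet.diag _)) (L.tmul m n))) ∧
          let ε : unitModule R G ⟶ (Phi R G).obj (burnside R G) :=
            Functor.LaxMonoidal.ε (Phi R G)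
          ∀ (x : UnitCarrier R G) (H : Subgroup G),
            (show PhiCarrier (burnside R G) from ε.hom x) H = x H := by
  -- The braidings and the unit isomorphism agree with the required ones by definition; only the
  -- value of `μ` on `[m ⊗ n]` needs an argument.
  refine ⟨inferInstance, fun _ _ => surjective_toBox, ⟨lewisBox R G⟩, fun L =>
    ⟨L.coherence, L.boxCoherence, L.isMonoidal, L.isMonoidal_box, L.symmetric, L.boxSymmetric,
      L.phiBraided, fun _ _ => rfl, fun _ _ => rfl, fun _ _ _ m n => ?_, fun _ _ => rfl⟩⟩
  exact congrArg Subtype.val (L.boxPhi_hom_boxMk m n)
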